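/- Let $p$ be a prime and $V$ an $n$-dimensional $\mathbb{Q}$-vector space with a lattice $L$; choosing a $\mathbb{Z}$-basis of $L$, identify $V=\mathbb{Q}^n$, $L=\mathbb{Z}^n$, and write $V_{\mathbb{R}}=\mathbb{R}^n$, $V_\ell=\mathbb{Q}_\ell^n$, $L_\ell=\mathbb{Z}_\ell^n$ for every prime $\ell$. Let $e_1,\dots,e_n$ be a basis of $V_{\mathbb{R}}$ such that the norm form $N=e_1^*\cdots e_n^*$ takes rational values on $V$; thus $N$ is a polynomial with rational coefficients in the coordinates of $V$ and defines a continuous function $N:L_p\to\mathbb{Q}_p$. Let $(V_{\mathbb{R}})_+=\{x : e_i^*(x)>0 \text{ for all } i\}$. Let $f'$ be a test function away from $p$, that is, a finite $\mathbb{Z}$-linear combination of functions $v\mapsto\prod_{\ell\neq p}f_\ell(v)$ with $f_\ell:V_\ell\to\mathbb{Z}$ locally constant of compact support and $f_\ell=[L_\ell]$ for almost all $\ell$, where $[\cdot]$ denotes a characteristic function; for a compact open $U\subset L_p$ write $f'\otimes[U]$ for the function $v\mapsto f'(v)[U](v)$ on $V$. Let $C\subset V_{\mathbb{R}}$ be a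 rational simplicial cone, that is, a finite union of open cones $\{\sum_j a_jw_j : a_j>0\}$ generated by linearly independent vectors $w_1,\dots,w_r\in V$, and suppose that $C\subset(V_{\mathbb{R}})_+$. Let $\mathcal{M}(L_p)$ be the convolution ring of $p$-adic measures on $L_p$, i.e. of continuous linear functionals on the space of continuous functions $L_p\to\mathbb{Q}_p$, and let $\widetilde{\mathcal{M}}(L_p)$ be the ring of pseudo-measures, the localization of $\mathcal{M}(L_p)$ at the multiplicative set generated by the elements $\delta_0-\delta_v$ with $0\neq v\in L_p$. The Amice transform $\mathcal{A}(\mu)=\int_{L_p}q^x\,d\mu(x)=\sum_k\left(\int_{L_p}\binom{x}{k}d\mu(x)\right)(q-1)^k$ extends to $\widetilde{\mathcal{M}}(L_p)$, with values in the fraction field of the ring of power series in $q_1-1,\dots,q_n-1$ over $\mathbb{Q}_p$. For a compact open $W\subset L_p$ let $\mu_{f',C,W}\in\widetilde{\mathcal{M}}(L_p)$ be the pseudo-measure whose Amice transform is the rational function represented by the formal series $\sum_{v\in C}(f'\otimes[W])(v)\,q^v$, namely the quotient $\left(\sum_v c(v)q^v\right)/\prod_i(1-q^{w_i})$ whenever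 $w_1,\dots,w_m\in V\cap L_p$ are nonzero and the product of the formal series with $\prod_i(1-q^{w_i})$ is a finite sum $\sum_v c(v)q^v$. Put $\mu_{C,f'}=\mu_{f',C,L_p}$. Suppose that $U\subset W\subset L_p$ are compact open and that $\mu_{f',C,W}$ is a measure (for $W=L_p$ the hypothesis is that $\mu_{C,f'}$ is a measure). Then the series $$\zeta(f'\otimes[U],C;s)=\sum_{v\in C}\frac{(f'\otimes[U])(v)}{N(v)^s}$$ converges for $\operatorname{Re}(s)$ sufficiently large and has a meromorphic continuation to $\mathbb{C}$ which, for every integer $k\ge0$, is analytic at $s=-k$, and $$\int_U N(v)^k\,d\mu_{f',C,W}(v)=\zeta(f'\otimes[U],C;-k),$$ both sides being one and the same rational number. -/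

import Mathlib

noncomputable section

namespace Shintani

open scoped AbstractMeasure

/-! ### The lattice, its completion, and test functions

A finite-dimensional rational vector space `V` with a distinguished lattice `L` is written in
coordinates with respect to a `ℤ`-basis of `L`: `V = ℚ^n`, `L = ℤ^n`, `V_ℝ = ℝ^n`,
`V_ℓ = ℚ_ℓ^n`, `L_ℓ = ℤ_ℓ^n`. -/

/-- The rational vector space `V`. -/
abbrev V (n : ℕ) : Type := Fin n → ℚ

/-- `L_p = L ⊗ ℤ_p`. -/
abbrev Lp (n p : ℕ) [Fact p.Prime] : Type := Fin n → ℤ_[p]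

/-- The inclusion `V → V_ℝ`. -/
def toReal {n : ℕ} (v : V n) : Fin n → ℝ := fun i => (v i : ℝ)

/-- The inclusion `V → V_ℓ`. -/
def toLocal {n : ℕ} (l : ℕ) [Fact l.Prime] (v : V n) : Fin n → ℚ_[l] := fun i => (v i : ℚ_[l])

/-- The primes different from `p`. -/
abbrev PrimesAway (p : ℕ) : Type := {l : ℕ // l.Prime ∧ l ≠ p}

instance (p : ℕ) (l : PrimesAway p) : Fact (l : ℕ).Prime := ⟨l.2.1⟩

/-- The lattice `L_ℓ` as a subset of `V_ℓ`. -/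
def localLattice (n l : ℕ) [Fact l.Prime] : Set (Fin n → ℚ_[l]) := {x | ∀ i, ‖x i‖ ≤ 1}

/-- Step functions on `V_ℓ`: locally constant, compactly supported, integer-valued. -/
def IsStepFunction {n l : ℕ} [Fact l.Prime] (f : (Fin n → ℚ_[l]) → ℤ) : Prop :=
  IsLocallyConstant f ∧ HasCompactSupport f

open scoped Classical in
/-- The pure tensors `⨂_{ℓ ≠ p} f_ℓ`, where every `f_ℓ` is a step function on `V_ℓ` and
`f_ℓ = [L_ℓ]` for almost all `ℓ`, as functions `v ↦ ∏_{ℓ ≠ p} f_ℓ(v)` on `V` (which is dense in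
the adelic space away from `p`); all but finitely many factors of the product are `1`. -/
def pureTensors (n p : ℕ) : Set (V n → ℤ) :=
  {g | ∃ f : (l : PrimesAway p) → (Fin n → ℚ_[(l : ℕ)]) → ℤ,
      (∀ l, IsStepFunction (f l)) ∧
      {l | f l ≠ Set.indicator (localLattice n l) 1}.Finite ∧
      g = fun v => ∏ᶠ l : PrimesAway p, f l (toLocal l v)}

/-- Test functions away from `p`: finite `ℤ`-linear combinations of pure tensors. -/
def TestFunctionsAway (n p : ℕ) : AddSubgroup (V n → ℤ) := AddSubgroup.closure (pureTensors n p)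

open scoped Classical in
/-- The test function `f' ⊗ [U]` on `V`, for a subset `U` of `L_p`. -/
def tensorIndicator {n p : ℕ} [Fact p.Prime] (f : V n → ℤ) (U : Set (Lp n p)) : V n → ℤ :=
  fun v => f v * (if ∃ u ∈ U, (fun i => (u i : ℚ_[p])) = toLocal p v then 1 else 0)

/-! ### Cones -/

/-- The open cone of all positive linear combinations of the vectors `w_1, …, w_r`. -/
def openCone {n r : ℕ} (w : Fin r → Fin n → ℝ) : Set (Fin n → ℝ) :=
  {x | ∃ a : Fin r → ℝ, (∀ j, 0 < a j) ∧ x = ∑ j, a j • w j}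

/-- Rational open cones: generated by linearly independent vectors of `V`. -/
def IsRationalOpenCone {n : ℕ} (D : Set (Fin n → ℝ)) : Prop :=
  ∃ (r : ℕ) (w : Fin r → V n), LinearIndependent ℚ w ∧ D = openCone fun j => toReal (w j)

/-- Rational simplicial cones: finite unions of rational open cones. -/
def IsRationalSimplicialCone {n : ℕ} (C : Set (Fin n → ℝ)) : Prop :=
  ∃ S : Set (Set (Fin n → ℝ)), S.Finite ∧ (∀ D ∈ S, IsRationalOpenCone D) ∧ C = ⋃₀ S

/-- The open positive orthant of `V_ℝ` with respect to a basis `e`. -/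
def positiveOrthant {n : ℕ} (e : Module.Basis (Fin n) ℝ (Fin n → ℝ)) : Set (Fin n → ℝ) :=
  {x | ∀ i, 0 < e.coord i x}

/-- The product of the coordinates with respect to a basis `e` of `V_ℝ`. -/
def normForm {n : ℕ} (e : Module.Basis (Fin n) ℝ (Fin n → ℝ)) (x : Fin n → ℝ) : ℝ :=
  ∏ i, e.coord i x

/-! ### The Shintani zeta function -/

open scoped Classical in
/-- The term of index `v` of the series `∑_{v ∈ C} f(v) N(v)^{-s}`. -/
def zetaTerm {n : ℕ} (e : Module.Basis (Fin n) ℝ (Fin n → ℝ)) (f : V n → ℤ)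
    (C : Set (Fin n → ℝ)) (s : ℂ) (v : V n) : ℂ :=
  if toReal v ∈ C then (f v : ℂ) * ((normForm e (toReal v) : ℝ) : ℂ) ^ (-s) else 0

/-- `Z` is a meromorphic continuation to `ℂ` of `ζ(f, C; s) = ∑_{v ∈ C} f(v) N(v)^{-s}`, the series
being convergent for all `s` with sufficiently large real part. -/
def IsShintaniZeta {n : ℕ} (e : Module.Basis (Fin n) ℝ (Fin n → ℝ)) (f : V n → ℤ)
    (C : Set (Fin n → ℝ)) (Z : ℂ → ℂ) : Prop :=
  MeromorphicOn Z Set.univ ∧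
    ∃ σ : ℝ, ∀ s : ℂ, σ < s.re → HasSum (zetaTerm e f C s) (Z s)

/-! ### `p`-adic measures, their convolution ring, and pseudo-measures -/

section Measures

variable {n p : ℕ} [Fact p.Prime]

/-- `p`-adic measures on `L_p`: continuous `ℚ_p`-linear functionals on `C(L_p, ℚ_p)`. -/
abbrev PMeasure (n p : ℕ) [Fact p.Prime] : Type := D(Lp n p, ℚ_[p])

/-- Addition on `L_p` as a continuous map. -/
def addMap (n p : ℕ) [Fact p.Prime] : C(Lp n p × Lp n p, Lp n p) := ⟨fun x => x.1 + x.2, by fun_prop⟩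

/-- Convolution: `(μ * ν)(f) = ∫ (∫ f (v + w) dν(w)) dμ(v)`. -/
instance : Mul (PMeasure n p) := ⟨fun μ ν => AbstractMeasure.map (addMap n p) (μ.prodMk' ν)⟩

instance : One (PMeasure n p) := ⟨AbstractMeasure.dirac ℚ_[p] 0⟩

theorem conv_apply (μ ν : PMeasure n p) (f : C(Lp n p, ℚ_[p])) :
    (μ * ν) f = μ (ν.contractSnd (f.comp (addMap n p))) := rfl

theorem conv_comm (μ ν : PMeasure n p) : μ * ν = ν * μ := by
  refine DFunLike.ext _ _ fun f => ?_
  have h := congrArg (fun m : D(Lp n p × Lp n p, ℚ_[p]) => m (f.comp (addMap n p)))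
    (AbstractMeasure.prodMk_eq_prodMk' ν μ)
  refine Eq.trans ?_ h
  change μ _ = μ _
  congr 1
  ext x
  change ν _ = ν _
  congr 1
  ext y
  simp [addMap, add_comm]

/-- The convolution ring of measures on `L_p`. -/
instance : CommRing (PMeasure n p) :=
  { (inferInstance : AddCommGroup (PMeasure n p)) with
    mul := (· * ·)
    one := 1
    mul_assoc := fun a b c => by
      refine DFunLike.ext _ _ fun f => ?_
      change a _ = a _
      congr 1
      ext x
      change b _ = b _
      congr 1
      ext y
      change c _ = c _
      congr 1
      ext z
      simp [addMap, add_assoc]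
    one_mul := fun a => by
      refine DFunLike.ext _ _ fun f => ?_
      change a _ = a _
      congr 1
      ext x
      simp [addMap]
    mul_one := fun a => by
      refine DFunLike.ext _ _ fun f => ?_
      change a _ = a _
      congr 1
      ext x
      change f _ = f _
      simp [addMap]
    zero_mul := fun a => rfl
    mul_zero := fun a => by
      rw [conv_comm]
      rfl
    left_distrib := fun a b c => by
      rw [conv_comm a, conv_comm a, conv_comm a]
      rfl
    right_distrib := fun a b c => rfl
    mul_comm := conv_comm }

/-- The multiplicative set generated by the elements `δ_0 - δ_v` with `v ≠ 0` in `L_p`. -/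
def diracDifferences (n p : ℕ) [Fact p.Prime] : Submonoid (PMeasure n p) :=
  Submonoid.closure {m | ∃ v : Lp n p, v ≠ 0 ∧
    m = AbstractMeasure.dirac ℚ_[p] 0 - AbstractMeasure.dirac ℚ_[p] v}

/-- Pseudo-measures on `L_p`. -/
abbrev PseudoMeasure (n p : ℕ) [Fact p.Prime] : Type := Localization (diracDifferences n p)

/-! ### The Amice transform -/

/-- The function `x ↦ ∏_i binom(x_i, k_i)` on `L_p`. -/
def binom (k : Fin n →₀ ℕ) : C(Lp n p, ℚ_[p]) :=
  ⟨fun x => ∏ i, ((Ring.choose (x i) (k i) : ℤ_[p]) : ℚ_[p]),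
    continuous_finsetProd _ fun i _ => continuous_subtype_val.comp
      ((PadicInt.continuous_choose (k i)).comp (continuous_apply i))⟩

/-- The power series `q^α = ∑_k binom(α, k) (q - 1)^k` in the variables `T_i = q_i - 1`, for
`α` in `L_p`. -/
def qPow (α : Lp n p) : MvPowerSeries (Fin n) ℚ_[p] := fun k => binom k α

theorem binom_add (k : Fin n →₀ ℕ) (x y : Lp n p) :
    binom k (x + y) = ∑ ij ∈ Finset.HasAntidiagonal.antidiagonal k, binom ij.1 x * binom ij.2 y := by
  have h : ∀ i, ((Ring.choose ((x + y) i) (k i) : ℤ_[p]) : ℚ_[p]) =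
      ∑ ab ∈ Finset.HasAntidiagonal.antidiagonal (k i), ((Ring.choose (x i) ab.1 : ℤ_[p]) : ℚ_[p]) *
        ((Ring.choose (y i) ab.2 : ℤ_[p]) : ℚ_[p]) := fun i => by
    rw [Pi.add_apply, Ring.add_choose_eq _ (Commute.all _ _)]
    refine (map_sum (PadicInt.Coe.ringHom (p := p)) _ _).trans ?_
    exact Finset.sum_congr rfl fun ab _ => map_mul (PadicInt.Coe.ringHom (p := p)) _ _
  change ∏ i, ((Ring.choose ((x + y) i) (k i) : ℤ_[p]) : ℚ_[p]) = _
  rw [Finset.prod_congr rfl fun i _ => h i, Finset.prod_univ_sum]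
  refine Finset.sum_bij'
    (fun g _ => (Finsupp.equivFunOnFinite.symm fun i => (g i).1,
      Finsupp.equivFunOnFinite.symm fun i => (g i).2))
    (fun ij _ i => (ij.1 i, ij.2 i)) ?_ ?_ ?_ ?_ ?_
  · intro g hg
    simp only [Fintype.mem_piFinset, Finset.HasAntidiagonal.mem_antidiagonal] at hg ⊢
    ext i
    simpa using hg i
  · intro ij hij
    simp only [Fintype.mem_piFinset, Finset.HasAntidiagonal.mem_antidiagonal] at hij ⊢
    intro i
    simp [← hij]
  · intro g hg
    rfl
  · intro ij hij
    ext i <;> rfl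
  · intro g hg
    rw [Finset.prod_mul_distrib]
    rfl

/-- The Amice transform `∑_k (∫ binom(x, k) dμ(x)) (q - 1)^k` of a measure `μ`, a power series in
the variables `T_i = q_i - 1`. -/
def amice : PMeasure n p →+* MvPowerSeries (Fin n) ℚ_[p] where
  toFun μ := fun k => μ (binom k)
  map_one' := by
    ext k
    change binom k 0 = _
    rw [MvPowerSeries.coeff_one]
    split_ifs with h
    · subst h
      simp [binom]
    · obtain ⟨i, hi⟩ : ∃ i, k i ≠ 0 := by
        by_contra! hk
        exact h (Finsupp.ext hk)
      refine Finset.prod_eq_zero (Finset.mem_univ i) ?_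
      simp [Ring.choose_zero_pos ℤ_[p] (Nat.pos_of_ne_zero hi)]
  map_zero' := rfl
  map_add' _ _ := rfl
  map_mul' μ ν := by
    ext k
    refine Eq.trans ?_ (MvPowerSeries.coeff_mul k _ _).symm
    change μ.prodMk' ν ((binom k).comp (addMap n p)) = _
    have h : (binom k).comp (addMap n p) = ∑ ij ∈ Finset.HasAntidiagonal.antidiagonal k,
        ((binom ij.1).comp .fst) * ((binom ij.2).comp .snd) := by
      ext x
      rw [ContinuousMap.sum_apply]
      exact binom_add k x.1 x.2
    rw [h, map_sum]
    exact Finset.sum_congr rfl fun ij _ => AbstractMeasure.prodMk'_prod_apply μ ν _ _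

theorem amice_dirac (v : Lp n p) : amice (AbstractMeasure.dirac ℚ_[p] v) = qPow v := rfl

theorem amice_ne_zero (v : Lp n p) (hv : v ≠ 0) :
    amice (AbstractMeasure.dirac ℚ_[p] 0 - AbstractMeasure.dirac ℚ_[p] v) ≠ 0 := by
  obtain ⟨i, hi⟩ := Function.ne_iff.mp hv
  have hb : ∀ x : Lp n p, binom (Finsupp.single i 1) x = ((x i : ℤ_[p]) : ℚ_[p]) := fun x => by
    change ∏ j, ((Ring.choose (x j) (Finsupp.single i 1 j) : ℤ_[p]) : ℚ_[p]) = _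
    rw [Finset.prod_eq_single i]
    · simp
    · intro j _ hj
      simp [Finsupp.single_eq_of_ne hj]
    · simp
  intro h
  rw [map_sub] at h
  have h1 : binom (Finsupp.single i 1) (0 : Lp n p) - binom (Finsupp.single i 1) v = 0 :=
    congrFun h (Finsupp.single i 1)
  rw [hb, hb] at h1
  apply hi
  simpa using h1

theorem isUnit_amice (m : diracDifferences n p) :
    IsUnit (((algebraMap (MvPowerSeries (Fin n) ℚ_[p])
      (FractionRing (MvPowerSeries (Fin n) ℚ_[p]))).comp amice) (m : PMeasure n p)) := by
  suffices h : diracDifferences n p ≤ (IsUnit.submonoid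
      (FractionRing (MvPowerSeries (Fin n) ℚ_[p]))).comap
      ((algebraMap (MvPowerSeries (Fin n) ℚ_[p])
        (FractionRing (MvPowerSeries (Fin n) ℚ_[p]))).comp amice) from h m.2
  refine Submonoid.closure_le.mpr ?_
  rintro _ ⟨v, hv, rfl⟩
  change IsUnit (algebraMap (MvPowerSeries (Fin n) ℚ_[p])
    (FractionRing (MvPowerSeries (Fin n) ℚ_[p])) (amice _))
  rw [isUnit_iff_ne_zero]
  exact (map_ne_zero_iff _ (IsFractionRing.injective (MvPowerSeries (Fin n) ℚ_[p]) _)).mpr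
    (amice_ne_zero v hv)

/-- The Amice transform of a pseudo-measure, an element of the fraction field of the ring of power
series in `q_1 - 1, …, q_n - 1`. -/
def amicePseudo : PseudoMeasure n p →+* FractionRing (MvPowerSeries (Fin n) ℚ_[p]) :=
  IsLocalization.lift (M := diracDifferences n p) (isUnit_amice (n := n) (p := p))

/-! ### The pseudo-measure of a cone -/

/-- The vectors of `V` that lie in `L_p`. -/
def pIntegral (n p : ℕ) [Fact p.Prime] : AddSubgroup (V n) where
  carrier := {v | ∀ i, ‖(v i : ℚ_[p])‖ ≤ 1}
  zero_mem' := fun i => by simp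
  add_mem' := fun {a b} ha hb i => by
    rw [Pi.add_apply, Rat.cast_add]
    exact (Padic.nonarchimedean _ _).trans (max_le (ha i) (hb i))
  neg_mem' := fun {a} ha i => by
    rw [Pi.neg_apply, Rat.cast_neg, norm_neg]
    exact ha i

/-- The inclusion `V ∩ L_p → L_p`. -/
def toLp (v : pIntegral n p) : Lp n p := fun i => ⟨((v : V n) i : ℚ_[p]), v.2 i⟩

/-- The effect on the coefficients of a formal series `∑_v F(v) q^v` of multiplication by
`1 - q^w`. -/
def mulOneSub {A : Type*} [AddCommGroup A] (w : A) (F : A → ℤ) : A → ℤ := fun v => F v - F (v - w)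

/-- `x` is the rational function represented by the formal series `∑_v F(v) q^v`, the sum running
over `v` in `V ∩ L_p`: for suitable nonzero `w_1, …, w_m` in `V ∩ L_p`, the product of the series
with `(1 - q^{w_1}) ⋯ (1 - q^{w_m})` is a finite sum `∑_v c(v) q^v`, and
`x = (∑_v c(v) q^v) / ((1 - q^{w_1}) ⋯ (1 - q^{w_m}))`. The exponents may be negative or
non-integral, so this, rather than convergence near the origin, is the meaning of the expansion
of `x` at `q = 0`. -/
def IsRepresentedBy (x : FractionRing (MvPowerSeries (Fin n) ℚ_[p])) (F : pIntegral n p → ℤ) :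
    Prop :=
  ∃ ws : List (pIntegral n p), (∀ w ∈ ws, w ≠ 0) ∧
    (Function.support (ws.foldr mulOneSub F)).Finite ∧
    algebraMap (MvPowerSeries (Fin n) ℚ_[p]) _ (ws.map fun w => 1 - qPow (toLp w)).prod * x =
      algebraMap (MvPowerSeries (Fin n) ℚ_[p]) _
        (∑ᶠ v, (ws.foldr mulOneSub F v) • qPow (toLp v))

open scoped Classical in
/-- `ξ` is the pseudo-measure `μ_{f', C, U}`, whose Amice transform is the rational function
represented by `∑_{v ∈ C} (f' ⊗ [U])(v) q^v`. (The function `f' ⊗ [U]` vanishes outside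
`V ∩ L_p`.) -/
def IsConePseudoMeasure (f : V n → ℤ) (C : Set (Fin n → ℝ)) (U : Set (Lp n p))
    (ξ : PseudoMeasure n p) : Prop :=
  IsRepresentedBy (amicePseudo ξ) fun v =>
    if toReal (v : V n) ∈ C then tensorIndicator f U v else 0

/-! ### Integration -/

open scoped Classical in
/-- The function on `L_p` that is equal to the `k`-th power of the polynomial `N` on `U` and to `0`
outside `U`. -/
def powOn (N : MvPolynomial (Fin n) ℚ) (k : ℕ) (U : TopologicalSpace.CompactOpens (Lp n p)) :
    C(Lp n p, ℚ_[p]) where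
  toFun := Set.indicator (U : Set (Lp n p))
    fun x => (MvPolynomial.aeval (fun i => (x i : ℚ_[p])) N) ^ k
  continuous_toFun := by
    refine Continuous.indicator ?_ ?_
    · intro a ha
      rw [IsClopen.frontier_eq ⟨U.isCompact.isClosed, U.isOpen⟩] at ha
      exact ha.elim
    · simp_rw [MvPolynomial.aeval_def, MvPolynomial.eval₂_eq_eval_map]
      exact ((MvPolynomial.continuous_eval _).comp
        (continuous_pi fun i => (continuous_subtype_val (p := fun x : ℚ_[p] => ‖x‖ ≤ 1)).comp
          (continuous_apply i))).pow k

/-- The integral `∫_U N^k dμ`. -/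
def integralPow (μ : PMeasure n p) (N : MvPolynomial (Fin n) ℚ) (k : ℕ)
    (U : TopologicalSpace.CompactOpens (Lp n p)) : ℚ_[p] :=
  μ (powOn N k U)

end Measures

end Shintani

end

/-! Let `x_j` be the coordinates `e_j^*`, let `F` be the function `[C]·(f' ⊗ [U])` on `V`, and let
`Λ(h) = ∫_U h dμ` on rational polynomials `h`. The group algebra `ℚ[V]` acts on functions by
translation and on polynomials by shifts. The proof makes `F` and `Λ` solve one and the same linear
equation over `ℚ[V]`, and then inverts the coefficient of that equation by the same geometric series
on the analytic and on the `p`-adic side.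

The equation. A representation of the Amice transform says `aF = c` with `a = ∏ (1 - q^w)` and `c`
finite. The Amice transform is injective (Mahler), so this is also a convolution identity for `μ`.
After each `w` is replaced by `p^m w`, which preserves `U`, the identity can be restricted to `U`
and integrated against polynomials (`exists_integralOn_eq_pair`). But `a` may vanish at `q = 1`, so
it cannot yet be inverted there.

Cancellation (`exists_isPositive`). Here it matters that `μ` is a measure. A polynomial invariant
under `w` is killed by `1 - q^w`, so it pairs to zero with `c`. Polynomials separate points, hence
`c` vanishes in `ℚ[V/ℚw]` and is divisible by some `1 - q^{w/m}`. The factor `1 - q^w` can therefore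
be lowered to the geometric sum `1 + q^{w/m} + ⋯ + q^{(m-1)w/m}` when all `x_j(w) ≥ 0`; for `w` of
mixed signs the series is already finite. The result is a new equation with coefficient `b` whose
value at `q^v = exp(-∑ t_j x_j(v))`, for `t ≥ 0`, lies between `1` and its value at `t = 0`.

Inversion (`exists_continuation`). Divide `b` by its augmentation to get `a`, and put `D = 1 - a`.
Then `D` has augmentation `0` and `|D| ≤ ρ < 1` on `t ≥ 0`. By Mellin transform the zeta function is
`∑_i` of the Dirichlet polynomials of `D^i c`. Their geometric decay survives logarithmic
derivatives, which trade against shifts of `s`; so the series converges locally uniformly on `ℂ` and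
is entire. On polynomials `D` lowers the degree, so `Λ(N^k)` is the finite sum of the pairings of
`N^k` with `D^i c`. These pairings are exactly the values of the Dirichlet polynomials at `s = -k`,
so both sides are the same rational number. -/

noncomputable section

namespace Shintani

open MeasureTheory
open scoped AbstractMeasure

/-! ### Group algebras acting by translation -/

section Translation

variable {k A : Type*} [CommRing k] [AddCommGroup A]

/-- The action of the group algebra `k[A]` on all functions `A → k`, with `q^w` acting by
translation by `w`. -/
def act (k A : Type*) [CommRing k] [AddCommGroup A] :
    AddMonoidAlgebra k A →ₐ[k] Module.End k (A → k) :=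
  AddMonoidAlgebra.lift k _ A
    { toFun := fun w => LinearMap.funLeft k k fun v => v - w.toAdd
      map_one' := by ext F v; simp
      map_mul' := fun a b => by ext F v; simp [LinearMap.funLeft_apply, sub_sub] }

theorem act_single (w : A) (r : k) (F : A → k) (v : A) :
    act k A (.single w r) F v = r * F (v - w) := by
  simp [act, LinearMap.funLeft_apply]

theorem act_mul (a b : AddMonoidAlgebra k A) (F : A → k) :
    act k A (a * b) F = act k A a (act k A b F) := by
  simp

theorem act_one_sub (w : A) (F : A → k) (v : A) :
    act k A (1 - .single w 1) F v = F v - F (v - w) := by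
  simp [act_single]

/-- Finitely supported functions thus form a copy of the group algebra inside all functions, so that
an equation `aH = c` can be multiplied by further elements of the group algebra. -/
theorem act_coeff (a b : AddMonoidAlgebra k A) : act k A a b.coeff = (a * b).coeff := by
  induction a using AddMonoidAlgebra.induction_linear with
  | zero => ext; simp
  | add x y hx hy => rw [map_add, LinearMap.add_apply, hx, hy, add_mul]; ext; simp
  | single w r =>
    ext v
    rw [act_single]
    have := AddMonoidAlgebra.coeff_single_mul_eq_mul_coeff (x := b) (r := r) (m := w) (m₁ := v)
      (v - w) (fun m' _ => eq_sub_iff_add_eq'.symm)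
    rw [this]

/-- The product of the elements `1 - q^w` for `w` in a list. -/
def oneSubProd (k : Type*) [CommRing k] (ws : List A) : AddMonoidAlgebra k A :=
  (ws.map fun w => 1 - .single w 1).prod

@[simp] theorem oneSubProd_nil : oneSubProd k ([] : List A) = 1 := rfl

@[simp] theorem oneSubProd_cons (w : A) (ws : List A) :
    oneSubProd k (w :: ws) = (1 - .single w 1) * oneSubProd k ws := by
  simp [oneSubProd]

theorem act_oneSubProd (ws : List A) (F : A → ℤ) :
    act ℤ A (oneSubProd ℤ ws) F = ws.foldr mulOneSub F := by
  induction ws with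
  | nil => simp
  | cons w ws ih =>
    rw [oneSubProd_cons, act_mul, ih]
    ext v
    rw [act_one_sub]
    rfl

/-- A denominator may be replaced by one whose exponents are multiplied by `m`. With `m` a power of
`p`, these exponents become `p`-adically small. -/
theorem oneSubProd_dvd (m : ℕ) (ws : List A) :
    oneSubProd k ws ∣ oneSubProd k (ws.map fun w => m • w) := by
  induction ws with
  | nil => simp
  | cons w ws ih =>
    rw [List.map_cons, oneSubProd_cons, oneSubProd_cons]
    refine mul_dvd_mul ?_ ih
    have := sub_dvd_pow_sub_pow (1 : AddMonoidAlgebra k A) (.single w 1) m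
    simpa [AddMonoidAlgebra.single_pow] using this

end Translation

/-! ### Linear functionals on the group algebra -/

section SumOver

variable {k A E : Type*} [CommRing k] [AddCommGroup E] [Module k E]

/-- The linear map `∑_v c(v) q^v ↦ ∑_v c(v) φ(v)`. -/
def sumOver (φ : A → E) : AddMonoidAlgebra k A →ₗ[k] E :=
  (Finsupp.linearCombination k φ).comp (AddMonoidAlgebra.coeffLinearEquiv k).toLinearMap

theorem sumOver_apply (φ : A → E) (c : AddMonoidAlgebra k A) :
    sumOver φ c = c.coeff.sum fun v x => x • φ v := rfl

@[simp]
theorem sumOver_single (φ : A → E) (v : A) (x : k) : sumOver φ (.single v x) = x • φ v := by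
  simp [sumOver_apply]

end SumOver

/-! ### Polynomials and finite differences -/

section Polynomials

variable {n : ℕ}

/-- The action of `ℚ[V]` on polynomials, with `q^w` acting as `h ↦ h(· + w)`. -/
def shiftPoly (n : ℕ) : AddMonoidAlgebra ℚ (V n) →ₐ[ℚ] Module.End ℚ (MvPolynomial (Fin n) ℚ) :=
  AddMonoidAlgebra.lift ℚ _ (V n)
    { toFun := fun w =>
        (MvPolynomial.aeval fun i => MvPolynomial.X i + MvPolynomial.C (w.toAdd i)).toLinearMap
      map_one' := LinearMap.ext fun h => by simp
      map_mul' := fun a b => by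
        rw [Module.End.mul_eq_comp, ← AlgHom.comp_toLinearMap]
        congr 1
        ext i : 1
        simp [add_assoc] }

theorem shiftPoly_single (w : V n) (r : ℚ) (h : MvPolynomial (Fin n) ℚ) :
    shiftPoly n (.single w r) h =
      r • MvPolynomial.aeval (fun i => MvPolynomial.X i + MvPolynomial.C (w i)) h := by
  simp [shiftPoly]

theorem shiftPoly_mul (a b : AddMonoidAlgebra ℚ (V n)) (h : MvPolynomial (Fin n) ℚ) :
    shiftPoly n (a * b) h = shiftPoly n a (shiftPoly n b h) := by
  simp

theorem eval_shift (v w : V n) (h : MvPolynomial (Fin n) ℚ) :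
    MvPolynomial.eval v (MvPolynomial.aeval (fun i => MvPolynomial.X i + MvPolynomial.C (w i)) h) =
      MvPolynomial.eval (v + w) h := by
  have : (MvPolynomial.aeval v).comp
      (MvPolynomial.aeval fun i => MvPolynomial.X i + MvPolynomial.C (w i)) =
      MvPolynomial.aeval (R := ℚ) (v + w) := by
    ext i
    simp
  simpa [MvPolynomial.coe_aeval_eq_eval] using congrArg (fun φ => φ h) this

/-- The pairing of `ℚ[V]` with polynomials. -/
def pair (h : MvPolynomial (Fin n) ℚ) : AddMonoidAlgebra ℚ (V n) →ₗ[ℚ] ℚ :=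
  sumOver fun v => MvPolynomial.eval v h

theorem pair_single (h : MvPolynomial (Fin n) ℚ) (v : V n) (x : ℚ) :
    pair h (.single v x) = x * MvPolynomial.eval v h := by
  simp [pair]

theorem pair_add (g h : MvPolynomial (Fin n) ℚ) (c : AddMonoidAlgebra ℚ (V n)) :
    pair (g + h) c = pair g c + pair h c := by
  induction c using AddMonoidAlgebra.induction_linear with
  | zero => simp
  | add x y hx hy => simp only [map_add, hx, hy]; ring
  | single w r => simp only [pair_single, map_add]; ring

theorem pair_smul (r : ℚ) (h : MvPolynomial (Fin n) ℚ) (c : AddMonoidAlgebra ℚ (V n)) :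
    pair (r • h) c = r * pair h c := by
  induction c using AddMonoidAlgebra.induction_linear with
  | zero => simp
  | add x y hx hy => simp only [map_add, hx, hy]; ring
  | single w s => simp only [pair_single, MvPolynomial.smul_eval]; ring

theorem pair_zero_left (c : AddMonoidAlgebra ℚ (V n)) :
    pair (0 : MvPolynomial (Fin n) ℚ) c = 0 := by
  simpa using pair_smul 0 0 c

/-- Multiplication in `ℚ[V]` is adjoint to the shift action, since evaluating a shift of `h` at `v`
is evaluating `h` at `v + w`. -/
theorem pair_mul (b a : AddMonoidAlgebra ℚ (V n)) (h : MvPolynomial (Fin n) ℚ) :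
    pair h (b * a) = pair (shiftPoly n b h) a := by
  induction b using AddMonoidAlgebra.induction_linear with
  | zero => simp [pair_zero_left]
  | add x y hx hy => rw [add_mul, map_add, hx, hy, map_add, LinearMap.add_apply, pair_add]
  | single w r =>
    induction a using AddMonoidAlgebra.induction_linear with
    | zero => simp
    | add x y hx hy => rw [mul_add, map_add, hx, hy, map_add]
    | single v s =>
      rw [AddMonoidAlgebra.single_mul_single, pair_single, pair_single, shiftPoly_single,
        MvPolynomial.smul_eval, eval_shift, add_comm w v]
      ring

/-- Polynomials separate the elements of `ℚ[V]`. -/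
theorem eq_zero_of_pair {c : AddMonoidAlgebra ℚ (V n)} (hc : ∀ h, pair h c = 0) : c = 0 := by
  classical
  ext u
  by_contra hu
  -- A linear factor vanishing at `v` but not at `u`. The product of these over the rest of the
  -- support of `c` pairs with `c` to a nonzero multiple of the coefficient at `u`.
  have hsep : ∀ v : V n, ∃ g : MvPolynomial (Fin n) ℚ,
      v ≠ u → MvPolynomial.eval v g = 0 ∧ MvPolynomial.eval u g ≠ 0 := fun v => by
    by_cases hv : v = u
    · exact ⟨0, fun h => absurd hv h⟩
    · obtain ⟨i, hi⟩ := Function.ne_iff.mp hv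
      refine ⟨MvPolynomial.X i - MvPolynomial.C (v i), fun _ => ?_⟩
      simp [sub_ne_zero, Ne.symm hi]
  choose g hg using hsep
  have h := hc (∏ v ∈ c.coeff.support.erase u, g v)
  rw [pair, sumOver_apply, Finsupp.sum, Finset.sum_eq_single u] at h
  · rw [smul_eq_mul, mul_eq_zero, MvPolynomial.eval_prod, Finset.prod_eq_zero_iff] at h
    rcases h with h | ⟨v, hv, h⟩
    · exact hu (by simpa using h)
    · exact (hg v (Finset.ne_of_mem_erase hv)).2 h
  · intro v hv hvu
    rw [MvPolynomial.eval_prod, Finset.prod_eq_zero (Finset.mem_erase.mpr ⟨hvu, hv⟩)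
      (hg v hvu).1, smul_zero]
  · intro h'
    simp [Finsupp.notMem_support_iff.mp h']

/-- Polynomials all of whose monomials have degree less than `d`. -/
def degLT (n d : ℕ) : Submodule ℚ (MvPolynomial (Fin n) ℚ) :=
  MvPolynomial.restrictSupport ℚ {s | s.degree < d}

theorem mem_degLT_iff {d : ℕ} {h : MvPolynomial (Fin n) ℚ} :
    h ∈ degLT n d ↔ ∀ s ∈ h.support, s.degree < d := by
  simp only [degLT, MvPolynomial.mem_restrictSupport_iff]
  rfl

theorem degLT_mono {d d' : ℕ} (hd : d ≤ d') : degLT n d ≤ degLT n d' := fun _ hh =>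
  mem_degLT_iff.mpr fun s hs => (mem_degLT_iff.mp hh s hs).trans_le hd

theorem X_mul_mem_degLT {d : ℕ} {h : MvPolynomial (Fin n) ℚ} (hh : h ∈ degLT n d) (i : Fin n) :
    MvPolynomial.X i * h ∈ degLT n (d + 1) := by
  classical
  rw [mem_degLT_iff] at hh ⊢
  intro s hs
  rw [MvPolynomial.support_X_mul, Finset.mem_map] at hs
  obtain ⟨t, ht, rfl⟩ := hs
  have := hh t ht
  simp [Finsupp.degree_eq_sum] at this ⊢
  simp [Finset.sum_add_distrib, Finsupp.single_apply]
  omega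

/-- A translation does not change the top degree part of a polynomial. Checked on monomials, one
variable at a time. -/
theorem shift_sub_mem_degLT (w : V n) {d : ℕ} {h : MvPolynomial (Fin n) ℚ}
    (hh : h ∈ degLT n (d + 1)) :
    MvPolynomial.aeval (fun i => MvPolynomial.X i + MvPolynomial.C (w i)) h - h ∈ degLT n d := by
  classical
  set τ := MvPolynomial.aeval (R := ℚ)
    (fun i => MvPolynomial.X i + MvPolynomial.C (w i) : Fin n → MvPolynomial (Fin n) ℚ) with hτ
  have mono : ∀ d : ℕ, ∀ s : Fin n →₀ ℕ, s.degree = d →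
      MvPolynomial.monomial s (1 : ℚ) ∈ degLT n (d + 1) ∧
      τ (MvPolynomial.monomial s 1) - MvPolynomial.monomial s 1 ∈ degLT n d := by
    intro d
    induction d with
    | zero =>
      intro s hs
      have : s = 0 := (Finsupp.degree_eq_zero_iff s).mp hs
      subst this
      constructor
      · rw [mem_degLT_iff]
        intro s hs
        rw [MvPolynomial.support_monomial, if_neg one_ne_zero, Finset.mem_singleton] at hs
        simp [hs]
      · simp
    | succ d ih =>
      intro s hs
      obtain ⟨i, hi⟩ : ∃ i, s i ≠ 0 := by
        by_contra! h
        have : s = 0 := Finsupp.ext h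
        simp [this] at hs
      obtain ⟨t, rfl⟩ : ∃ t, s = Finsupp.single i 1 + t :=
        exists_add_of_le (by simpa using Nat.one_le_iff_ne_zero.mpr hi)
      have ht : t.degree = d := by
        simp at hs
        omega
      obtain ⟨h1, h2⟩ := ih t ht
      have hX : MvPolynomial.monomial (Finsupp.single i 1 + t) (1 : ℚ) =
          MvPolynomial.X i * MvPolynomial.monomial t 1 := by
        rw [MvPolynomial.X, MvPolynomial.monomial_mul, one_mul]
      rw [hX]
      refine ⟨X_mul_mem_degLT h1 i, ?_⟩
      -- Twisted Leibniz rule: `τ X_i = X_i + w_i` applied to a product.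
      have : τ (MvPolynomial.X i * MvPolynomial.monomial t 1) -
          MvPolynomial.X i * MvPolynomial.monomial t 1 =
          MvPolynomial.X i * (τ (MvPolynomial.monomial t 1) - MvPolynomial.monomial t 1) +
          w i • (τ (MvPolynomial.monomial t 1) - MvPolynomial.monomial t 1) +
          w i • MvPolynomial.monomial t 1 := by
        rw [map_mul, hτ, MvPolynomial.aeval_X]
        simp only [MvPolynomial.smul_eq_C_mul]
        ring
      rw [this]
      exact add_mem (add_mem (X_mul_mem_degLT h2 i)
        (Submodule.smul_mem _ _ (degLT_mono (Nat.le_succ d) h2))) (Submodule.smul_mem _ _ h1)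
  have hsum : τ h - h = ∑ s ∈ h.support, MvPolynomial.coeff s h •
      (τ (MvPolynomial.monomial s 1) - MvPolynomial.monomial s 1) := by
    conv_lhs => rw [h.as_sum, map_sum, ← Finset.sum_sub_distrib]
    refine Finset.sum_congr rfl fun s _ => ?_
    rw [smul_sub, ← map_smul, MvPolynomial.smul_monomial, smul_eq_mul, mul_one]
  rw [hsum]
  refine Submodule.sum_mem _ fun s hs => Submodule.smul_mem _ _ ?_
  exact degLT_mono (Nat.lt_succ_iff.mp (mem_degLT_iff.mp hh s hs)) (mono _ s rfl).2

/-- The sum of the coefficients. -/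
def aug (n : ℕ) : AddMonoidAlgebra ℚ (V n) →ₐ[ℚ] ℚ := AddMonoidAlgebra.lift ℚ _ (V n) 1

@[simp]
theorem aug_single (w : V n) (r : ℚ) : aug n (.single w r) = r := by
  simp [aug]

/-- On the graded pieces of the degree filtration all translations are trivial, so `a` acts there
through its augmentation. -/
theorem shiftPoly_sub_mem_degLT (a : AddMonoidAlgebra ℚ (V n)) {d : ℕ}
    {h : MvPolynomial (Fin n) ℚ} (hh : h ∈ degLT n (d + 1)) :
    shiftPoly n a h - aug n a • h ∈ degLT n d := by
  induction a using AddMonoidAlgebra.induction_linear with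
  | zero => simp
  | add x y hx hy =>
    have : shiftPoly n (x + y) h - aug n (x + y) • h =
        (shiftPoly n x h - aug n x • h) + (shiftPoly n y h - aug n y • h) := by
      rw [map_add, map_add, add_smul, LinearMap.add_apply]
      abel
    rw [this]
    exact add_mem hx hy
  | single w r =>
    rw [shiftPoly_single, aug_single, ← smul_sub]
    exact Submodule.smul_mem _ _ (shift_sub_mem_degLT w hh)

/-- Elements of augmentation zero act locally nilpotently on polynomials. -/
theorem exists_shiftPoly_pow_eq_zero {a : AddMonoidAlgebra ℚ (V n)} (ha : aug n a = 0)
    (h : MvPolynomial (Fin n) ℚ) : ∃ I, ∀ i ≥ I, shiftPoly n (a ^ i) h = 0 := by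
  have key : ∀ d : ℕ, ∀ h ∈ degLT n d, ∀ i ≥ d, shiftPoly n (a ^ i) h = 0 := by
    intro d
    induction d with
    | zero =>
      intro h hh i _
      have : h = 0 := by
        rw [← MvPolynomial.support_eq_empty, Finset.eq_empty_iff_forall_notMem]
        exact fun s hs => by simpa using mem_degLT_iff.mp hh s hs
      simp [this]
    | succ d ih =>
      intro h hh i hi
      obtain ⟨j, rfl⟩ := Nat.exists_eq_add_of_le' (Nat.one_le_of_lt hi)
      rw [pow_succ, shiftPoly_mul]
      refine ih _ ?_ j (by omega)
      simpa [ha] using shiftPoly_sub_mem_degLT a hh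
  refine ⟨h.totalDegree + 1, key _ h (mem_degLT_iff.mpr fun s hs => Nat.lt_succ_of_le ?_)⟩
  simpa [Finsupp.degree_eq_sum, Finsupp.sum_fintype] using MvPolynomial.le_totalDegree hs

/-- The difference operator `h ↦ h - h(· + w)`, `w ≠ 0`, is surjective on polynomials. -/
theorem shiftPoly_one_sub_surjective {w : V n} (hw : w ≠ 0) :
    Function.Surjective (shiftPoly n (1 - .single w 1)) := by
  classical
  obtain ⟨i₀, hi₀⟩ := Function.ne_iff.mp hw
  replace hi₀ : w i₀ ≠ 0 := hi₀
  set τ := MvPolynomial.aeval (R := ℚ)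
    (fun i => MvPolynomial.X i + MvPolynomial.C (w i) : Fin n → MvPolynomial (Fin n) ℚ) with hτ
  have happ : ∀ h, shiftPoly n (1 - .single w 1) h = h - τ h := fun h => by
    rw [map_sub, LinearMap.sub_apply, shiftPoly_single, one_smul, map_one, Module.End.one_apply]
  set Δ := shiftPoly n (1 - .single w 1) with hΔ
  -- Normalised so that translation by `w` becomes `y ↦ y + 1`.
  set y : MvPolynomial (Fin n) ℚ := (w i₀)⁻¹ • MvPolynomial.X i₀ with hy
  have hτy : τ y = y + 1 := by
    rw [hy, map_smul, hτ, MvPolynomial.aeval_X, smul_add, MvPolynomial.smul_eq_C_mul,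
      MvPolynomial.smul_eq_C_mul, ← map_mul, inv_mul_cancel₀ hi₀, map_one]
  -- For invariant `a`, the image of `a y^{j+1}` is `-(j+1) a y^j` plus lower powers of `y`, which
  -- are in the range by induction.
  have hpow : ∀ j : ℕ, ∀ a : MvPolynomial (Fin n) ℚ, τ a = a → a * y ^ j ∈ LinearMap.range Δ := by
    intro j
    induction j using Nat.strong_induction_on with
    | _ j ih =>
      intro a ha
      have h1 : Δ (a * y ^ (j + 1)) = - ∑ m ∈ Finset.range (j + 1),
          ((j + 1).choose m : ℚ) • (a * y ^ m) := by
        rw [happ, map_mul, map_pow, ha, hτy, add_pow, Finset.sum_range_succ]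
        simp only [one_pow, mul_one, Nat.choose_self, Nat.cast_one, mul_add, Finset.mul_sum]
        rw [sub_add_cancel_right]
        congr 1
        refine Finset.sum_congr rfl fun m _ => ?_
        rw [MvPolynomial.smul_eq_C_mul, map_natCast]
        ring
      rw [Finset.sum_range_succ] at h1
      have h2 : ((j + 1 : ℕ) : ℚ) • (a * y ^ j) ∈ LinearMap.range Δ := by
        have : ((j + 1 : ℕ) : ℚ) • (a * y ^ j) = - Δ (a * y ^ (j + 1)) -
            ∑ m ∈ Finset.range j, ((j + 1).choose m : ℚ) • (a * y ^ m) := by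
          rw [h1, Nat.choose_succ_self_right]
          abel
        rw [this]
        refine sub_mem (neg_mem ⟨_, rfl⟩) (Submodule.sum_mem _ fun m hm =>
          Submodule.smul_mem _ _ (ih m (Finset.mem_range.mp hm) a ha))
      have h3 := Submodule.smul_mem _ ((j + 1 : ℕ) : ℚ)⁻¹ h2
      rwa [smul_smul, inv_mul_cancel₀ (Nat.cast_ne_zero.mpr j.succ_ne_zero), one_smul] at h3
  let S : Submodule ℚ (MvPolynomial (Fin n) ℚ) :=
    Submodule.span ℚ {g | ∃ (j : ℕ) (a : MvPolynomial (Fin n) ℚ), τ a = a ∧ g = a * y ^ j}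
  have hSle : S ≤ LinearMap.range Δ := by
    refine Submodule.span_le.mpr ?_
    rintro _ ⟨j, a, ha, rfl⟩
    exact hpow j a ha
  -- Each variable is `(X_i - w_i y) + w_i y` with the first summand invariant, so the invariants
  -- and `y` generate all polynomials.
  have hX : ∀ i, ∀ g ∈ S, MvPolynomial.X i * g ∈ S := by
    intro i g hg
    induction hg using Submodule.span_induction with
    | mem g hg =>
      obtain ⟨j, a, ha, rfl⟩ := hg
      have hinv : τ ((MvPolynomial.X i - w i • y) * a) = (MvPolynomial.X i - w i • y) * a := by
        rw [map_mul, ha, map_sub, map_smul, hτy, hτ, MvPolynomial.aeval_X, smul_add,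
          MvPolynomial.smul_eq_C_mul, MvPolynomial.smul_eq_C_mul, mul_one]
        ring
      have : MvPolynomial.X i * (a * y ^ j) =
          (MvPolynomial.X i - w i • y) * a * y ^ j + w i • (a * y ^ (j + 1)) := by
        simp only [MvPolynomial.smul_eq_C_mul]
        ring
      rw [this]
      exact add_mem (Submodule.subset_span ⟨j, _, hinv, rfl⟩)
        (Submodule.smul_mem _ _ (Submodule.subset_span ⟨j + 1, a, ha, rfl⟩))
    | zero => simp
    | add x z _ _ hx hz => rw [mul_add]; exact add_mem hx hz
    | smul r x _ hx => rw [mul_smul_comm]; exact Submodule.smul_mem _ _ hx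
  have hS : ∀ h, h ∈ S := by
    intro h
    induction h using MvPolynomial.induction_on with
    | C r =>
      refine Submodule.subset_span ⟨0, MvPolynomial.C r, ?_, by simp⟩
      exact τ.commutes r
    | add a b ha hb => exact add_mem ha hb
    | mul_X a i ha => rw [mul_comm]; exact hX i a ha
  exact fun h => hSle (hS h)

end Polynomials

/-! ### Density of polynomials and injectivity of the Amice transform -/

section Density

variable {n p : ℕ} [Fact p.Prime]

theorem choose_succ_mul (x : ℤ_[p]) (k : ℕ) :
    (k + 1 : ℤ_[p]) * Ring.choose x (k + 1) = (x - k) * Ring.choose x k := by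
  have h1 := Ring.descPochhammer_eq_factorial_smul_choose x (k + 1)
  have h0 := Ring.descPochhammer_eq_factorial_smul_choose x k
  rw [descPochhammer_succ_right, Polynomial.smeval_mul, h0] at h1
  simp only [nsmul_eq_mul, Nat.factorial_succ, Nat.cast_mul, Polynomial.smeval_sub,
    Polynomial.smeval_X, pow_one, Polynomial.smeval_natCast, pow_zero, mul_one] at h1
  have hk : ((k.factorial : ℕ) : ℤ_[p]) ≠ 0 := Nat.cast_ne_zero.mpr k.factorial_ne_zero
  refine mul_left_cancel₀ hk ?_
  push_cast at h1
  linear_combination -h1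

/-- The `i`-th coordinate function on `L_p`. -/
def coordFun (n p : ℕ) [Fact p.Prime] (i : Fin n) : C(Lp n p, ℚ_[p]) :=
  ⟨fun x => (x i : ℚ_[p]), continuous_subtype_val.comp (continuous_apply i)⟩

/-- The point is that the span of the binomial functions is stable under multiplication by the
coordinates. -/
theorem binom_add_single (k : Fin n →₀ ℕ) (i : Fin n) (x : Lp n p) :
    (x i : ℚ_[p]) * binom k x =
      (k i + 1) * binom (k + Finsupp.single i 1) x + k i * binom k x := by
  classical
  have h : ∀ l : Fin n →₀ ℕ, binom l x = ((Ring.choose (x i) (l i) : ℤ_[p]) : ℚ_[p]) *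
      ∏ j ∈ Finset.univ.erase i, ((Ring.choose (x j) (l j) : ℤ_[p]) : ℚ_[p]) := fun l =>
    (Finset.mul_prod_erase _ _ (Finset.mem_univ i)).symm
  have h' : ∏ j ∈ Finset.univ.erase i,
        ((Ring.choose (x j) ((k + Finsupp.single i 1 : Fin n →₀ ℕ) j) : ℤ_[p]) : ℚ_[p]) =
      ∏ j ∈ Finset.univ.erase i, ((Ring.choose (x j) (k j) : ℤ_[p]) : ℚ_[p]) :=
    Finset.prod_congr rfl fun j hj => by
      rw [show (k + Finsupp.single i 1 : Fin n →₀ ℕ) j = k j + Finsupp.single i 1 j from rfl,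
        Finsupp.single_eq_of_ne (Finset.ne_of_mem_erase hj), add_zero]
  rw [h, h, h']
  have hc := congrArg (fun z : ℤ_[p] => (z : ℚ_[p])) (choose_succ_mul (x i) (k i))
  simp only [PadicInt.coe_mul, PadicInt.coe_add, PadicInt.coe_natCast, PadicInt.coe_one,
    PadicInt.coe_sub] at hc
  rw [show (k + Finsupp.single i 1 : Fin n →₀ ℕ) i = k i + Finsupp.single i 1 i from rfl,
    Finsupp.single_eq_same]
  linear_combination -(∏ j ∈ Finset.univ.erase i,
    ((Ring.choose (x j) (k j) : ℤ_[p]) : ℚ_[p])) * hc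

/-- The functions preserving a closed subspace under multiplication. -/
def multipliers (S : Submodule ℚ_[p] C(Lp n p, ℚ_[p])) : Subalgebra ℚ_[p] C(Lp n p, ℚ_[p]) where
  carrier := {g | ∀ f ∈ S, g * f ∈ S}
  mul_mem' := fun {a b} ha hb f hf => by
    rw [mul_assoc]
    exact ha _ (hb f hf)
  add_mem' := fun {a b} ha hb f hf => by
    rw [add_mul]
    exact add_mem (ha f hf) (hb f hf)
  algebraMap_mem' := fun r f hf => by
    rw [← Algebra.smul_def]
    exact S.smul_mem r hf

theorem isClosed_multipliers {S : Submodule ℚ_[p] C(Lp n p, ℚ_[p])}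
    (hS : IsClosed (S : Set C(Lp n p, ℚ_[p]))) :
    IsClosed (multipliers S : Set C(Lp n p, ℚ_[p])) := by
  have : (multipliers S : Set C(Lp n p, ℚ_[p])) =
      ⋂ f ∈ S, (fun g => g * f) ⁻¹' (S : Set C(Lp n p, ℚ_[p])) := by
    ext g
    simp [multipliers]
  rw [this]
  exact isClosed_biInter fun f _ => hS.preimage (by fun_prop)

/-- A closed subalgebra of `C(L_p, ℚ_p)` containing the coordinate functions contains all
continuous functions of one coordinate. -/
theorem comp_coord_mem {T : Subalgebra ℚ_[p] C(Lp n p, ℚ_[p])}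
    (hT : IsClosed (T : Set C(Lp n p, ℚ_[p]))) {i : Fin n} (hi : coordFun n p i ∈ T)
    (φ : C(ℤ_[p], ℚ_[p])) : φ.comp ⟨fun x : Lp n p => x i, continuous_apply i⟩ ∈ T := by
  set π : C(Lp n p, ℤ_[p]) := ⟨fun x : Lp n p => x i, continuous_apply i⟩ with hπ
  let ch : ℕ → C(Lp n p, ℚ_[p]) := fun k =>
    ⟨fun x => ((Ring.choose (x i) k : ℤ_[p]) : ℚ_[p]), continuous_subtype_val.comp
      ((PadicInt.continuous_choose k).comp (continuous_apply i))⟩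
  have hch : ∀ k, ch k ∈ T := by
    intro k
    induction k with
    | zero =>
      have : ch 0 = 1 := by
        ext x
        simp [ch]
      rw [this]
      exact one_mem T
    | succ k ih =>
      have : ch (k + 1) = algebraMap ℚ_[p] _ ((k + 1 : ℚ_[p])⁻¹) *
          ((coordFun n p i - algebraMap ℚ_[p] _ (k : ℚ_[p])) * ch k) := by
        ext x
        have hk : (k + 1 : ℚ_[p]) ≠ 0 := by exact_mod_cast k.succ_ne_zero
        have hc := congrArg (fun z : ℤ_[p] => (z : ℚ_[p])) (choose_succ_mul (x i) k)
        simp only [PadicInt.coe_mul, PadicInt.coe_add, PadicInt.coe_natCast, PadicInt.coe_one,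
          PadicInt.coe_sub] at hc
        change ((Ring.choose (x i) (k + 1) : ℤ_[p]) : ℚ_[p]) = (k + 1 : ℚ_[p])⁻¹ *
          (((x i : ℚ_[p]) - k) * ((Ring.choose (x i) k : ℤ_[p]) : ℚ_[p]))
        rw [← hc, inv_mul_cancel_left₀ hk]
      rw [this]
      exact mul_mem (T.algebraMap_mem _) (mul_mem (sub_mem hi (T.algebraMap_mem _)) ih)
  have : IsBoundedSMul ℤ_[p] ℚ_[p] := IsBoundedSMul.of_norm_smul_le fun x y => by
    rw [Algebra.smul_def, norm_mul]
    rfl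
  -- Mahler's theorem in one variable: `φ` is a uniform limit of combinations of binomials, and
  -- those are polynomials in the coordinate.
  have hsum := PadicInt.hasSum_mahler φ
  have hcont : Continuous fun ψ : C(ℤ_[p], ℚ_[p]) => ψ.comp π := ContinuousMap.continuous_precomp π
  refine hT.mem_of_tendsto ((hcont.tendsto φ).comp hsum) (Filter.Eventually.of_forall fun s => ?_)
  have : (∑ k ∈ s, PadicInt.mahlerTerm (((fwdDiff 1)^[k] φ) 0) k : C(ℤ_[p], ℚ_[p])).comp π =
      ∑ k ∈ s, algebraMap ℚ_[p] _ (((fwdDiff 1)^[k] φ) 0) * ch k := by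
    ext x
    simp only [ContinuousMap.comp_apply, ContinuousMap.sum_apply, PadicInt.mahlerTerm_apply]
    refine Finset.sum_congr rfl fun k _ => ?_
    exact mul_comm _ _
  exact (congrArg (· ∈ T) this).mpr <| sum_mem fun k _ => mul_mem (T.algebraMap_mem _) (hch k)

theorem mem_closedBall_iff_toZModPow (m : ℕ) (x y : ℤ_[p]) :
    y ∈ Metric.closedBall x ((p : ℝ) ^ (-m : ℤ)) ↔
      PadicInt.toZModPow m y = PadicInt.toZModPow m x := by
  rw [Metric.mem_closedBall, dist_eq_norm, PadicInt.norm_le_pow_iff_mem_span_pow,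
    ← PadicInt.ker_toZModPow, RingHom.mem_ker, map_sub, sub_eq_zero]

theorem zpow_neg_pos (p m : ℕ) [Fact p.Prime] : (0 : ℝ) < (p : ℝ) ^ (-m : ℤ) :=
  zpow_pos (by exact_mod_cast (Fact.out : p.Prime).pos) _

/-- Points of `L_p` congruent modulo a high power of `p` are close. -/
theorem exists_pow_forall_dist_lt (p : ℕ) [Fact p.Prime] {δ : ℝ} (hδ : 0 < δ) :
    ∃ m : ℕ, ∀ n : ℕ, ∀ x y : Lp n p,
      (∀ i, PadicInt.toZModPow m (x i) = PadicInt.toZModPow m (y i)) → dist x y < δ := by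
  obtain ⟨m, hm⟩ := PadicInt.exists_pow_neg_lt p hδ
  refine ⟨m, fun n x y h => ?_⟩
  rw [dist_pi_lt_iff hδ]
  intro i
  exact lt_of_le_of_lt ((mem_closedBall_iff_toZModPow m (y i) (x i)).mpr (h i)) hm

/-- A closed subalgebra of `C(L_p, ℚ_p)` containing the coordinate functions is everything. -/
theorem subalgebra_eq_top {T : Subalgebra ℚ_[p] C(Lp n p, ℚ_[p])}
    (hT : IsClosed (T : Set C(Lp n p, ℚ_[p]))) (hc : ∀ i, coordFun n p i ∈ T) : T = ⊤ := by
  classical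
  refine eq_top_iff.mpr fun g _ => ?_
  rw [← SetLike.mem_coe, ← hT.closure_eq, Metric.mem_closure_iff]
  intro ε hε
  obtain ⟨δ, hδ, hg⟩ := Metric.uniformContinuous_iff.mp
    (CompactSpace.uniformContinuous_of_continuous g.continuous) (ε / 2) (half_pos hε)
  obtain ⟨m, hm⟩ := exists_pow_forall_dist_lt p hδ
  have : NeZero (p ^ m) := ⟨pow_ne_zero _ (Fact.out : p.Prime).ne_zero⟩
  let l : ZMod (p ^ m) → ℤ_[p] := fun a => ((a.val : ℕ) : ℤ_[p])
  have hl : ∀ a, PadicInt.toZModPow m (l a) = a := fun a => by simp [l]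
  let φ : ZMod (p ^ m) → C(ℤ_[p], ℚ_[p]) := fun a =>
    ⟨(Metric.closedBall (l a) ((p : ℝ) ^ (-m : ℤ))).indicator fun _ => 1,
      (IsUltrametricDist.isClopen_closedBall _ (zpow_neg_pos p m).ne').continuous_indicator
        continuous_const⟩
  -- The step function sampling `g` at one representative of each class modulo `p^m`; every
  -- indicator is a product of functions of one coordinate.
  let G : C(Lp n p, ℚ_[p]) := ∑ a : Fin n → ZMod (p ^ m),
    algebraMap ℚ_[p] _ (g fun i => l (a i)) *
      ∏ i, (φ (a i)).comp ⟨fun x : Lp n p => x i, continuous_apply i⟩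
  refine ⟨G, sum_mem fun a _ => mul_mem (T.algebraMap_mem _)
    (prod_mem fun i _ => comp_coord_mem hT (hc i) _), ?_⟩
  refine lt_of_le_of_lt ?_ (half_lt_self hε)
  rw [ContinuousMap.dist_le (half_pos hε).le]
  intro x
  have hG : G x = g fun i => l (PadicInt.toZModPow m (x i)) := by
    simp only [G, ContinuousMap.sum_apply, ContinuousMap.mul_apply, ContinuousMap.prod_apply]
    rw [Finset.sum_eq_single fun i => PadicInt.toZModPow m (x i)]
    · rw [Finset.prod_eq_one, mul_one]
      · rfl
      · intro i _
        refine Set.indicator_of_mem (M := ℚ_[p]) (a := x i) (f := fun _ => 1) ?_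
        rw [mem_closedBall_iff_toZModPow, hl]
    · intro a _ ha
      obtain ⟨i, hi⟩ := Function.ne_iff.mp ha
      rw [Finset.prod_eq_zero (Finset.mem_univ i), mul_zero]
      refine Set.indicator_of_notMem (M := ℚ_[p]) (a := x i) (f := fun _ => 1) ?_
      rw [mem_closedBall_iff_toZModPow, hl]
      exact Ne.symm hi
    · intro h
      exact absurd (Finset.mem_univ _) h
  rw [hG]
  exact (hg (hm n _ _ fun i => (hl _).symm)).le

/-- Mahler density in several variables. The multipliers of the closed span form a closed subalgebra
containing the coordinates, hence are all continuous functions; applying them to `1 = binom 0` gives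
everything. -/
theorem topologicalClosure_span_binom :
    (Submodule.span ℚ_[p] (Set.range (binom : (Fin n →₀ ℕ) → C(Lp n p, ℚ_[p])))).topologicalClosure
      = ⊤ := by
  set S₀ := Submodule.span ℚ_[p] (Set.range (binom : (Fin n →₀ ℕ) → C(Lp n p, ℚ_[p])))
  have hcl := S₀.isClosed_topologicalClosure
  have hX : ∀ i, coordFun n p i ∈ multipliers S₀.topologicalClosure := by
    intro i f hf
    have hmaps : Set.MapsTo (fun f => coordFun n p i * f) (S₀ : Set C(Lp n p, ℚ_[p])) S₀ := by
      intro f hf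
      induction hf using Submodule.span_induction with
      | mem f hf =>
        obtain ⟨k, rfl⟩ := hf
        have : coordFun n p i * binom k =
            (k i + 1 : ℚ_[p]) • binom (k + Finsupp.single i 1) + (k i : ℚ_[p]) • binom k := by
          ext x
          exact binom_add_single k i x
        change coordFun n p i * binom k ∈ S₀
        rw [this]
        exact add_mem (S₀.smul_mem _ (Submodule.subset_span ⟨_, rfl⟩))
          (S₀.smul_mem _ (Submodule.subset_span ⟨_, rfl⟩))
      | zero => simp
      | add x y _ _ hx hy =>
        simp only [mul_add]
        exact add_mem hx hy
      | smul r x _ hx =>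
        simp only [mul_smul_comm]
        exact S₀.smul_mem _ hx
    exact map_mem_closure (by fun_prop) hf hmaps
  have htop := subalgebra_eq_top (isClosed_multipliers hcl) hX
  have h1 : (1 : C(Lp n p, ℚ_[p])) ∈ S₀.topologicalClosure := by
    refine S₀.le_topologicalClosure (Submodule.subset_span ⟨0, ?_⟩)
    ext x
    simp [binom]
  refine eq_top_iff.mpr fun g _ => ?_
  have hg : g ∈ multipliers S₀.topologicalClosure := htop ▸ Algebra.mem_top
  simpa using hg 1 h1

/-- The coefficients of the transform are the values on the binomials, and a continuous functional
is determined on a dense subspace. -/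
theorem amice_injective : Function.Injective (amice (n := n) (p := p)) := by
  intro μ ν h
  refine DFunLike.ext _ _ fun f => ?_
  let L : C(Lp n p, ℚ_[p]) →L[ℚ_[p]] ℚ_[p] :=
    AbstractMeasure.toCLMEquiv μ - AbstractMeasure.toCLMEquiv ν
  have hle : Submodule.span ℚ_[p] (Set.range (binom : (Fin n →₀ ℕ) → C(Lp n p, ℚ_[p]))) ≤
      LinearMap.ker (L : C(Lp n p, ℚ_[p]) →ₗ[ℚ_[p]] ℚ_[p]) := by
    refine Submodule.span_le.mpr ?_
    rintro _ ⟨k, rfl⟩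
    exact sub_eq_zero.mpr (congrFun h k)
  have hcl := Submodule.topologicalClosure_minimal _ hle L.isClosed_ker
  rw [topologicalClosure_span_binom] at hcl
  exact sub_eq_zero.mp (hcl (Submodule.mem_top : f ∈ ⊤))

end Density

/-! ### Restriction of measures and the functional equation on polynomials -/

section Restriction

variable {n p : ℕ} [Fact p.Prime]

theorem toLp_add (v w : pIntegral n p) : toLp (v + w) = toLp v + toLp w := by
  refine funext fun i => Subtype.ext ?_
  change (((v : V n) i + (w : V n) i : ℚ) : ℚ_[p]) = ((v : V n) i : ℚ_[p]) + ((w : V n) i : ℚ_[p])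
  push_cast
  rfl

/-- The ring homomorphism `q^v ↦ δ_v`. -/
def diracHom (n p : ℕ) [Fact p.Prime] : AddMonoidAlgebra ℤ (pIntegral n p) →ₐ[ℤ] PMeasure n p :=
  AddMonoidAlgebra.lift ℤ _ _
    { toFun := fun v => AbstractMeasure.dirac ℚ_[p] (toLp v.toAdd)
      map_one' := by
        have : toLp (0 : pIntegral n p) = 0 := by
          ext i
          simp [toLp]
        change AbstractMeasure.dirac ℚ_[p] (toLp (0 : pIntegral n p)) = _
        rw [this]
        rfl
      map_mul' := fun a b => by
        rw [toAdd_mul, toLp_add]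
        rfl }

theorem diracHom_single (v : pIntegral n p) (k : ℤ) :
    diracHom n p (.single v k) = k • AbstractMeasure.dirac ℚ_[p] (toLp v) := by
  simp [diracHom]

theorem dirac_mul_apply (v : Lp n p) (μ : PMeasure n p) (g : C(Lp n p, ℚ_[p])) :
    (AbstractMeasure.dirac ℚ_[p] v * μ : PMeasure n p) g =
      μ (g.comp ⟨fun x => v + x, by fun_prop⟩) := rfl

theorem zsmul_measure_apply (k : ℤ) (μ : PMeasure n p) (g : C(Lp n p, ℚ_[p])) :
    (k • μ) g = k • μ g := by
  let L : PMeasure n p →+ ℚ_[p] := ⟨⟨fun μ => μ g, rfl⟩, fun _ _ => rfl⟩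
  exact map_zsmul L k μ

theorem measure_add_apply (μ ν : PMeasure n p) (g : C(Lp n p, ℚ_[p])) :
    (μ + ν) g = μ g + ν g := rfl

/-- A representation of the Amice transform of a measure gives an identity of measures. -/
theorem diracHom_mul_eq {μ : PMeasure n p} {F : pIntegral n p → ℤ} {ws : List (pIntegral n p)}
    {c : AddMonoidAlgebra ℤ (pIntegral n p)} (hc : ws.foldr mulOneSub F = c.coeff)
    (h : (ws.map fun w => 1 - qPow (toLp w)).prod * amice μ =
      ∑ᶠ v, (ws.foldr mulOneSub F v) • qPow (toLp v)) :
    diracHom n p (oneSubProd ℤ ws) * μ = diracHom n p c := by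
  apply amice_injective
  rw [map_mul]
  have h1 : amice (diracHom n p (oneSubProd ℤ ws)) =
      (ws.map fun w => 1 - qPow (toLp w)).prod := by
    rw [oneSubProd, map_list_prod, map_list_prod, List.map_map, List.map_map]
    congr 1
    refine List.map_congr_left fun w _ => ?_
    simp [diracHom_single, amice_dirac]
  rw [h1, h, hc]
  have h2 : amice (diracHom n p c) = sumOver (k := ℤ) (fun v => qPow (toLp v)) c := by
    clear hc h h1
    induction c using AddMonoidAlgebra.induction_linear with
    | zero => simp
    | add x y hx hy => rw [map_add, map_add, map_add, hx, hy]
    | single v k => simp [diracHom_single, amice_dirac]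
  rw [h2, sumOver_apply, Finsupp.sum]
  refine finsum_eq_sum_of_support_subset _ fun v hv => ?_
  rw [Finset.mem_coe, Finsupp.mem_support_iff]
  intro h0
  exact hv (by simp only [h0, zero_smul])

/-- The characteristic function of a compact open set. -/
def indicatorFun (U : TopologicalSpace.CompactOpens (Lp n p)) : C(Lp n p, ℚ_[p]) :=
  ⟨(U : Set (Lp n p)).indicator fun _ => 1,
    IsClopen.continuous_indicator ⟨U.isCompact.isClosed, U.isOpen⟩ continuous_const⟩

/-- The restriction of a measure to a compact open set. -/
def restrictTo (U : TopologicalSpace.CompactOpens (Lp n p)) (μ : PMeasure n p) : PMeasure n p :=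
  AbstractMeasure.toCLMEquiv.symm ((AbstractMeasure.toCLMEquiv μ).comp
    (ContinuousLinearMap.mul ℚ_[p] C(Lp n p, ℚ_[p]) (indicatorFun U)))

theorem restrictTo_apply (U : TopologicalSpace.CompactOpens (Lp n p)) (μ : PMeasure n p)
    (g : C(Lp n p, ℚ_[p])) : restrictTo U μ g = μ (indicatorFun U * g) := rfl

theorem restrictTo_sub (U : TopologicalSpace.CompactOpens (Lp n p)) (μ ν : PMeasure n p) :
    restrictTo U (μ - ν) = restrictTo U μ - restrictTo U ν := rfl

/-- Convolution with `δ_v` is translation by `v`, which commutes with cutting off to a `v`-invariant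
set. -/
theorem restrictTo_dirac_mul {U : TopologicalSpace.CompactOpens (Lp n p)} {v : Lp n p}
    (hv : ∀ x, x + v ∈ U ↔ x ∈ U) (μ : PMeasure n p) :
    restrictTo U (AbstractMeasure.dirac ℚ_[p] v * μ) =
      AbstractMeasure.dirac ℚ_[p] v * restrictTo U μ := by
  classical
  refine DFunLike.ext _ _ fun g => ?_
  rw [restrictTo_apply, dirac_mul_apply, dirac_mul_apply, restrictTo_apply]
  congr 1
  ext x
  change (U : Set (Lp n p)).indicator (fun _ => (1 : ℚ_[p])) (v + x) * g (v + x) =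
    (U : Set (Lp n p)).indicator (fun _ => (1 : ℚ_[p])) x * g (v + x)
  congr 1
  have := hv x
  rw [add_comm x v] at this
  simp only [Set.indicator_apply, SetLike.mem_coe, this]

/-- A compact open set is invariant under translation by a small enough subgroup. -/
theorem exists_pow_translation_invariant (U : TopologicalSpace.CompactOpens (Lp n p)) :
    ∃ m : ℕ, ∀ v : Lp n p, (∀ i, PadicInt.toZModPow m (v i) = 0) → ∀ x, x + v ∈ U ↔ x ∈ U := by
  classical
  -- The values `0` and `1` are at distance `1`, so an oscillation below `1` forces the
  -- characteristic function to be constant.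
  obtain ⟨δ, hδ, hg⟩ := Metric.uniformContinuous_iff.mp
    (CompactSpace.uniformContinuous_of_continuous (indicatorFun U).continuous) 1 one_pos
  obtain ⟨m, hm⟩ := exists_pow_forall_dist_lt p hδ
  refine ⟨m, fun v hv x => ?_⟩
  have h := hg (hm n (x + v) x fun i => by rw [Pi.add_apply, map_add, hv, add_zero])
  change dist ((U : Set (Lp n p)).indicator (fun _ => (1 : ℚ_[p])) (x + v))
    ((U : Set (Lp n p)).indicator (fun _ => (1 : ℚ_[p])) x) < 1 at h
  by_cases h1 : x + v ∈ U <;> by_cases h2 : x ∈ U <;>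
    simp [h1, h2] at h ⊢

/-- The inclusion `ℤ[V ∩ L_p] → ℚ[V]`. -/
def inclHom (n p : ℕ) [Fact p.Prime] :
    AddMonoidAlgebra ℤ (pIntegral n p) →ₐ[ℤ] AddMonoidAlgebra ℚ (V n) :=
  AddMonoidAlgebra.lift ℤ _ _
    ((AddMonoidAlgebra.of ℚ (V n)).comp (AddMonoidHom.toMultiplicative (pIntegral n p).subtype))

theorem inclHom_single (v : pIntegral n p) (k : ℤ) :
    inclHom n p (.single v k) = .single (v : V n) (k : ℚ) := by
  simp [inclHom]

theorem inclHom_oneSubProd (ws : List (pIntegral n p)) :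
    inclHom n p (oneSubProd ℤ ws) = oneSubProd ℚ (ws.map (pIntegral n p).subtype) := by
  rw [oneSubProd, oneSubProd, map_list_prod, List.map_map, List.map_map]
  congr 1
  refine List.map_congr_left fun w _ => ?_
  simp [inclHom_single]

open scoped Classical in
/-- Extension by zero of functions on `V ∩ L_p`. -/
def extendZero (F : pIntegral n p → ℤ) : V n → ℚ :=
  fun v => if h : v ∈ pIntegral n p then (F ⟨v, h⟩ : ℚ) else 0

theorem extendZero_add (F G : pIntegral n p → ℤ) :
    extendZero (F + G) = extendZero F + extendZero G := by
  ext v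
  by_cases h : v ∈ pIntegral n p <;> simp [extendZero, h]

/-- Extension by zero is equivariant because `V ∩ L_p` is a subgroup: for `w` in it, `v` and `v - w`
lie in it simultaneously. -/
theorem act_inclHom (x : AddMonoidAlgebra ℤ (pIntegral n p)) (F : pIntegral n p → ℤ) :
    act ℚ (V n) (inclHom n p x) (extendZero F) = extendZero (act ℤ _ x F) := by
  induction x using AddMonoidAlgebra.induction_linear with
  | zero => ext v; simp [extendZero]
  | add x y hx hy =>
    rw [map_add, map_add, LinearMap.add_apply, hx, hy, map_add, LinearMap.add_apply,
      extendZero_add]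
  | single w k =>
    ext v
    rw [inclHom_single, act_single]
    by_cases h : v ∈ pIntegral n p
    · have h' : v - w ∈ pIntegral n p := sub_mem h w.2
      rw [extendZero, extendZero, dif_pos h, dif_pos h', act_single]
      push_cast
      rfl
    · have h' : v - w ∉ pIntegral n p := fun h' => h (by simpa using add_mem h' w.2)
      rw [extendZero, extendZero, dif_neg h, dif_neg h', mul_zero]

theorem inclHom_coeff (x : AddMonoidAlgebra ℤ (pIntegral n p)) :
    (inclHom n p x).coeff = extendZero x.coeff := by
  classical
  induction x using AddMonoidAlgebra.induction_linear with
  | zero => ext v; simp [extendZero]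
  | add x y hx hy =>
    have : ((x + y).coeff : pIntegral n p → ℤ) = x.coeff + y.coeff := rfl
    rw [this, extendZero_add, ← hx, ← hy, map_add]
    rfl
  | single w k =>
    ext v
    rw [inclHom_single]
    by_cases h : v ∈ pIntegral n p
    · rw [extendZero, dif_pos h]
      simp only [AddMonoidAlgebra.coeff_single, Finsupp.single_apply, Subtype.ext_iff]
      split_ifs <;> simp
    · rw [extendZero, dif_neg h, AddMonoidAlgebra.coeff_single, Finsupp.single_apply, if_neg]
      rintro rfl
      exact h w.2

/-- The continuous function on `L_p` defined by a polynomial. -/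
def polyFun (n p : ℕ) [Fact p.Prime] : MvPolynomial (Fin n) ℚ →ₐ[ℚ] C(Lp n p, ℚ_[p]) :=
  MvPolynomial.aeval (coordFun n p)

theorem polyFun_apply (h : MvPolynomial (Fin n) ℚ) (x : Lp n p) :
    polyFun n p h x = MvPolynomial.aeval (fun i => (x i : ℚ_[p])) h := by
  let ev : C(Lp n p, ℚ_[p]) →ₐ[ℚ] ℚ_[p] :=
    (ContinuousMap.evalAlgHom ℚ_[p] ℚ_[p] x).restrictScalars ℚ
  have : ev.comp (polyFun n p) = MvPolynomial.aeval fun i => (x i : ℚ_[p]) := by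
    ext i
    simp only [polyFun, AlgHom.comp_apply, MvPolynomial.aeval_X]
    rfl
  exact congrArg (fun φ => φ h) this

theorem polyFun_toLp (h : MvPolynomial (Fin n) ℚ) (v : pIntegral n p) :
    polyFun n p h (toLp v) = (MvPolynomial.eval (v : V n) h : ℚ) := by
  rw [polyFun_apply]
  have := MvPolynomial.aeval_algebraMap_apply ℚ_[p] (v : V n) h
  simpa [toLp, Function.comp_def, MvPolynomial.coe_aeval_eq_eval] using this

theorem polyFun_comp_add (h : MvPolynomial (Fin n) ℚ) (w : pIntegral n p) :
    (polyFun n p h).comp ⟨fun x => toLp w + x, by fun_prop⟩ =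
      polyFun n p (shiftPoly n (.single (w : V n) 1) h) := by
  ext x
  rw [ContinuousMap.comp_apply, polyFun_apply, polyFun_apply, shiftPoly_single, one_smul]
  have : (MvPolynomial.aeval fun i => (x i : ℚ_[p])).comp
      (MvPolynomial.aeval fun i => MvPolynomial.X i + MvPolynomial.C ((w : V n) i)) =
      MvPolynomial.aeval (R := ℚ) fun i => ((toLp w + x) i : ℚ_[p]) := by
    ext i
    simp only [AlgHom.comp_apply, MvPolynomial.aeval_X, map_add, MvPolynomial.aeval_C]
    exact add_comm _ _
  exact (congrArg (fun φ => φ h) this).symm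

theorem diracHom_apply_polyFun (x : AddMonoidAlgebra ℤ (pIntegral n p))
    (h : MvPolynomial (Fin n) ℚ) :
    diracHom n p x (polyFun n p h) = (pair h (inclHom n p x) : ℚ) := by
  induction x using AddMonoidAlgebra.induction_linear with
  | zero => simp; rfl
  | add x y hx hy =>
    rw [map_add, measure_add_apply, hx, hy, map_add, map_add, Rat.cast_add]
  | single v k =>
    rw [diracHom_single, zsmul_measure_apply, AbstractMeasure.dirac_apply, polyFun_toLp,
      inclHom_single, pair_single]
    simp

/-- The `p`-adic counterpart of `pair_mul`: convolution is adjoint to the shift action on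
polynomials. -/
theorem diracHom_mul_apply_polyFun (x : AddMonoidAlgebra ℤ (pIntegral n p)) (ν : PMeasure n p)
    (h : MvPolynomial (Fin n) ℚ) :
    (diracHom n p x * ν) (polyFun n p h) = ν (polyFun n p (shiftPoly n (inclHom n p x) h)) := by
  induction x using AddMonoidAlgebra.induction_linear with
  | zero =>
    simp only [map_zero, zero_mul, LinearMap.zero_apply]
    rfl
  | add x y hx hy =>
    rw [map_add, add_mul, measure_add_apply, hx, hy, map_add, map_add, LinearMap.add_apply,
      map_add, map_add]
  | single v k =>
    rw [diracHom_single, smul_mul_assoc, zsmul_measure_apply, dirac_mul_apply, polyFun_comp_add,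
      inclHom_single]
    have : AddMonoidAlgebra.single (v : V n) (k : ℚ) = k • AddMonoidAlgebra.single (v : V n) 1 := by
      simp
    rw [this, map_zsmul, LinearMap.smul_apply, map_zsmul, map_zsmul]

theorem restrictTo_oneSubProd_mul {U : TopologicalSpace.CompactOpens (Lp n p)}
    {ws : List (pIntegral n p)} (hws : ∀ w ∈ ws, ∀ x, x + toLp w ∈ U ↔ x ∈ U) (μ : PMeasure n p) :
    restrictTo U (diracHom n p (oneSubProd ℤ ws) * μ) =
      diracHom n p (oneSubProd ℤ ws) * restrictTo U μ := by
  induction ws with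
  | nil => simp
  | cons w ws ih =>
    rw [List.forall_mem_cons] at hws
    rw [oneSubProd_cons, map_mul, map_sub, map_one, diracHom_single, one_smul, mul_assoc, sub_mul,
      one_mul, restrictTo_sub, restrictTo_dirac_mul hws.1, ih hws.2, mul_assoc, sub_mul, one_mul]

open scoped Classical in
/-- The product of a function with a characteristic function. -/
def cutOff (U : TopologicalSpace.CompactOpens (Lp n p)) (F : pIntegral n p → ℤ) :
    pIntegral n p → ℤ := fun v => if toLp v ∈ U then F v else 0

/-- The formal-series counterpart of `restrictTo_oneSubProd_mul`; together they keep the equations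
for `F` and for `μ` parallel after restriction to `U`. -/
theorem cutOff_foldr {U : TopologicalSpace.CompactOpens (Lp n p)}
    {ws : List (pIntegral n p)} (hws : ∀ w ∈ ws, ∀ x, x + toLp w ∈ U ↔ x ∈ U)
    (F : pIntegral n p → ℤ) :
    ws.foldr mulOneSub (cutOff U F) = cutOff U (ws.foldr mulOneSub F) := by
  induction ws with
  | nil => rfl
  | cons w ws ih =>
    rw [List.forall_mem_cons] at hws
    rw [List.foldr_cons, List.foldr_cons, ih hws.2]
    ext v
    have h : toLp (v - w) ∈ U ↔ toLp v ∈ U := by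
      rw [← hws.1, ← toLp_add, sub_add_cancel]
    by_cases hv : toLp v ∈ U <;> simp [mulOneSub, cutOff, h, hv]

theorem restrictTo_diracHom (U : TopologicalSpace.CompactOpens (Lp n p))
    (c : AddMonoidAlgebra ℤ (pIntegral n p)) :
    ∃ c' : AddMonoidAlgebra ℤ (pIntegral n p), c'.coeff = cutOff U c.coeff ∧
      restrictTo U (diracHom n p c) = diracHom n p c' := by
  classical
  induction c using AddMonoidAlgebra.induction_linear with
  | zero =>
    refine ⟨0, ?_, ?_⟩
    · ext v
      simp [cutOff]
    · rw [map_zero]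
      rfl
  | add x y hx hy =>
    obtain ⟨x', hx1, hx2⟩ := hx
    obtain ⟨y', hy1, hy2⟩ := hy
    refine ⟨x' + y', ?_, ?_⟩
    · have : ((x' + y').coeff : pIntegral n p → ℤ) = x'.coeff + y'.coeff := rfl
      rw [this, hx1, hy1]
      ext v
      simp only [cutOff, Pi.add_apply, AddMonoidAlgebra.coeff_add, Finsupp.add_apply]
      split_ifs <;> simp
    · rw [map_add, map_add, ← hx2, ← hy2]
      rfl
  | single w k =>
    refine ⟨if toLp w ∈ U then .single w k else 0, ?_, ?_⟩
    · ext v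
      by_cases hvw : w = v
      · subst hvw
        by_cases hw : toLp w ∈ U <;> simp [cutOff, hw]
      · by_cases hw : toLp w ∈ U <;> simp [cutOff, hw, hvw]
    · refine DFunLike.ext _ _ fun g => ?_
      rw [restrictTo_apply, diracHom_single, zsmul_measure_apply, AbstractMeasure.dirac_apply,
        ContinuousMap.mul_apply]
      change k • ((U : Set (Lp n p)).indicator (fun _ => (1 : ℚ_[p])) (toLp w) * g (toLp w)) = _
      by_cases hw : toLp w ∈ U
      · rw [if_pos hw, diracHom_single, zsmul_measure_apply, AbstractMeasure.dirac_apply,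
          Set.indicator_of_mem (by exact hw), one_mul]
      · rw [if_neg hw, map_zero, Set.indicator_of_notMem (by exact hw), zero_mul, smul_zero]
        rfl

/-- Integration over `U`, as a functional on polynomials. -/
def integralOn (μ : PMeasure n p) (U : TopologicalSpace.CompactOpens (Lp n p)) :
    MvPolynomial (Fin n) ℚ →ₗ[ℚ] ℚ_[p] :=
  ((AbstractMeasure.toCLMEquiv (restrictTo U μ) : C(Lp n p, ℚ_[p]) →ₗ[ℚ_[p]] ℚ_[p]).restrictScalars
    ℚ).comp (polyFun n p).toLinearMap

theorem integralOn_apply (μ : PMeasure n p) (U : TopologicalSpace.CompactOpens (Lp n p))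
    (h : MvPolynomial (Fin n) ℚ) : integralOn μ U h = restrictTo U μ (polyFun n p h) := rfl

theorem integralPow_eq (μ : PMeasure n p) (N : MvPolynomial (Fin n) ℚ) (k : ℕ)
    (U : TopologicalSpace.CompactOpens (Lp n p)) :
    integralPow μ N k U = integralOn μ U (N ^ k) := by
  classical
  rw [integralOn_apply, restrictTo_apply, integralPow]
  congr 1
  ext x
  rw [ContinuousMap.mul_apply, polyFun_apply, map_pow]
  change (U : Set (Lp n p)).indicator
    (fun x => (MvPolynomial.aeval (fun i => (x i : ℚ_[p])) N) ^ k) x =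
      (U : Set (Lp n p)).indicator (fun _ => (1 : ℚ_[p])) x * _
  by_cases hx : x ∈ (U : Set (Lp n p))
  · rw [Set.indicator_of_mem hx, Set.indicator_of_mem hx, one_mul]
  · rw [Set.indicator_of_notMem hx, Set.indicator_of_notMem hx, zero_mul]

open scoped Classical in
/-- The coefficients `[v ∈ C] f(v)` of the formal series of a cone. -/
def coneFun (f : V n → ℤ) (C : Set (Fin n → ℝ)) : V n → ℤ :=
  fun v => if toReal v ∈ C then f v else 0

theorem tensorIndicator_of_mem (f : V n → ℤ) (U : TopologicalSpace.CompactOpens (Lp n p))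
    (v : pIntegral n p) [Decidable (toLp v ∈ U)] :
    tensorIndicator f (U : Set (Lp n p)) v = if toLp v ∈ U then f v else 0 := by
  have : (∃ u ∈ (U : Set (Lp n p)), (fun i => (u i : ℚ_[p])) = toLocal p v) ↔ toLp v ∈ U := by
    constructor
    · rintro ⟨u, hu, h⟩
      have : u = toLp v := by
        exact funext fun i => Subtype.ext (congrFun h i)
      exact this ▸ hu
    · exact fun h => ⟨toLp v, h, rfl⟩
  simp only [tensorIndicator, this]
  split_ifs <;> simp

theorem tensorIndicator_of_notMem (f : V n → ℤ) (U : Set (Lp n p)) {v : V n}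
    (hv : v ∉ pIntegral n p) : tensorIndicator f U v = 0 := by
  rw [tensorIndicator, if_neg, mul_zero]
  rintro ⟨u, -, h⟩
  refine hv fun i => ?_
  have := congrFun h i
  simp only [toLocal] at this
  rw [← this]
  exact (u i).2

theorem extendZero_coneFun (f : V n → ℤ) (C : Set (Fin n → ℝ)) (U : Set (Lp n p)) :
    extendZero (fun v : pIntegral n p => coneFun (tensorIndicator f U) C v) =
      fun v => (coneFun (tensorIndicator f U) C v : ℚ) := by
  ext v
  by_cases h : v ∈ pIntegral n p
  · rw [extendZero, dif_pos h]
  · simp [extendZero, h, coneFun, tensorIndicator_of_notMem f U h]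

/-- The functional equation satisfied by the integrals of polynomials over `U`. -/
theorem exists_integralOn_eq_pair {f : V n → ℤ} {C : Set (Fin n → ℝ)}
    {U W : TopologicalSpace.CompactOpens (Lp n p)} (hUW : U ≤ W)
    {ξ : PseudoMeasure n p} (hξ : IsConePseudoMeasure f C (W : Set _) ξ)
    {μ : PMeasure n p} (hμ : algebraMap _ (PseudoMeasure n p) μ = ξ) :
    ∃ (ws : List (V n)) (c : AddMonoidAlgebra ℚ (V n)), (∀ w ∈ ws, w ≠ 0) ∧
      act ℚ (V n) (oneSubProd ℚ ws)
        (fun v => (coneFun (tensorIndicator f (U : Set (Lp n p))) C v : ℚ)) = c.coeff ∧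
      ∀ h, integralOn μ U (shiftPoly n (oneSubProd ℚ ws) h) = (pair h c : ℚ) := by
  classical
  obtain ⟨ws, hws, hfin, heq⟩ := hξ
  set F : pIntegral n p → ℤ := fun v =>
    if toReal (v : V n) ∈ C then tensorIndicator f (W : Set (Lp n p)) v else 0 with hF
  have hamice : amicePseudo ξ = algebraMap (MvPowerSeries (Fin n) ℚ_[p])
      (FractionRing (MvPowerSeries (Fin n) ℚ_[p])) (amice μ) := by
    rw [← hμ]
    exact IsLocalization.lift_eq _ μ
  rw [hamice, ← map_mul] at heq
  have heq' := IsFractionRing.injective (MvPowerSeries (Fin n) ℚ_[p])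
    (FractionRing (MvPowerSeries (Fin n) ℚ_[p])) heq
  let c₀ : AddMonoidAlgebra ℤ (pIntegral n p) := .ofCoeff (Finsupp.ofSupportFinite _ hfin)
  have hc₀ : ws.foldr mulOneSub F = c₀.coeff := rfl
  have hmeas := diracHom_mul_eq hc₀ heq'
  obtain ⟨m, hm⟩ := exists_pow_translation_invariant U
  -- Translation by these exponents preserves `U`, so the new denominator commutes with restriction.
  set ws' := ws.map fun w => p ^ m • w with hws'
  have hinv : ∀ w ∈ ws', ∀ x, x + toLp w ∈ U ↔ x ∈ U := by
    intro w hw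
    obtain ⟨w₀, -, rfl⟩ := List.mem_map.mp hw
    refine hm _ fun i => ?_
    have : toLp (p ^ m • w₀) i = ((p ^ m : ℕ) : ℤ_[p]) * toLp w₀ i := by
      refine Subtype.ext ?_
      change (((p ^ m • (w₀ : V n)) i : ℚ) : ℚ_[p]) = _
      rw [PadicInt.coe_mul, PadicInt.coe_natCast, Pi.smul_apply, nsmul_eq_mul, Rat.cast_mul,
        Rat.cast_natCast]
      rfl
    rw [this, map_mul, map_natCast, ZMod.natCast_self, zero_mul]
  obtain ⟨d, hd⟩ := oneSubProd_dvd (k := ℤ) (p ^ m) ws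
  have hmeas' : diracHom n p (oneSubProd ℤ ws') * μ = diracHom n p (d * c₀) := by
    rw [hws', hd, mul_comm _ d, map_mul, mul_assoc, hmeas, map_mul]
  have hcoeff : ws'.foldr mulOneSub F = (d * c₀).coeff := by
    rw [← act_coeff, ← hc₀, ← act_oneSubProd, ← act_oneSubProd, ← act_mul, hws', hd, mul_comm]
  obtain ⟨c, hc1, hc2⟩ := restrictTo_diracHom U (d * c₀)
  -- Since `U ⊆ W`, cutting the series for `W` off to `U` gives the series for `U`.
  have hcut : cutOff U F =
      fun v : pIntegral n p => coneFun (tensorIndicator f (U : Set (Lp n p))) C v := by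
    ext v
    simp only [cutOff, coneFun, hF]
    rw [tensorIndicator_of_mem, tensorIndicator_of_mem]
    by_cases hv : toLp v ∈ U
    · simp [hv, hUW hv]
    · simp [hv]
  refine ⟨ws'.map (pIntegral n p).subtype, inclHom n p c, ?_, ?_, fun h => ?_⟩
  · intro w hw
    rw [hws', List.map_map] at hw
    obtain ⟨w₀, hw₀, rfl⟩ := List.mem_map.mp hw
    intro h0
    refine hws w₀ hw₀ (Subtype.ext ?_)
    have h1 : (p ^ m : ℕ) • (w₀ : V n) = 0 := h0
    rw [← Nat.cast_smul_eq_nsmul ℚ] at h1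
    exact (smul_eq_zero.mp h1).resolve_left
      (Nat.cast_ne_zero.mpr (pow_ne_zero _ (Fact.out : p.Prime).ne_zero))
  · rw [← inclHom_oneSubProd, ← extendZero_coneFun, ← hcut, act_inclHom, act_oneSubProd,
      cutOff_foldr hinv, hcoeff, ← hc1, inclHom_coeff]
  · rw [integralOn_apply, ← inclHom_oneSubProd, ← diracHom_mul_apply_polyFun,
      ← restrictTo_oneSubProd_mul hinv, hmeas', hc2, diracHom_apply_polyFun]

end Restriction

/-! ### Cancellation of the denominators -/

section Cancellation

variable {n : ℕ} (x : Fin n → V n →ₗ[ℚ] ℝ)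

/-- The value of an element of the group algebra at `q^v = exp (-∑ t_j x_j(v))`. -/
def evalExp (k : Type*) [CommRing k] [Algebra k ℝ] (t : Fin n → ℝ) :
    AddMonoidAlgebra k (V n) →ₐ[k] ℝ :=
  AddMonoidAlgebra.lift k ℝ (V n)
    { toFun := fun v => Real.exp (-∑ j, t j * x j v.toAdd)
      map_one' := by simp
      map_mul' := fun a b => by
        rw [← Real.exp_add]
        congr 1
        simp only [toAdd_mul, map_add, mul_add, Finset.sum_add_distrib]
        ring }

theorem evalExp_single (k : Type*) [CommRing k] [Algebra k ℝ] (t : Fin n → ℝ) (v : V n) (r : k) :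
    evalExp x k t (.single v r) = algebraMap k ℝ r * Real.exp (-∑ j, t j * x j v) := by
  simp [evalExp, Algebra.smul_def]

/-- Functions whose support is bounded below with respect to all the `x_j`. -/
def BddBelowSupport (H : V n → ℚ) : Prop := ∃ b : ℝ, ∀ v, H v ≠ 0 → ∀ j, b ≤ x j v

variable {x}

theorem BddBelowSupport.add {H G : V n → ℚ} (hH : BddBelowSupport x H) (hG : BddBelowSupport x G) :
    BddBelowSupport x (H + G) := by
  obtain ⟨b, hb⟩ := hH
  obtain ⟨b', hb'⟩ := hG
  refine ⟨min b b', fun v hv j => ?_⟩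
  by_cases h : H v = 0
  · exact (min_le_right _ _).trans (hb' v (fun h' => hv (by simp [h, h'])) j)
  · exact (min_le_left _ _).trans (hb v h j)

theorem BddBelowSupport.neg {H : V n → ℚ} (hH : BddBelowSupport x H) : BddBelowSupport x (-H) := by
  obtain ⟨b, hb⟩ := hH
  exact ⟨b, fun v hv => hb v (by simpa using hv)⟩

theorem BddBelowSupport.act {H : V n → ℚ} (hH : BddBelowSupport x H)
    (a : AddMonoidAlgebra ℚ (V n)) : BddBelowSupport x (act ℚ (V n) a H) := by
  induction a using AddMonoidAlgebra.induction_linear with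
  | zero => exact ⟨0, fun v hv => absurd (by simp) hv⟩
  | add a b ha hb =>
    rw [map_add, LinearMap.add_apply]
    exact ha.add hb
  | single w r =>
    obtain ⟨b, hb⟩ := hH
    refine ⟨b - ∑ j, |x j w|, fun v hv j => ?_⟩
    rw [act_single] at hv
    have h1 := hb (v - w) (right_ne_zero_of_mul hv) j
    rw [map_sub] at h1
    have h2 : |x j w| ≤ ∑ j, |x j w| :=
      Finset.single_le_sum (f := fun j => |x j w|) (fun _ _ => abs_nonneg _) (Finset.mem_univ j)
    have := neg_abs_le (x j w)
    linarith

theorem bddBelowSupport_coeff (c : AddMonoidAlgebra ℚ (V n)) : BddBelowSupport x c.coeff := by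
  have h : BddBelowSupport x (1 : AddMonoidAlgebra ℚ (V n)).coeff := by
    classical
    refine ⟨0, fun v hv j => ?_⟩
    rw [AddMonoidAlgebra.one_def, AddMonoidAlgebra.coeff_single, Finsupp.single_apply] at hv
    have : 0 = v := by
      by_contra h0
      exact hv (if_neg h0)
    rw [← this, map_zero]
  simpa [act_coeff] using h.act c

/-- Going backwards along `w` decreases `x_i` without bound, so it leaves the support. -/
theorem BddBelowSupport.eventually_sub {H : V n → ℚ} (hH : BddBelowSupport x H) {w : V n}
    {i : Fin n} (hi : 0 < x i w) (v : V n) : ∃ K : ℕ, ∀ k ≥ K, H (v - k • w) = 0 := by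
  obtain ⟨b, hb⟩ := hH
  obtain ⟨K, hK⟩ := exists_nat_gt ((x i v - b) / x i w)
  refine ⟨K, fun k hk => ?_⟩
  by_contra h
  have h1 := hb _ h i
  rw [map_sub, map_nsmul, nsmul_eq_mul] at h1
  rw [div_lt_iff₀ hi] at hK
  have : (K : ℝ) * x i w ≤ k * x i w := by gcongr
  linarith

/-- The equation says that `H` is `w`-periodic, while `H` vanishes far back on every line in the
direction of `w`. Hence `1 - q^w` may be cancelled on such functions. -/
theorem eq_zero_of_act_one_sub_eq_zero {H : V n → ℚ} (hH : BddBelowSupport x H) {w : V n}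
    {i : Fin n} (hi : 0 < x i w) (h0 : act ℚ (V n) (1 - .single w 1) H = 0) : H = 0 := by
  ext v
  obtain ⟨K, hK⟩ := hH.eventually_sub hi v
  have : ∀ k : ℕ, H v = H (v - k • w) := by
    intro k
    induction k with
    | zero => simp
    | succ k ih =>
      have := congrFun h0 (v - k • w)
      rw [act_one_sub, Pi.zero_apply, sub_eq_zero] at this
      rw [ih, this, succ_nsmul, sub_sub]
  rw [this K, hK K le_rfl]
  rfl

/-- If `(1 - q^w) H` is finite and `H` has finite support on all lines in the direction of `w`,
then `H` is finite. -/
theorem exists_coeff_eq {H : V n → ℚ} (hH : BddBelowSupport x H) {w : V n} {i j : Fin n}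
    (hi : 0 < x i w) (hj : x j w < 0) {c : AddMonoidAlgebra ℚ (V n)}
    (hc : act ℚ (V n) (1 - .single w 1) H = c.coeff) :
    ∃ a : AddMonoidAlgebra ℚ (V n), H = a.coeff := by
  -- As `x_j(w) < 0`, the support is also left in the forward direction.
  have hfwd : ∀ u, ∃ K : ℕ, ∀ k ≥ K, H (u + k • w) = 0 := fun u => by
    simpa using hH.eventually_sub (w := -w) (i := j) (by simpa using hj) u
  choose K hK using hfwd
  have hfin : (Function.support H).Finite := by
    refine (c.coeff.support.finite_toSet.biUnion fun u _ =>
      ((Finset.range (K u)).finite_toSet.image fun k : ℕ => u + k • w)).subset fun v hv => ?_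
    obtain ⟨L, hL⟩ := hH.eventually_sub hi v
    -- If `c` vanished at all points backwards from `v`, then `H` would be constant there, hence
    -- zero at `v`. So every point of the support of `H` lies forward of one of the finitely many
    -- points of the support of `c`.
    have : ∃ k : ℕ, c.coeff (v - k • w) ≠ 0 := by
      by_contra! h
      refine hv ?_
      have : ∀ k : ℕ, H v = H (v - k • w) := by
        intro k
        induction k with
        | zero => simp
        | succ k ih =>
          have := congrFun hc (v - k • w)
          rw [act_one_sub, h, sub_eq_zero] at this
          rw [ih, this, succ_nsmul, sub_sub]
      rw [this L, hL L le_rfl]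
    obtain ⟨k, hk⟩ := this
    simp only [Set.mem_iUnion]
    refine ⟨v - k • w, by simpa using hk, k, ?_, by simp⟩
    rw [Finset.mem_coe, Finset.mem_range]
    by_contra! hle
    exact hv (by simpa using hK _ k hle)
  exact ⟨.ofCoeff (Finsupp.ofSupportFinite H hfin), rfl⟩

/-- The projection of `V` along a vector `w` with nonzero `i`-th coordinate. -/
def projAlong (w : V n) (i : Fin n) (v : V n) : V n := v - (v i / w i) • w

/-- Composition of polynomials with a projection along `w`. -/
def projPoly (w : V n) (i : Fin n) : MvPolynomial (Fin n) ℚ →ₐ[ℚ] MvPolynomial (Fin n) ℚ :=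
  MvPolynomial.aeval fun l => MvPolynomial.X l - MvPolynomial.C (w l / w i) * MvPolynomial.X i

theorem eval_projPoly (w : V n) (i : Fin n) (v : V n) (h : MvPolynomial (Fin n) ℚ) :
    MvPolynomial.eval v (projPoly w i h) = MvPolynomial.eval (projAlong w i v) h := by
  have : (MvPolynomial.aeval v).comp (projPoly w i) =
      MvPolynomial.aeval (R := ℚ) (projAlong w i v) := by
    ext l
    simp [projPoly, projAlong]
    ring
  simpa [MvPolynomial.coe_aeval_eq_eval] using congrArg (fun φ => φ h) this

/-- These polynomials factor through `V/ℚw`, so they are invariant under translation by `w`. -/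
theorem shiftPoly_projPoly {w : V n} {i : Fin n} (hi : w i ≠ 0) (h : MvPolynomial (Fin n) ℚ) :
    shiftPoly n (1 - .single w 1) (projPoly w i h) = 0 := by
  rw [map_sub, map_one, LinearMap.sub_apply, shiftPoly_single, one_smul, Module.End.one_apply,
    sub_eq_zero]
  have : (MvPolynomial.aeval fun l => MvPolynomial.X l + MvPolynomial.C (w l)).comp
      (projPoly w i) = projPoly w i := by
    ext1 l
    simp only [projPoly, AlgHom.comp_apply, MvPolynomial.aeval_X, map_sub, map_mul,
      MvPolynomial.algHom_C, MvPolynomial.algebraMap_eq]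
    have : (MvPolynomial.C (w l / w i) : MvPolynomial (Fin n) ℚ) * MvPolynomial.C (w i) =
        MvPolynomial.C (w l) := by
      rw [← map_mul, div_mul_cancel₀ _ hi]
    linear_combination -this
  exact (congrArg (fun φ => φ h) this).symm

theorem pair_mapDomain_projAlong (w : V n) (i : Fin n) (h : MvPolynomial (Fin n) ℚ)
    (c : AddMonoidAlgebra ℚ (V n)) :
    pair h (AddMonoidAlgebra.mapDomain (projAlong w i) c) = pair (projPoly w i h) c := by
  induction c using AddMonoidAlgebra.induction_linear with
  | zero => simp
  | add a b ha hb => rw [AddMonoidAlgebra.mapDomain_add, map_add, map_add, ha, hb]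
  | single v r => rw [AddMonoidAlgebra.mapDomain_single, pair_single, pair_single, eval_projPoly]

theorem one_sub_single_dvd_zsmul (u : V n) (a : ℤ) :
    (1 - .single u 1 : AddMonoidAlgebra ℚ (V n)) ∣ 1 - .single (a • u) 1 := by
  have hnat : ∀ k : ℕ, (1 - .single u 1 : AddMonoidAlgebra ℚ (V n)) ∣ 1 - .single (k • u) 1 := by
    intro k
    have := sub_dvd_pow_sub_pow (1 : AddMonoidAlgebra ℚ (V n)) (.single u 1) k
    simpa [AddMonoidAlgebra.single_pow] using this
  obtain ⟨k, rfl | rfl⟩ := a.eq_nat_or_neg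
  · simpa using hnat k
  · have : (1 - .single ((-(k : ℤ)) • u) 1 : AddMonoidAlgebra ℚ (V n)) =
        (1 - .single (k • u) 1) * -.single (-(k • u)) 1 := by
      rw [mul_neg, sub_mul, one_mul, AddMonoidAlgebra.single_mul_single, add_neg_cancel,
        AddMonoidAlgebra.one_def, neg_smul, natCast_zsmul]
      simp
    rw [this]
    exact (hnat k).mul_right _

/-- The exponents `v` and `projAlong w i v` differ by `λw` with `λ = v_i / w_i` rational, and `1 -
q^{λw}` is divisible by `1 - q^{w/d}` for `d` the denominator of `λ`. Products of denominators serve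
all terms at once. Consequently, an element vanishing in `ℚ[V/ℚw]` is a multiple of some `1 -
q^{w/m}`. -/
theorem exists_dvd_sub_mapDomain (w : V n) (i : Fin n) (c : AddMonoidAlgebra ℚ (V n)) :
    ∃ m : ℕ, 0 < m ∧ (1 - .single ((m : ℚ)⁻¹ • w) 1 : AddMonoidAlgebra ℚ (V n)) ∣
      c - AddMonoidAlgebra.mapDomain (projAlong w i) c := by
  have hdvd : ∀ m m' : ℕ, 0 < m → 0 < m' →
      (1 - .single (((m * m' : ℕ) : ℚ)⁻¹ • w) 1 : AddMonoidAlgebra ℚ (V n)) ∣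
        1 - .single ((m : ℚ)⁻¹ • w) 1 := by
    intro m m' hm hm'
    have h := one_sub_single_dvd_zsmul (((m * m' : ℕ) : ℚ)⁻¹ • w) (m' : ℤ)
    have e : (m' : ℤ) • (((m * m' : ℕ) : ℚ)⁻¹ • w) = (m : ℚ)⁻¹ • w := by
      rw [← Int.cast_smul_eq_zsmul ℚ, smul_smul]
      congr 1
      have : (m' : ℚ) ≠ 0 := Nat.cast_ne_zero.mpr hm'.ne'
      have : (m : ℚ) ≠ 0 := Nat.cast_ne_zero.mpr hm.ne'
      push_cast
      field_simp
    rwa [e] at h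
  induction c using AddMonoidAlgebra.induction_linear with
  | zero => exact ⟨1, one_pos, by simp⟩
  | add a b ha hb =>
    obtain ⟨m, hm, hm'⟩ := ha
    obtain ⟨l, hl, hl'⟩ := hb
    refine ⟨m * l, Nat.mul_pos hm hl, ?_⟩
    rw [AddMonoidAlgebra.mapDomain_add, add_sub_add_comm]
    exact dvd_add ((hdvd m l hm hl).trans hm') ((mul_comm m l ▸ hdvd l m hl hm).trans hl')
  | single v r =>
    refine ⟨(v i / w i).den, (v i / w i).den_pos, ?_⟩
    have h := one_sub_single_dvd_zsmul (((v i / w i).den : ℚ)⁻¹ • w) (v i / w i).num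
    have e : (v i / w i).num • ((((v i / w i).den : ℚ)⁻¹) • w) = (v i / w i) • w := by
      rw [← Int.cast_smul_eq_zsmul ℚ, smul_smul, ← div_eq_mul_inv, Rat.num_div_den]
    rw [e] at h
    have e2 : .single v r - AddMonoidAlgebra.mapDomain (projAlong w i) (.single v r) =
        (1 - .single ((v i / w i) • w) 1 : AddMonoidAlgebra ℚ (V n)) *
          -.single (projAlong w i v) r := by
      rw [AddMonoidAlgebra.mapDomain_single, mul_neg, sub_mul, one_mul,
        AddMonoidAlgebra.single_mul_single, projAlong, add_sub_cancel, one_mul, neg_sub]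
    rw [e2]
    exact h.mul_right _

variable (x) in
/-- Elements of the group algebra with exponents in the orthant `x ≥ 0` whose exponential sums
take values between `1` and their value at the origin. -/
structure IsPositive (b : AddMonoidAlgebra ℚ (V n)) : Prop where
  support : ∀ v, b.coeff v ≠ 0 → ∀ j, 0 ≤ x j v
  one_le : ∀ t : Fin n → ℝ, (∀ j, 0 ≤ t j) → 1 ≤ evalExp x ℚ t b
  le_aug : ∀ t : Fin n → ℝ, (∀ j, 0 ≤ t j) → evalExp x ℚ t b ≤ aug n b

theorem mul_coeff_ne_zero {k : Type*} [CommRing k] {a b : AddMonoidAlgebra k (V n)} {v : V n}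
    (h : (a * b).coeff v ≠ 0) :
    ∃ u w, a.coeff u ≠ 0 ∧ b.coeff w ≠ 0 ∧ v = u + w := by
  classical
  have := AddMonoidAlgebra.support_coeff_mul_subset (x := a) (y := b)
    (Finsupp.mem_support_iff.mpr h)
  obtain ⟨u, hu, w, hw, rfl⟩ := Finset.mem_add.mp this
  exact ⟨u, w, by simpa using hu, by simpa using hw, rfl⟩

theorem isPositive_one : IsPositive x 1 where
  support v hv j := by
    classical
    rw [AddMonoidAlgebra.one_def, AddMonoidAlgebra.coeff_single, Finsupp.single_apply] at hv
    have : 0 = v := by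
      by_contra h0
      exact hv (if_neg h0)
    rw [← this, map_zero]
  one_le t _ := by simp
  le_aug t _ := by simp

theorem IsPositive.mul {a b : AddMonoidAlgebra ℚ (V n)} (ha : IsPositive x a)
    (hb : IsPositive x b) : IsPositive x (a * b) where
  support v hv j := by
    obtain ⟨u, w, hu, hw, rfl⟩ := mul_coeff_ne_zero hv
    rw [map_add]
    exact add_nonneg (ha.support u hu j) (hb.support w hw j)
  one_le t ht := by
    rw [map_mul]
    exact one_le_mul_of_one_le_of_one_le (ha.one_le t ht) (hb.one_le t ht)
  le_aug t ht := by
    rw [map_mul, map_mul, Rat.cast_mul]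
    exact mul_le_mul (ha.le_aug t ht) (hb.le_aug t ht) (zero_le_one.trans (hb.one_le t ht))
      (zero_le_one.trans ((ha.one_le t ht).trans (ha.le_aug t ht)))

/-- The term `k = 0` contributes `1`, and every other term is an exponential with value in `(0, 1]`.
-/
theorem isPositive_geom_sum {u : V n} (hu : ∀ j, 0 ≤ x j u) {m : ℕ} (hm : 0 < m) :
    IsPositive x (∑ k ∈ Finset.range m, AddMonoidAlgebra.single u 1 ^ k) := by
  have hsum : (∑ k ∈ Finset.range m, AddMonoidAlgebra.single u 1 ^ k : AddMonoidAlgebra ℚ (V n)) =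
      ∑ k ∈ Finset.range m, .single (k • u) 1 :=
    Finset.sum_congr rfl fun k _ => by rw [AddMonoidAlgebra.single_pow, one_pow]
  rw [hsum]
  refine ⟨fun v hv j => ?_, fun t ht => ?_, fun t ht => ?_⟩
  · classical
    rw [AddMonoidAlgebra.coeff_sum, Finsupp.finsetSum_apply] at hv
    obtain ⟨k, -, hk⟩ := Finset.exists_ne_zero_of_sum_ne_zero hv
    rw [AddMonoidAlgebra.coeff_single, Finsupp.single_apply] at hk
    have : k • u = v := by
      by_contra h0
      exact hk (if_neg h0)
    rw [← this, map_nsmul]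
    exact nsmul_nonneg (hu j) k
  · rw [map_sum]
    refine le_trans ?_ (Finset.single_le_sum (fun k _ => ?_) (Finset.mem_range.mpr hm))
    · simp [evalExp_single]
    · rw [evalExp_single]
      simp [Real.exp_nonneg]
  · rw [map_sum, map_sum, Rat.cast_sum]
    refine Finset.sum_le_sum fun k _ => ?_
    rw [evalExp_single, aug_single, map_one, one_mul, Rat.cast_one, Real.exp_le_one_iff,
      neg_nonpos]
    refine Finset.sum_nonneg fun j _ => mul_nonneg (ht j) ?_
    rw [map_nsmul]
    exact nsmul_nonneg (hu j) k

variable {E : Type*} [AddCommGroup E] [Module ℚ E]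

/-- `a H = c` as formal series, and the functional `Λ` satisfies the corresponding identity. -/
structure Solves (H : V n → ℚ) (Λ : MvPolynomial (Fin n) ℚ →ₗ[ℚ] E) (ι : ℚ →ₗ[ℚ] E)
    (a c : AddMonoidAlgebra ℚ (V n)) : Prop where
  act_eq : act ℚ (V n) a H = c.coeff
  functional_eq : ∀ h, Λ (shiftPoly n a h) = ι (pair h c)

/-- The functional equation forces `c` to vanish in `ℚ[V/ℚw]`, so `1 - q^{w/m}` divides `c`. It is
then cancelled on the function side by injectivity and on the functional side by surjectivity of the
difference operator, leaving a geometric sum as coefficient. -/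
theorem exists_isPositive_of_nonneg {H : V n → ℚ} (hH : BddBelowSupport x H)
    {Λ : MvPolynomial (Fin n) ℚ →ₗ[ℚ] E} {ι : ℚ →ₗ[ℚ] E} (hι : Function.Injective ι) {w : V n}
    (hw : ∀ j, 0 ≤ x j w) {i : Fin n} (hi : 0 < x i w) {c : AddMonoidAlgebra ℚ (V n)}
    (hs : Solves H Λ ι (1 - .single w 1) c) : ∃ b c', IsPositive x b ∧ Solves H Λ ι b c' := by
  have hw0 : w ≠ 0 := by
    rintro rfl
    simp at hi
  obtain ⟨i₀, hi₀⟩ := Function.ne_iff.mp hw0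
  replace hi₀ : w i₀ ≠ 0 := hi₀
  -- Only here is the existence of `Λ` used to produce divisibility: an invariant polynomial is
  -- killed by `1 - q^w`, so it pairs to zero with `c`.
  have hzero : AddMonoidAlgebra.mapDomain (projAlong w i₀) c = 0 := by
    refine eq_zero_of_pair fun h => ?_
    rw [pair_mapDomain_projAlong]
    apply hι
    rw [← hs.functional_eq, shiftPoly_projPoly hi₀, map_zero, map_zero]
  obtain ⟨m, hm, c', hc'⟩ := exists_dvd_sub_mapDomain w i₀ c
  rw [hzero, sub_zero] at hc'
  set u : V n := (m : ℚ)⁻¹ • w with hu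
  have hm0 : (m : ℚ) ≠ 0 := Nat.cast_ne_zero.mpr hm.ne'
  have hxu : ∀ j, x j u = (m : ℝ)⁻¹ * x j w := fun j => by
    rw [hu, map_smul, Rat.smul_def]
    push_cast
    rfl
  have hmu : m • u = w := by
    rw [hu, ← Nat.cast_smul_eq_nsmul ℚ, smul_smul, mul_inv_cancel₀ hm0, one_smul]
  have hui : 0 < x i u := by
    rw [hxu]
    positivity
  set b : AddMonoidAlgebra ℚ (V n) := ∑ k ∈ Finset.range m, AddMonoidAlgebra.single u 1 ^ k with hb
  have hgeom : (1 - .single u 1) * b = 1 - .single w 1 := by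
    rw [hb, mul_neg_geom_sum, AddMonoidAlgebra.single_pow, one_pow, hmu]
  refine ⟨b, c', isPositive_geom_sum (fun j => ?_) hm, ?_, fun g => ?_⟩
  · rw [hxu]
    exact mul_nonneg (by positivity) (hw j)
  · have h0 : act ℚ (V n) b H + -⇑c'.coeff = 0 := by
      refine eq_zero_of_act_one_sub_eq_zero ((hH.act b).add (bddBelowSupport_coeff c').neg) hui ?_
      rw [map_add, map_neg, ← act_mul, hgeom, hs.act_eq, act_coeff, ← hc', add_neg_cancel]
    exact add_neg_eq_zero.mp h0
  · have hu0 : u ≠ 0 := by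
      intro h0
      rw [h0, map_zero] at hui
      exact hui.false
    -- Writing the test polynomial as a difference restores the factor `1 - q^u` needed to use the
    -- known equation.
    obtain ⟨h, rfl⟩ := shiftPoly_one_sub_surjective hu0 g
    rw [← shiftPoly_mul, mul_comm b, hgeom, hs.functional_eq, hc', pair_mul]

theorem Solves.mul_left {H : V n → ℚ} {Λ : MvPolynomial (Fin n) ℚ →ₗ[ℚ] E} {ι : ℚ →ₗ[ℚ] E}
    {a c : AddMonoidAlgebra ℚ (V n)} (hs : Solves H Λ ι a c) (b : AddMonoidAlgebra ℚ (V n)) :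
    Solves H Λ ι (b * a) (b * c) where
  act_eq := by rw [act_mul, hs.act_eq, act_coeff]
  functional_eq h := by rw [mul_comm b a, shiftPoly_mul, hs.functional_eq, pair_mul]

/-- Three cases by the signs of the `x_j(w)`. Mixed signs: `H` is finite and `b = 1` works. All
nonnegative: the previous lemma. All nonpositive: multiplication by `-q^{-w}` turns `1 - q^w` into
`1 - q^{-w}`. -/
theorem exists_isPositive_of_one_sub (hx : ∀ v, (∀ j, x j v = 0) → v = 0) {H : V n → ℚ}
    (hH : BddBelowSupport x H) {Λ : MvPolynomial (Fin n) ℚ →ₗ[ℚ] E} {ι : ℚ →ₗ[ℚ] E}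
    (hι : Function.Injective ι) {w : V n} (hw : w ≠ 0) {c : AddMonoidAlgebra ℚ (V n)}
    (hs : Solves H Λ ι (1 - .single w 1) c) : ∃ b c', IsPositive x b ∧ Solves H Λ ι b c' := by
  obtain ⟨i, hi⟩ : ∃ i, x i w ≠ 0 := by
    by_contra! h
    exact hw (hx w h)
  by_cases hpos : ∃ i, 0 < x i w
  · obtain ⟨i, hi⟩ := hpos
    by_cases hneg : ∃ j, x j w < 0
    · obtain ⟨j, hj⟩ := hneg
      obtain ⟨a, ha⟩ := exists_coeff_eq hH hi hj hs.act_eq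
      refine ⟨1, a, isPositive_one, by simpa using ha, fun g => ?_⟩
      obtain ⟨h, rfl⟩ := shiftPoly_one_sub_surjective hw g
      have hca : c = (1 - .single w 1) * a := by
        apply AddMonoidAlgebra.coeff_injective
        apply DFunLike.coe_injective
        rw [← act_coeff, ← ha, hs.act_eq]
      rw [map_one, Module.End.one_apply, hs.functional_eq, hca, pair_mul]
    · push Not at hneg
      exact exists_isPositive_of_nonneg hH hι hneg hi hs
  · push Not at hpos
    have hs' := hs.mul_left (-.single (-w) 1)
    have e : (-.single (-w) 1 : AddMonoidAlgebra ℚ (V n)) * (1 - .single w 1) =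
        1 - .single (-w) 1 := by
      rw [neg_mul, mul_sub, mul_one, AddMonoidAlgebra.single_mul_single, neg_add_cancel,
        AddMonoidAlgebra.one_def]
      simp
    rw [e] at hs'
    exact exists_isPositive_of_nonneg hH hι (w := -w) (fun j => by simpa using hpos j)
      (by simpa using lt_of_le_of_ne (hpos i) hi) hs'

/-- The factors are treated one at a time: the others are absorbed into `H` and `Λ`, and the
positive element obtained is absorbed in turn before the next step. This is why `H` and `Λ` are
arbitrary. -/
theorem exists_isPositive (hx : ∀ v, (∀ j, x j v = 0) → v = 0) {ι : ℚ →ₗ[ℚ] E}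
    (hι : Function.Injective ι) {ws : List (V n)} (hws : ∀ w ∈ ws, w ≠ 0) {H : V n → ℚ}
    (hH : BddBelowSupport x H) {Λ : MvPolynomial (Fin n) ℚ →ₗ[ℚ] E}
    {c : AddMonoidAlgebra ℚ (V n)} (hs : Solves H Λ ι (oneSubProd ℚ ws) c) :
    ∃ b c', IsPositive x b ∧ Solves H Λ ι b c' := by
  induction ws generalizing H Λ c with
  | nil => exact ⟨1, c, isPositive_one, by simpa using hs⟩
  | cons w ws ih =>
    rw [List.forall_mem_cons] at hws
    rw [oneSubProd_cons] at hs
    have hs1 : Solves (act ℚ (V n) (oneSubProd ℚ ws) H)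
        (Λ ∘ₗ shiftPoly n (oneSubProd ℚ ws)) ι (1 - .single w 1) c :=
      ⟨by rw [← act_mul, hs.act_eq], fun h => by
        rw [LinearMap.comp_apply, ← shiftPoly_mul, mul_comm, hs.functional_eq]⟩
    obtain ⟨b, c', hb, hbs⟩ := exists_isPositive_of_one_sub hx (hH.act _) hι hws.1 hs1
    have hs2 : Solves (act ℚ (V n) b H) (Λ ∘ₗ shiftPoly n b) ι (oneSubProd ℚ ws) c' :=
      ⟨by rw [← act_mul, mul_comm, act_mul, hbs.act_eq], fun h => by
        rw [LinearMap.comp_apply, ← shiftPoly_mul, mul_comm, shiftPoly_mul,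
          ← hbs.functional_eq, LinearMap.comp_apply]⟩
    obtain ⟨b', c'', hb', hs'⟩ := ih hws.2 (hH.act b) hs2
    exact ⟨b' * b, c'', hb'.mul hb, by rw [act_mul, hs'.act_eq], fun h => by
      rw [mul_comm, shiftPoly_mul, ← hs'.functional_eq, LinearMap.comp_apply]⟩

end Cancellation

/-! ### Test functions are bounded and supported on lattices -/

section TestFunctions

theorem norm_rat_le_one_iff (l : ℕ) [Fact l.Prime] (q : ℚ) : ‖(q : ℚ_[l])‖ ≤ 1 ↔ ¬l ∣ q.den := by
  refine ⟨fun h hd => ?_, Padic.norm_rat_le_one⟩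
  have h1 : ‖((q.den : ℕ) : ℚ_[l])‖ < 1 := (Padic.norm_natCast_lt_one_iff).mpr hd
  have h2 : ‖((q.num : ℤ) : ℚ_[l])‖ < 1 := by
    have : ((q.num : ℤ) : ℚ_[l]) = (q : ℚ_[l]) * ((q.den : ℕ) : ℚ_[l]) := by
      have := congrArg (fun r : ℚ => (r : ℚ_[l])) (Rat.mul_den_eq_num q)
      push_cast at this
      exact this.symm
    rw [this, norm_mul]
    exact lt_of_le_of_lt (mul_le_of_le_one_left (norm_nonneg _) h) h1
  rw [Padic.norm_intCast_lt_one_iff, Int.natCast_dvd] at h2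
  have := Nat.dvd_gcd h2 hd
  rw [q.reduced.gcd_eq_one] at this
  exact (Fact.out : l.Prime).one_lt.ne' (Nat.dvd_one.mp this)

theorem exists_int_of_forall_norm_le_one {q : ℚ}
    (h : ∀ l : ℕ, ∀ _ : Fact l.Prime, ‖(q : ℚ_[l])‖ ≤ 1) : ∃ z : ℤ, q = z := by
  refine ⟨q.num, ?_⟩
  have : q.den = 1 := by
    by_contra hne
    obtain ⟨l, hl, hd⟩ := Nat.exists_prime_and_dvd hne
    have := Fact.mk hl
    exact (norm_rat_le_one_iff l q).mp (h l this) hd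
  exact (Rat.coe_int_num_of_den_eq_one this).symm

variable {n p : ℕ}

theorem finite_not_integral (v : V n) :
    {l : PrimesAway p | toLocal (l : ℕ) v ∉ localLattice n l}.Finite := by
  have hfin : (⋃ i, ((v i).den.primeFactors : Set ℕ)).Finite :=
    Set.finite_iUnion fun i => Finset.finite_toSet _
  refine Set.Finite.of_finite_image (hfin.subset ?_) Subtype.val_injective.injOn
  rintro _ ⟨l, hl, rfl⟩
  simp only [localLattice, toLocal, Set.mem_ofPred_eq, not_forall] at hl
  obtain ⟨i, hi⟩ := hl
  rw [norm_rat_le_one_iff, not_not] at hi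
  exact Set.mem_iUnion.mpr ⟨i, by simpa using ⟨l.2.1, hi⟩⟩

/-- Bounded functions on `V` supported on some lattice away from `p`. -/
structure IsBoundedAway (p : ℕ) (g : V n → ℤ) : Prop where
  bound : ∃ B : ℤ, ∀ v, |g v| ≤ B
  support : ∃ M : ℕ, 0 < M ∧ ∀ v, g v ≠ 0 → ∀ l : PrimesAway p, ∀ i,
    ‖((M * v i : ℚ) : ℚ_[(l : ℕ)])‖ ≤ 1

theorem norm_natCast_mul_le {l : ℕ} [Fact l.Prime] (M : ℕ) {q : ℚ} (h : ‖(q : ℚ_[l])‖ ≤ 1) :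
    ‖((M * q : ℚ) : ℚ_[l])‖ ≤ 1 := by
  rw [Rat.cast_mul, norm_mul]
  exact mul_le_one₀ (by simpa using Padic.norm_int_le_one (p := l) (M : ℤ)) (norm_nonneg _) h

theorem IsBoundedAway.add {g h : V n → ℤ} (hg : IsBoundedAway p g) (hh : IsBoundedAway p h) :
    IsBoundedAway p (g + h) := by
  obtain ⟨⟨B, hB⟩, M, hM, hgM⟩ := hg
  obtain ⟨⟨B', hB'⟩, M', hM', hhM⟩ := hh
  refine ⟨⟨B + B', fun v => (abs_add_le _ _).trans (add_le_add (hB v) (hB' v))⟩, M * M',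
    Nat.mul_pos hM hM', fun v hv l i => ?_⟩
  by_cases h0 : g v = 0
  · have := norm_natCast_mul_le M (hhM v (fun h' => hv (by simp [h0, h'])) l i)
    rwa [← mul_assoc, ← Nat.cast_mul] at this
  · have := norm_natCast_mul_le M' (hgM v h0 l i)
    rwa [← mul_assoc, ← Nat.cast_mul, mul_comm M'] at this

/-- Only the finitely many primes in `T`, where `f_ℓ ≠ [L_ℓ]`, matter: the bound is the product of
their bounds, and the lattice is given by the product of the powers `ℓ^a` clearing their compact
supports. -/
theorem isBoundedAway_of_mem_pureTensors {g : V n → ℤ} (hg : g ∈ pureTensors n p) :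
    IsBoundedAway p g := by
  classical
  obtain ⟨f, hstep, hfin, rfl⟩ := hg
  set T := hfin.toFinset with hT
  have hTmem : ∀ l, l ∉ T → f l = Set.indicator (localLattice n l) 1 := fun l hl => by
    simpa [hT] using hl
  have hsupp : ∀ v : V n,
      (Function.mulSupport fun l : PrimesAway p => f l (toLocal l v)).Finite := by
    intro v
    refine (T.finite_toSet.union (finite_not_integral v)).subset fun l hl => ?_
    by_contra hnot
    simp only [Set.mem_union, Finset.mem_coe, Set.mem_ofPred_eq, not_or, not_not] at hnot
    refine hl ?_
    simp only [hTmem l hnot.1, Set.indicator_of_mem hnot.2, Pi.one_apply]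
  constructor
  · have hb : ∀ l, ∃ B : ℤ, 1 ≤ B ∧ ∀ y, |f l y| ≤ B := by
      intro l
      obtain ⟨B, hB⟩ := (hstep l).2.exists_bound_of_continuous (hstep l).1.continuous
      refine ⟨max 1 ⌊B⌋, le_max_left _ _, fun y => le_max_of_le_right (Int.le_floor.mpr ?_)⟩
      simpa [Int.norm_eq_abs] using hB y
    choose B hB1 hB using hb
    refine ⟨∏ l ∈ T, B l, fun v => ?_⟩
    -- The product runs over a finite set depending on `v`; outside `T` its factors are at most `1`,
    -- so the bound does not depend on `v`.
    have hsub : (Function.mulSupport fun l : PrimesAway p => f l (toLocal l v)) ⊆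
        (T ∪ (hsupp v).toFinset : Finset (PrimesAway p)) := by
      intro l hl
      simp only [Finset.coe_union, Set.Finite.coe_toFinset, Set.mem_union]
      exact Or.inr hl
    change |∏ᶠ l : PrimesAway p, f l (toLocal l v)| ≤ _
    rw [finprod_eq_prod_of_mulSupport_subset _ hsub, Finset.abs_prod]
    calc ∏ l ∈ T ∪ (hsupp v).toFinset, |f l (toLocal l v)|
        ≤ ∏ l ∈ T ∪ (hsupp v).toFinset, (if l ∈ T then B l else 1) := by
          refine Finset.prod_le_prod (fun _ _ => abs_nonneg _) fun l _ => ?_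
          split_ifs with hl
          · exact hB l _
          · rw [hTmem l hl, Set.indicator_apply]
            split_ifs <;> simp
      _ = ∏ l ∈ T, B l := by
          rw [Finset.prod_ite_mem, Finset.union_inter_cancel_left]
  · have ha : ∀ l : PrimesAway p, ∃ a : ℕ, ∀ y, f l y ≠ 0 → ∀ i, ‖y i‖ ≤ (l : ℝ) ^ a := by
      intro l
      obtain ⟨R, hR⟩ := (hstep l).2.isCompact.isBounded.exists_norm_le
      obtain ⟨a, ha⟩ := pow_unbounded_of_one_lt R
        (Nat.one_lt_cast.mpr l.2.1.one_lt : (1 : ℝ) < ((l : ℕ) : ℝ))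
      exact ⟨a, fun y hy i =>
        (norm_le_pi_norm y i).trans ((hR y (subset_tsupport _ hy)).trans ha.le)⟩
    choose a ha using ha
    refine ⟨∏ l ∈ T, (l : ℕ) ^ a l, Finset.prod_pos fun l _ => pow_pos l.2.1.pos _,
      fun v hv l i => ?_⟩
    have hne : f l (toLocal l v) ≠ 0 := fun h0 => hv (finprod_eq_zero _ l h0 (hsupp v))
    by_cases hl : l ∈ T
    · rw [← Finset.mul_prod_erase _ _ hl, Nat.cast_mul, mul_comm ((((l : ℕ) ^ a l : ℕ)) : ℚ),
        mul_assoc]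
      refine norm_natCast_mul_le _ ?_
      have h1 := ha l _ hne i
      have hl0 : (0 : ℝ) < ((l : ℕ) : ℝ) := Nat.cast_pos.mpr l.2.1.pos
      rw [Rat.cast_mul, norm_mul, Rat.cast_natCast, Nat.cast_pow, norm_pow, Padic.norm_p, inv_pow,
        inv_mul_le_one₀ (pow_pos hl0 _)]
      exact h1
    · refine norm_natCast_mul_le _ ?_
      rw [hTmem l hl] at hne
      exact (Set.mem_of_indicator_ne_zero hne) i

theorem isBoundedAway_of_mem {g : V n → ℤ} (hg : g ∈ TestFunctionsAway n p) :
    IsBoundedAway p g := by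
  induction hg using AddSubgroup.closure_induction with
  | mem g hg => exact isBoundedAway_of_mem_pureTensors hg
  | zero => exact ⟨⟨0, fun v => by simp⟩, 1, one_pos, fun v hv => absurd rfl hv⟩
  | add g h _ _ hg hh => exact hg.add hh
  | neg g _ hg =>
    obtain ⟨⟨B, hB⟩, M, hM, hgM⟩ := hg
    exact ⟨⟨B, fun v => by simpa using hB v⟩, M, hM, fun v hv => hgM v (by simpa using hv)⟩

/-- The lattice `M⁻¹ L`. -/
def scaledLattice (n M : ℕ) : Set (V n) := {v | ∀ i, ∃ z : ℤ, (M : ℚ) * v i = z}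

/-- Integrality at `p`, missing from `IsBoundedAway`, comes from the support in `L_p`; a rational
number integral at all primes is an integer. -/
theorem exists_bound_tensorIndicator [Fact p.Prime] {g : V n → ℤ} (hg : g ∈ TestFunctionsAway n p)
    (U : Set (Lp n p)) :
    (∃ B : ℤ, ∀ v, |tensorIndicator g U v| ≤ B) ∧
      ∃ M : ℕ, 0 < M ∧ ∀ v, tensorIndicator g U v ≠ 0 → v ∈ scaledLattice n M := by
  obtain ⟨⟨B, hB⟩, M, hM, hgM⟩ := isBoundedAway_of_mem hg
  refine ⟨⟨B, fun v => ?_⟩, M, hM, fun v hv i => exists_int_of_forall_norm_le_one fun l hl => ?_⟩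
  · rw [tensorIndicator]
    split_ifs
    · simpa using hB v
    · simpa using (abs_nonneg _).trans (hB v)
  · have hv' := hv
    rw [tensorIndicator] at hv
    by_cases hlp : l = p
    · subst hlp
      refine norm_natCast_mul_le M ?_
      by_contra h
      exact hv' (tensorIndicator_of_notMem g U fun h' => h (h' i))
    · exact hgM v (left_ne_zero_of_mul hv) ⟨l, hl.out, hlp⟩ i

end TestFunctions

/-! ### Lattice points in rational cones -/

section Cones

variable {n : ℕ}

/-- The coordinates of a vector of `V` with respect to a basis of `V_ℝ`. -/
def coordHom (e : Module.Basis (Fin n) ℝ (Fin n → ℝ)) (j : Fin n) : V n →ₗ[ℚ] ℝ where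
  toFun v := e.coord j (toReal v)
  map_add' v w := by
    rw [← map_add]
    congr 1
    ext i
    simp [toReal]
  map_smul' r v := by
    rw [RingHom.id_apply, Rat.smul_def, ← smul_eq_mul, ← map_smul]
    congr 1
    ext i
    simp [toReal]

theorem coordHom_apply (e : Module.Basis (Fin n) ℝ (Fin n → ℝ)) (j : Fin n) (v : V n) :
    coordHom e j v = e.coord j (toReal v) := rfl

theorem normForm_toReal (e : Module.Basis (Fin n) ℝ (Fin n → ℝ)) (v : V n) :
    normForm e (toReal v) = ∏ j, coordHom e j v := rfl

theorem eq_zero_of_coordHom (e : Module.Basis (Fin n) ℝ (Fin n → ℝ)) (v : V n)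
    (h : ∀ j, coordHom e j v = 0) : v = 0 := by
  have : toReal v = 0 := e.ext_elem fun j => by
    rw [map_zero]
    exact h j
  ext i
  have := congrFun this i
  simpa [toReal] using this

/-- The coefficients of a lattice point along the generators are positive with bounded denominator,
hence bounded below. A fixed interior vector `η s` can therefore be subtracted without leaving the
cone, and the coordinates of `v` exceed those of `η s`. -/
theorem exists_pos_le_coordHom_of_isRationalOpenCone (e : Module.Basis (Fin n) ℝ (Fin n → ℝ))
    {D : Set (Fin n → ℝ)} (hD : IsRationalOpenCone D) (hpos : D ⊆ positiveOrthant e)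
    {M : ℕ} (hM : 0 < M) :
    ∃ c : ℝ, 0 < c ∧ ∀ v ∈ scaledLattice n M, toReal v ∈ D → ∀ j, c ≤ coordHom e j v := by
  classical
  obtain ⟨r, w, hw, rfl⟩ := hD
  -- A rational left inverse reads off the coefficients along the generators; `M'` below is a common
  -- denominator of its matrix.
  obtain ⟨φ, hφ⟩ := LinearMap.exists_leftInverse_of_injective (Fintype.linearCombination ℚ w)
    (LinearMap.ker_eq_bot.mpr hw.fintypeLinearCombination_injective)
  have hφw : ∀ k j, φ (w k) j = if j = k then 1 else 0 := fun k j => by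
    have := congrArg (fun ψ => ψ (Pi.single k 1) j) hφ
    simpa [Fintype.linearCombination_apply_single, Pi.single_apply] using this
  have hφv : ∀ v j, φ v j = ∑ i, v i * φ (Pi.single i 1) j := fun v j => by
    conv_lhs => rw [← Finset.univ_sum_single v, map_sum, Finset.sum_apply]
    refine Finset.sum_congr rfl fun i _ => ?_
    have : (Pi.single i (v i) : V n) = v i • Pi.single i 1 := by
      rw [← Pi.single_smul, smul_eq_mul, mul_one]
    rw [this, map_smul, Pi.smul_apply, smul_eq_mul]
  obtain ⟨M', hM', hz⟩ : ∃ M' : ℕ, 0 < M' ∧ ∀ i j, ∃ z : ℤ, (M' : ℚ) * φ (Pi.single i 1) j = z := by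
    refine ⟨∏ i, ∏ j, (φ (Pi.single i 1) j).den,
      Finset.prod_pos fun i _ => Finset.prod_pos fun j _ => Rat.den_pos _, fun i j => ?_⟩
    rw [← Finset.mul_prod_erase _ _ (Finset.mem_univ i),
      ← Finset.mul_prod_erase _ _ (Finset.mem_univ j)]
    refine ⟨(φ (Pi.single i 1) j).num * ((∏ j' ∈ Finset.univ.erase j,
      (φ (Pi.single i 1) j').den : ℕ) * (∏ i' ∈ Finset.univ.erase i, ∏ j',
      (φ (Pi.single i' 1) j').den : ℕ)), ?_⟩
    have := Rat.mul_den_eq_num (φ (Pi.single i 1) j)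
    push_cast
    linear_combination (∏ j' ∈ Finset.univ.erase j, ((φ (Pi.single i 1) j').den : ℚ)) *
      (∏ i' ∈ Finset.univ.erase i, ∏ j', ((φ (Pi.single i' 1) j').den : ℚ)) * this
  have hMM : (0 : ℝ) < M * M' := by positivity
  -- Half the least possible coefficient, so that the differences stay strictly positive.
  set η : ℝ := (2 * (M * M'))⁻¹ with hη
  have hη0 : 0 < η := by positivity
  set s : Fin n → ℝ := ∑ k, toReal (w k) with hs
  have hsD : s ∈ openCone fun j => toReal (w j) := ⟨fun _ => 1, fun _ => one_pos, by simp [hs]⟩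
  obtain ⟨c, hc, hcs⟩ : ∃ c : ℝ, 0 < c ∧ ∀ j, c ≤ η * e.coord j s := by
    rcases isEmpty_or_nonempty (Fin n) with h | h
    · exact ⟨1, one_pos, fun j => h.elim j⟩
    · obtain ⟨j₀, hj₀⟩ := Finite.exists_min fun j => η * e.coord j s
      exact ⟨_, mul_pos hη0 (hpos hsD j₀), hj₀⟩
  refine ⟨c, hc, fun v hv ⟨a, ha, hva⟩ j => (hcs j).trans ?_⟩
  have hak : ∀ k, (φ v k : ℝ) = a k := by
    intro k
    rw [hφv]
    have h1 : ∀ i, (v i : ℝ) = ∑ l, a l * (w l i : ℝ) := fun i => by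
      have := congrFun hva i
      simpa [toReal] using this
    push_cast
    simp only [h1, Finset.sum_mul]
    rw [Finset.sum_comm]
    have h2 : ∀ l, ∑ i, a l * (w l i : ℝ) * (φ (Pi.single i 1) k : ℝ) =
        a l * if k = l then 1 else 0 := fun l => by
      have := congrArg (fun q : ℚ => (q : ℝ)) ((hφv (w l) k).symm.trans (hφw l k))
      push_cast at this
      simp only [mul_assoc, ← Finset.mul_sum, this, apply_ite (Rat.cast : ℚ → ℝ), Rat.cast_one,
        Rat.cast_zero]
    simp [h2]
  have haη : ∀ k, η < a k := by
    intro k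
    have hint : ∃ z : ℤ, (M * M' : ℚ) * φ v k = z := by
      choose z hz using hz
      choose y hy using hv
      refine ⟨∑ i, y i * z i k, ?_⟩
      rw [hφv, Finset.mul_sum]
      push_cast
      refine Finset.sum_congr rfl fun i _ => ?_
      rw [← hz, ← hy]
      ring
    obtain ⟨z, hz⟩ := hint
    have hz' : (M * M' : ℝ) * a k = z := by
      rw [← hak]
      exact_mod_cast hz
    have hzpos : (0 : ℝ) < z := by
      rw [← hz']
      exact mul_pos hMM (ha k)
    have hz1 : (1 : ℝ) ≤ z := by
      exact_mod_cast Int.add_one_le_of_lt (Int.cast_pos.mp hzpos)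
    rw [hη, inv_lt_iff_one_lt_mul₀ (by positivity)]
    nlinarith
  have hmem : toReal v - η • s ∈ openCone fun j => toReal (w j) := by
    refine ⟨fun k => a k - η, fun k => sub_pos.mpr (haη k), ?_⟩
    simp only [sub_smul, Finset.sum_sub_distrib, hva, hs, Finset.smul_sum]
  have := hpos hmem j
  rw [map_sub, map_smul, smul_eq_mul] at this
  rw [coordHom_apply]
  linarith

theorem exists_pos_le_coordHom (e : Module.Basis (Fin n) ℝ (Fin n → ℝ))
    {C : Set (Fin n → ℝ)} (hC : IsRationalSimplicialCone C) (hpos : C ⊆ positiveOrthant e)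
    {M : ℕ} (hM : 0 < M) :
    ∃ c : ℝ, 0 < c ∧ ∀ v ∈ scaledLattice n M, toReal v ∈ C → ∀ j, c ≤ coordHom e j v := by
  obtain ⟨S, hS, hcone, rfl⟩ := hC
  induction S, hS using Set.Finite.induction_on with
  | empty => exact ⟨1, one_pos, by simp⟩
  | @insert D S _ _ ih =>
    rw [Set.sUnion_insert, Set.union_subset_iff] at hpos
    obtain ⟨c, hc, h⟩ := ih (fun D hD => hcone D (Set.mem_insert_of_mem _ hD)) hpos.2
    obtain ⟨c', hc', h'⟩ := exists_pos_le_coordHom_of_isRationalOpenCone e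
      (hcone D (Set.mem_insert _ _)) hpos.1 hM
    refine ⟨min c c', lt_min hc hc', fun v hv hvC j => ?_⟩
    rw [Set.sUnion_insert] at hvC
    rcases hvC with hvD | hvS
    · exact (min_le_right _ _).trans (h' v hv hvD j)
    · exact (min_le_left _ _).trans (h v hv hvS j)

theorem summable_norm_scaledLattice {M : ℕ} (hM : 0 < M) {σ : ℝ} (hσ : n < σ) :
    Summable fun v : scaledLattice n M => ‖toReal (v : V n)‖ ^ (-σ) := by
  let b := Pi.basisFun ℝ (Fin n)
  let L : Submodule ℤ (Fin n → ℝ) := Submodule.span ℤ (Set.range b)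
  have hrank : Module.finrank ℤ L = n := by
    rw [ZLattice.rank ℝ L]
    simp
  have hsum := ZLattice.summable_norm_rpow L (-σ) (by rw [hrank]; linarith)
  have hmem : ∀ v : scaledLattice n M, (M : ℝ) • toReal (v : V n) ∈ L := by
    intro v
    rw [Module.Basis.mem_span_iff_repr_mem]
    intro i
    obtain ⟨z, hz⟩ := v.2 i
    refine ⟨z, ?_⟩
    have : (M : ℝ) * ((v : V n) i : ℝ) = z := by exact_mod_cast hz
    simp [b, toReal, this]
  have hM0 : (0 : ℝ) < M := Nat.cast_pos.mpr hM
  have hinj : Function.Injective fun v : scaledLattice n M => (⟨_, hmem v⟩ : L) := by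
    intro v w h
    have h1 := Subtype.ext_iff.mp h
    have h2 := smul_right_injective (Fin n → ℝ) hM0.ne' h1
    refine Subtype.ext (funext fun i => ?_)
    have := congrFun h2 i
    simpa [toReal] using this
  have h := (hsum.comp_injective hinj).mul_left ((M : ℝ) ^ σ)
  refine h.congr fun v => ?_
  simp only [Function.comp_apply, Submodule.coe_norm, norm_smul, Real.norm_natCast]
  rw [Real.mul_rpow hM0.le (norm_nonneg _), ← mul_assoc, ← Real.rpow_add hM0, add_neg_cancel,
    Real.rpow_zero, one_mul]

/-- Each coordinate is at most `N(v) / c^{n-1}`, because the other `n - 1` factors of the norm are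
at least `c`. -/
theorem norm_toReal_le (e : Module.Basis (Fin n) ℝ (Fin n → ℝ)) {c : ℝ} (hc : 0 < c) {v : V n}
    (hv : ∀ j, c ≤ coordHom e j v) :
    ‖toReal v‖ ≤ ((∑ j, ‖e j‖) / c ^ (n - 1)) * normForm e (toReal v) := by
  classical
  have hcoord : ∀ j, coordHom e j v * c ^ (n - 1) ≤ normForm e (toReal v) := fun j => by
    rw [normForm_toReal, ← Finset.mul_prod_erase _ _ (Finset.mem_univ j)]
    refine mul_le_mul_of_nonneg_left ?_ (hc.le.trans (hv j))
    calc c ^ (n - 1) = ∏ i ∈ Finset.univ.erase j, c := by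
          rw [Finset.prod_const, Finset.card_erase_of_mem (Finset.mem_univ j), Finset.card_univ,
            Fintype.card_fin]
      _ ≤ _ := Finset.prod_le_prod (fun _ _ => hc.le) fun i _ => hv i
  have hsum : toReal v = ∑ j, coordHom e j v • e j := by
    conv_lhs => rw [← e.sum_repr (toReal v)]
    rfl
  have hcn : 0 < c ^ (n - 1) := pow_pos hc _
  rw [div_mul_eq_mul_div, Finset.sum_mul, le_div_iff₀ hcn]
  calc ‖toReal v‖ * c ^ (n - 1) ≤ (∑ j, coordHom e j v * ‖e j‖) * c ^ (n - 1) := by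
        refine mul_le_mul_of_nonneg_right ?_ hcn.le
        conv_lhs => rw [hsum]
        refine (norm_sum_le _ _).trans (Finset.sum_le_sum fun j _ => ?_)
        rw [norm_smul, Real.norm_of_nonneg (hc.le.trans (hv j))]
    _ = ∑ j, (coordHom e j v * c ^ (n - 1)) * ‖e j‖ := by
        rw [Finset.sum_mul]
        exact Finset.sum_congr rfl fun j _ => by ring
    _ ≤ ∑ j, ‖e j‖ * normForm e (toReal v) := by
        refine Finset.sum_le_sum fun j _ => ?_
        rw [mul_comm]
        exact mul_le_mul_of_nonneg_left (hcoord j) (norm_nonneg _)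

/-- Convergence of the norm form series over lattice points far from the walls. -/
theorem summable_normForm (e : Module.Basis (Fin n) ℝ (Fin n → ℝ)) {F : V n → ℤ} {B : ℤ}
    (hB : ∀ v, |F v| ≤ B) {M : ℕ} (hM : 0 < M) (hFM : ∀ v, F v ≠ 0 → v ∈ scaledLattice n M)
    {c : ℝ} (hc : 0 < c) (hFc : ∀ v, F v ≠ 0 → ∀ j, c ≤ coordHom e j v) {σ : ℝ} (hσ : n < σ) :
    Summable fun v => |(F v : ℝ)| * normForm e (toReal v) ^ (-σ) := by
  -- For `n = 0` the space is a point, and the comparison with the norm below would fail.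
  rcases Nat.eq_zero_or_pos n with rfl | hn
  · exact (hasSum_fintype _).summable
  set K : ℝ := (∑ j, ‖e j‖) / c ^ (n - 1) with hK
  have hsum := (summable_norm_scaledLattice (n := n) hM hσ).mul_left ((B : ℝ) * K ^ σ)
  have hsupp : Function.support (fun v => |(F v : ℝ)| * normForm e (toReal v) ^ (-σ)) ⊆
      scaledLattice n M := fun v hv => hFM v fun h0 => hv (by simp [h0])
  have hsub := Function.Injective.summable_iff (Subtype.val_injective
    (p := fun v => v ∈ scaledLattice n M))
    (f := fun v => |(F v : ℝ)| * normForm e (toReal v) ^ (-σ)) (fun v hv => by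
      by_contra h
      exact hv ⟨⟨v, hsupp h⟩, rfl⟩)
  rw [← hsub]
  have hB0 : (0 : ℝ) ≤ B := by exact_mod_cast (abs_nonneg _).trans (hB 0)
  refine Summable.of_nonneg_of_le (fun v => ?_) (fun v => ?_) hsum
  · by_cases hv : F v = 0
    · simp [hv]
    · exact mul_nonneg (abs_nonneg _) (Real.rpow_nonneg (Finset.prod_nonneg fun j _ =>
        hc.le.trans (hFc v hv j)) _)
  · by_cases hv : F v = 0
    · have hK0 : 0 ≤ K := by positivity
      simp only [Function.comp_apply, hv]
      simp
      positivity
    · have hle := norm_toReal_le e hc (hFc v hv)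
      have hv0 : 0 < ‖toReal (v : V n)‖ := by
        rw [norm_pos_iff]
        intro h0
        have := hc.trans_le (hFc v hv ⟨0, hn⟩)
        rw [coordHom_apply, h0, map_zero] at this
        exact this.false
      have hN : 0 < normForm e (toReal (v : V n)) :=
        Finset.prod_pos fun j _ => hc.trans_le (hFc v hv j)
      have hK0 : 0 < K := by
        by_contra! h
        exact (hv0.trans_le (hle.trans (mul_nonpos_of_nonpos_of_nonneg h hN.le))).false
      rw [Function.comp_apply, mul_assoc]
      refine mul_le_mul (by exact_mod_cast hB v) ?_ (Real.rpow_nonneg hN.le _) hB0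
      have h1 : (K * normForm e (toReal (v : V n))) ^ (-σ) ≤ ‖toReal (v : V n)‖ ^ (-σ) :=
        Real.rpow_le_rpow_of_nonpos hv0 hle (by linarith [(Nat.cast_nonneg n : (0 : ℝ) ≤ n)])
      rw [Real.mul_rpow hK0.le hN.le] at h1
      calc normForm e (toReal (v : V n)) ^ (-σ)
          = K ^ σ * (K ^ (-σ) * normForm e (toReal (v : V n)) ^ (-σ)) := by
            rw [← mul_assoc, ← Real.rpow_add hK0, add_neg_cancel, Real.rpow_zero, one_mul]
        _ ≤ _ := mul_le_mul_of_nonneg_left h1 (Real.rpow_nonneg hK0.le _)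

end Cones

/-! ### Bounds for exponential sums -/

section ExponentialSums

variable {n : ℕ} (x : Fin n → V n →ₗ[ℚ] ℝ)

theorem evalExp_apply (t : Fin n → ℝ) (r : AddMonoidAlgebra ℝ (V n)) :
    evalExp x ℝ t r = r.coeff.sum fun v a => a * Real.exp (-∑ j, t j * x j v) := by
  rw [evalExp, AddMonoidAlgebra.lift_apply]
  rfl

/-- The extension of scalars `ℚ[V] → ℝ[V]`. -/
def realify (n : ℕ) : AddMonoidAlgebra ℚ (V n) →+* AddMonoidAlgebra ℝ (V n) :=
  AddMonoidAlgebra.mapRingHom (V n) (algebraMap ℚ ℝ)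

theorem realify_coeff (r : AddMonoidAlgebra ℚ (V n)) (v : V n) :
    (realify n r).coeff v = (r.coeff v : ℝ) := by
  simp [realify]

theorem realify_single (v : V n) (a : ℚ) :
    realify n (.single v a) = .single v (a : ℝ) := by
  simp [realify]

theorem evalExp_realify (t : Fin n → ℝ) (r : AddMonoidAlgebra ℚ (V n)) :
    evalExp x ℝ t (realify n r) = evalExp x ℚ t r := by
  induction r using AddMonoidAlgebra.induction_linear with
  | zero => simp
  | add a b ha hb => rw [map_add, map_add, map_add, ha, hb]
  | single v a => rw [realify_single, evalExp_single, evalExp_single]; rfl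

/-- Elements of the group algebra all of whose exponents satisfy `x_j ≥ c`. -/
def SuppGE (c : ℝ) (r : AddMonoidAlgebra ℝ (V n)) : Prop :=
  ∀ v, r.coeff v ≠ 0 → ∀ j, c ≤ x j v

/-- The derivation `q^v ↦ λ(v) q^v`. -/
def logDeriv (l : V n →ₗ[ℚ] ℝ) :
    Derivation ℝ (AddMonoidAlgebra ℝ (V n)) (AddMonoidAlgebra ℝ (V n)) :=
  Derivation.mk' (sumOver fun v => .single v (l v)) fun a b => by
    induction a using AddMonoidAlgebra.induction_linear with
    | zero => simp
    | add a a' ha ha' => rw [add_mul, map_add, ha, ha', map_add, add_smul, smul_add]; abel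
    | single v r =>
      induction b using AddMonoidAlgebra.induction_linear with
      | zero => simp
      | add b b' hb hb' => rw [mul_add, map_add, hb, hb', map_add, add_smul, smul_add]; abel
      | single w s =>
        simp only [AddMonoidAlgebra.single_mul_single, sumOver_single, smul_eq_mul, map_add,
          AddMonoidAlgebra.smul_single, add_comm w v, ← AddMonoidAlgebra.single_add]
        congr 1
        ring

theorem logDeriv_single (l : V n →ₗ[ℚ] ℝ) (v : V n) (r : ℝ) :
    logDeriv l (.single v r) = .single v (l v * r) := by
  have : logDeriv l (.single v r) = sumOver (k := ℝ) (fun v => .single v (l v)) (.single v r) := rfl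
  rw [this, sumOver_single, AddMonoidAlgebra.smul_single, smul_eq_mul, mul_comm]

theorem logDeriv_coeff (l : V n →ₗ[ℚ] ℝ) (r : AddMonoidAlgebra ℝ (V n)) (v : V n) :
    (logDeriv l r).coeff v = l v * r.coeff v := by
  classical
  induction r using AddMonoidAlgebra.induction_linear with
  | zero => simp
  | add a b ha hb =>
    rw [map_add, AddMonoidAlgebra.coeff_add, Finsupp.add_apply, ha, hb,
      AddMonoidAlgebra.coeff_add, Finsupp.add_apply, mul_add]
  | single w r =>
    rw [logDeriv_single, AddMonoidAlgebra.coeff_single, AddMonoidAlgebra.coeff_single,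
      Finsupp.single_apply, Finsupp.single_apply]
    split_ifs with h
    · rw [h]
    · rw [mul_zero]

/-- Iterated logarithmic derivatives. -/
def logDerivs : List (V n →ₗ[ℚ] ℝ) → AddMonoidAlgebra ℝ (V n) → AddMonoidAlgebra ℝ (V n)
  | [], r => r
  | l :: L, r => logDerivs L (logDeriv l r)

theorem logDerivs_add (L : List (V n →ₗ[ℚ] ℝ)) (a b : AddMonoidAlgebra ℝ (V n)) :
    logDerivs L (a + b) = logDerivs L a + logDerivs L b := by
  induction L generalizing a b with
  | nil => rfl
  | cons l L ih => rw [logDerivs, logDerivs, logDerivs, map_add, ih]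

theorem logDerivs_smul (L : List (V n →ₗ[ℚ] ℝ)) (r : ℝ) (a : AddMonoidAlgebra ℝ (V n)) :
    logDerivs L (r • a) = r • logDerivs L a := by
  induction L generalizing a with
  | nil => rfl
  | cons l L ih => rw [logDerivs, logDerivs, Derivation.map_smul, ih]

theorem logDerivs_coeff (L : List (V n →ₗ[ℚ] ℝ)) (r : AddMonoidAlgebra ℝ (V n)) (v : V n) :
    (logDerivs L r).coeff v = (L.map fun l => l v).prod * r.coeff v := by
  induction L generalizing r with
  | nil => simp [logDerivs]
  | cons l L ih => rw [logDerivs, ih, logDeriv_coeff, List.map_cons, List.prod_cons]; ring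

variable {x}

theorem SuppGE.logDeriv {c : ℝ} {r : AddMonoidAlgebra ℝ (V n)} (hr : SuppGE x c r)
    (l : V n →ₗ[ℚ] ℝ) : SuppGE x c (logDeriv l r) := fun v hv =>
  hr v (right_ne_zero_of_mul (logDeriv_coeff l r v ▸ hv))

theorem SuppGE.logDerivs {c : ℝ} {r : AddMonoidAlgebra ℝ (V n)} (hr : SuppGE x c r)
    (L : List (V n →ₗ[ℚ] ℝ)) : SuppGE x c (logDerivs L r) := fun v hv =>
  hr v (right_ne_zero_of_mul (logDerivs_coeff L r v ▸ hv))

theorem SuppGE.mul {c : ℝ} {a b : AddMonoidAlgebra ℝ (V n)} (ha : SuppGE x 0 a)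
    (hb : SuppGE x c b) : SuppGE x c (a * b) := fun v hv j => by
  obtain ⟨u, w, hu, hw, rfl⟩ := mul_coeff_ne_zero hv
  rw [map_add]
  linarith [ha u hu j, hb w hw j]

theorem SuppGE.pow_mul {c : ℝ} {a b : AddMonoidAlgebra ℝ (V n)} (ha : SuppGE x 0 a)
    (hb : SuppGE x c b) (i : ℕ) : SuppGE x c (a ^ i * b) := by
  induction i with
  | zero => simpa using hb
  | succ i ih =>
    rw [pow_succ', mul_assoc]
    exact ha.mul ih

theorem exp_neg_sum_le {c : ℝ} {v : V n} (hv : ∀ j, c ≤ x j v) {t : Fin n → ℝ}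
    (ht : ∀ j, 0 ≤ t j) :
    Real.exp (-∑ j, t j * x j v) ≤ ∏ j, Real.exp (-c * t j) := by
  rw [← Real.exp_sum, Real.exp_le_exp, ← Finset.sum_neg_distrib]
  refine Finset.sum_le_sum fun j _ => ?_
  nlinarith [mul_le_mul_of_nonneg_left (hv j) (ht j)]

theorem abs_evalExp_le {c : ℝ} {r : AddMonoidAlgebra ℝ (V n)} (hr : SuppGE x c r)
    {t : Fin n → ℝ} (ht : ∀ j, 0 ≤ t j) :
    |evalExp x ℝ t r| ≤ (∑ v ∈ r.coeff.support, |r.coeff v|) * ∏ j, Real.exp (-c * t j) := by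
  rw [evalExp_apply, Finsupp.sum, Finset.sum_mul]
  refine (Finset.abs_sum_le_sum_abs _ _).trans (Finset.sum_le_sum fun v hv => ?_)
  rw [abs_mul, abs_of_pos (Real.exp_pos _)]
  exact mul_le_mul_of_nonneg_left (exp_neg_sum_le (hr v (Finsupp.mem_support_iff.mp hv)) ht)
    (abs_nonneg _)

/-- The derivatives of `D^i c` decay geometrically in `i` if `|D| ≤ ρ`. -/
theorem exists_abs_evalExp_logDerivs_le {c₀ ρ : ℝ} (hρ : 0 < ρ) {D : AddMonoidAlgebra ℝ (V n)}
    (hD : SuppGE x 0 D)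
    (hDρ : ∀ t : Fin n → ℝ, (∀ j, 0 ≤ t j) → |evalExp x ℝ t D| ≤ ρ)
    (L : List (V n →ₗ[ℚ] ℝ)) {c : AddMonoidAlgebra ℝ (V n)} (hc : SuppGE x c₀ c) :
    ∃ K : ℝ, 0 ≤ K ∧ ∀ (i : ℕ) (t : Fin n → ℝ), (∀ j, 0 ≤ t j) →
      |evalExp x ℝ t (logDerivs L (D ^ i * c))| ≤
        K * ((i + 1 : ℝ) ^ L.length * ρ ^ i) * ∏ j, Real.exp (-c₀ * t j) := by
  induction L generalizing c with
  | nil =>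
    refine ⟨∑ v ∈ c.coeff.support, |c.coeff v|, Finset.sum_nonneg fun v _ => abs_nonneg _,
      fun i t ht => ?_⟩
    rw [logDerivs, map_mul, map_pow, abs_mul, abs_pow, List.length_nil, pow_zero, one_mul,
      mul_comm _ (ρ ^ i), mul_assoc]
    exact mul_le_mul (pow_le_pow_left₀ (abs_nonneg _) (hDρ t ht) i) (abs_evalExp_le hc ht)
      (abs_nonneg _) (pow_nonneg hρ.le i)
  | cons l L ih =>
    obtain ⟨K₁, hK₁, h₁⟩ := ih (c := logDeriv l D * c) ((hD.logDeriv l).mul hc)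
    obtain ⟨K₂, hK₂, h₂⟩ := ih (c := logDeriv l c) (hc.logDeriv l)
    refine ⟨K₁ * ρ⁻¹ + K₂, by positivity, fun i t ht => ?_⟩
    have hE : 0 ≤ ∏ j, Real.exp (-c₀ * t j) := Finset.prod_nonneg fun j _ => (Real.exp_pos _).le
    -- By Leibniz both terms again have the form of a power of `D` times an element with the same
    -- support bound, so the induction applies with a shorter list. The factor `i` raises the
    -- polynomial degree by one, and `ρ⁻¹` in the constant makes up for the lost power of `D`.
    have hder : logDeriv l (D ^ i * c) =
        (i : ℝ) • (D ^ (i - 1) * (logDeriv l D * c)) + D ^ i * logDeriv l c := by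
      rw [Derivation.leibniz, Derivation.leibniz_pow, add_comm]
      congr 1
      rw [Nat.cast_smul_eq_nsmul, smul_eq_mul, smul_eq_mul, nsmul_eq_mul, nsmul_eq_mul]
      ring
    rw [logDerivs, hder, logDerivs_add, logDerivs_smul, map_add, map_smul, smul_eq_mul]
    refine (abs_add_le _ _).trans ?_
    rw [add_mul, add_mul]
    refine add_le_add ?_ ?_
    · rcases Nat.eq_zero_or_pos i with rfl | hi
      · simp only [Nat.cast_zero, zero_mul, abs_zero]
        positivity
      · obtain ⟨m, rfl⟩ := Nat.exists_eq_add_of_le' hi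
        rw [abs_mul, Nat.abs_cast, Nat.add_sub_cancel]
        refine (mul_le_mul_of_nonneg_left (h₁ m t ht) (Nat.cast_nonneg _)).trans ?_
        rw [← mul_assoc]
        refine mul_le_mul_of_nonneg_right ?_ hE
        have e : K₁ * ρ⁻¹ * (((m + 1 : ℕ) + 1 : ℝ) ^ (l :: L).length * ρ ^ (m + 1)) =
            K₁ * (((m + 1 : ℕ) + 1 : ℝ) ^ (L.length + 1) * ρ ^ m) := by
          rw [List.length_cons, pow_succ ρ]
          field_simp
        rw [e, pow_succ, mul_left_comm]
        refine mul_le_mul_of_nonneg_left ?_ hK₁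
        have h3 : (m + 1 : ℝ) ^ L.length ≤ ((m + 1 : ℕ) + 1 : ℝ) ^ L.length := by
          push_cast
          gcongr
          linarith
        have h4 : ((m + 1 : ℕ) : ℝ) ≤ (m + 1 : ℕ) + 1 := by linarith
        calc ((m + 1 : ℕ) : ℝ) * ((m + 1 : ℝ) ^ L.length * ρ ^ m)
            ≤ ((m + 1 : ℕ) + 1 : ℝ) * (((m + 1 : ℕ) + 1 : ℝ) ^ L.length * ρ ^ m) := by gcongr
          _ = _ := by ring
    · refine (h₂ i t ht).trans ?_
      rw [List.length_cons]
      gcongr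
      · linarith [(Nat.cast_nonneg i : (0 : ℝ) ≤ i)]
      · exact Nat.le_succ _

end ExponentialSums

/-! ### Mellin transforms in several variables -/

section Mellin

variable {n : ℕ}

/-- The measure `dt` on `(0, ∞)^n`. -/
def orthantMeasure (n : ℕ) : Measure (Fin n → ℝ) :=
  Measure.pi fun _ => volume.restrict (Set.Ioi 0)

theorem ae_pos : ∀ᵐ t ∂orthantMeasure n, ∀ j, 0 < t j := by
  rw [orthantMeasure, ← Measure.restrict_pi_pi]
  filter_upwards [ae_restrict_mem (MeasurableSet.univ_pi fun _ => measurableSet_Ioi)] with t ht j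
  exact ht j trivial

/-- The kernel of the Mellin transform. -/
def mellinKernel (s : ℂ) (t : Fin n → ℝ) : ℂ := ∏ j, (t j : ℂ) ^ (s - 1)

/-- The integral of a non-integrable function is `0` by convention, whereas the Gamma integral has a
nonzero value. -/
theorem integrableOn_cpow_mul_exp {s : ℂ} (hs : 0 < s.re) {r : ℝ} (hr : 0 < r) :
    IntegrableOn (fun t : ℝ => (t : ℂ) ^ (s - 1) * Complex.exp (-(r * t))) (Set.Ioi 0) := by
  by_contra h
  have h1 := Complex.integral_cpow_mul_exp_neg_mul_Ioi hs (r := r) (by simpa using hr)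
  rw [integral_undef h] at h1
  have h2 : (1 / (r : ℂ)) ^ s * Complex.Gamma s ≠ 0 := by
    refine mul_ne_zero ?_ (Complex.Gamma_ne_zero_of_re_pos hs)
    rw [Complex.cpow_ne_zero_iff]
    left
    exact one_div_ne_zero (by exact_mod_cast hr.ne')
  exact h2 h1.symm

theorem exp_mul_mellinKernel (s : ℂ) (y : Fin n → ℝ) (t : Fin n → ℝ) :
    (Real.exp (-∑ j, t j * y j) : ℂ) * mellinKernel s t =
      ∏ j, ((t j : ℂ) ^ (s - 1) * Complex.exp (-(y j * t j))) := by
  rw [Finset.prod_mul_distrib, mul_comm, mellinKernel, ← Complex.exp_sum]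
  congr 1
  push_cast
  rw [← Finset.sum_neg_distrib]
  congr 1
  exact Finset.sum_congr rfl fun j _ => by ring

theorem integrable_exp_mul_mellinKernel {s : ℂ} (hs : 0 < s.re) {y : Fin n → ℝ}
    (hy : ∀ j, 0 < y j) :
    Integrable (fun t => (Real.exp (-∑ j, t j * y j) : ℂ) * mellinKernel s t)
      (orthantMeasure n) := by
  simp only [exp_mul_mellinKernel]
  exact Integrable.fintype_prod (f := fun j (t : ℝ) =>
    (t : ℂ) ^ (s - 1) * Complex.exp (-(y j * t))) fun j => integrableOn_cpow_mul_exp hs (hy j)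

theorem ofReal_prod_cpow (y : Fin n → ℝ) (hy : ∀ j, 0 ≤ y j) (s : ℂ) :
    ((∏ j, y j : ℝ) : ℂ) ^ s = ∏ j, (y j : ℂ) ^ s := by
  have : ∀ S : Finset (Fin n), ((∏ j ∈ S, y j : ℝ) : ℂ) ^ s = ∏ j ∈ S, (y j : ℂ) ^ s := by
    classical
    intro S
    induction S using Finset.induction_on with
    | empty => simp
    | insert j S hj ih =>
      rw [Finset.prod_insert hj, Finset.prod_insert hj, Complex.ofReal_mul,
        Complex.mul_cpow_ofReal_nonneg (hy j) (Finset.prod_nonneg fun j _ => hy j), ih]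
  exact this _

theorem integral_exp_mul_mellinKernel {s : ℂ} (hs : 0 < s.re) {y : Fin n → ℝ}
    (hy : ∀ j, 0 < y j) :
    ∫ t, (Real.exp (-∑ j, t j * y j) : ℂ) * mellinKernel s t ∂orthantMeasure n =
      Complex.Gamma s ^ n * ((∏ j, y j : ℝ) : ℂ) ^ (-s) := by
  simp only [exp_mul_mellinKernel]
  rw [orthantMeasure, integral_fintype_prod_eq_prod (𝕜 := ℂ) (f := fun j (t : ℝ) =>
    (t : ℂ) ^ (s - 1) * Complex.exp (-(y j * t))), ofReal_prod_cpow _ fun j => (hy j).le]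
  have h : ∀ j, ∫ t in Set.Ioi (0 : ℝ), (t : ℂ) ^ (s - 1) * Complex.exp (-(y j * t)) =
      Complex.Gamma s * (y j : ℂ) ^ (-s) := fun j => by
    rw [Complex.integral_cpow_mul_exp_neg_mul_Ioi hs (by simpa using hy j), one_div,
      Complex.inv_cpow _ _ (by
        rw [Complex.arg_ofReal_of_nonneg (hy j).le]
        exact Real.pi_pos.ne), Complex.cpow_neg, mul_comm]
  simp only [h]
  rw [Finset.prod_mul_distrib, Finset.prod_const, Finset.card_univ, Fintype.card_fin]

theorem norm_mellinKernel {s : ℂ} {t : Fin n → ℝ} (ht : ∀ j, 0 < t j) :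
    ‖mellinKernel s t‖ = ∏ j, t j ^ (s.re - 1) := by
  rw [mellinKernel, norm_prod]
  refine Finset.prod_congr rfl fun j _ => ?_
  rw [Complex.norm_cpow_eq_rpow_re_of_pos (ht j)]
  simp

theorem norm_exp_mul_mellinKernel (s : ℂ) (y : Fin n → ℝ) {t : Fin n → ℝ} (ht : ∀ j, 0 < t j) :
    ‖(Real.exp (-∑ j, t j * y j) : ℂ) * mellinKernel s t‖ =
      ((Real.exp (-∑ j, t j * y j) : ℂ) * mellinKernel (s.re : ℂ) t).re := by
  have h1 : mellinKernel (s.re : ℂ) t = ((∏ j, t j ^ (s.re - 1) : ℝ) : ℂ) := by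
    rw [mellinKernel, Complex.ofReal_prod]
    refine Finset.prod_congr rfl fun j _ => ?_
    rw [Complex.ofReal_cpow (ht j).le]
    simp
  rw [norm_mul, norm_mellinKernel ht, h1, ← Complex.ofReal_mul, Complex.ofReal_re,
    Complex.norm_of_nonneg (Real.exp_pos _).le]

/-- Taking absolute values replaces `s` by its real part, so the `L¹` norm is again a Gamma
integral. -/
theorem integral_norm_exp_mul_mellinKernel {s : ℂ} (hs : 0 < s.re) {y : Fin n → ℝ}
    (hy : ∀ j, 0 < y j) :
    ∫ t, ‖(Real.exp (-∑ j, t j * y j) : ℂ) * mellinKernel s t‖ ∂orthantMeasure n =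
      Real.Gamma s.re ^ n * (∏ j, y j) ^ (-s.re) := by
  have hs' : 0 < ((s.re : ℝ) : ℂ).re := by simpa using hs
  have h1 : ∫ t, ‖(Real.exp (-∑ j, t j * y j) : ℂ) * mellinKernel s t‖ ∂orthantMeasure n =
      ∫ t, ((Real.exp (-∑ j, t j * y j) : ℂ) * mellinKernel (s.re : ℂ) t).re
        ∂orthantMeasure n := by
    refine integral_congr_ae ?_
    filter_upwards [ae_pos] with t ht
    exact norm_exp_mul_mellinKernel s y ht
  have h2 := integral_re (integrable_exp_mul_mellinKernel hs' hy)
  simp only [RCLike.re_to_complex] at h2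
  rw [h1, h2, integral_exp_mul_mellinKernel hs' hy, Complex.Gamma_ofReal, ← Complex.ofReal_neg,
    ← Complex.ofReal_cpow (Finset.prod_nonneg fun j _ => (hy j).le), ← Complex.ofReal_pow,
    ← Complex.ofReal_mul, Complex.ofReal_re]

end Mellin

/-! ### Analytic continuation -/

section Continuation

variable {n : ℕ} (x : Fin n → V n →ₗ[ℚ] ℝ)

/-- The Dirichlet polynomial `∑_v r(v) (∏_j x_j(v))^{-s}`. -/
def dirichlet (s : ℂ) : AddMonoidAlgebra ℝ (V n) →ₗ[ℝ] ℂ :=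
  sumOver fun v => ((∏ j, x j v : ℝ) : ℂ) ^ (-s)

theorem dirichlet_apply (s : ℂ) (r : AddMonoidAlgebra ℝ (V n)) :
    dirichlet x s r = ∑ v ∈ r.coeff.support, (r.coeff v : ℂ) * ((∏ j, x j v : ℝ) : ℂ) ^ (-s) := by
  rw [dirichlet, sumOver_apply, Finsupp.sum]
  exact Finset.sum_congr rfl fun v _ => Complex.real_smul

variable {x}

theorem differentiable_dirichlet {c₀ : ℝ} (hc₀ : 0 < c₀) {r : AddMonoidAlgebra ℝ (V n)}
    (hr : SuppGE x c₀ r) : Differentiable ℂ fun s => dirichlet x s r := by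
  simp only [dirichlet_apply]
  refine Differentiable.fun_sum fun v hv => Differentiable.const_mul ?_ _
  have hN : ((∏ j, x j v : ℝ) : ℂ) ≠ 0 := by
    rw [Complex.ofReal_ne_zero]
    exact (Finset.prod_pos fun j _ =>
      hc₀.trans_le (hr v (Finsupp.mem_support_iff.mp hv) j)).ne'
  exact fun s => (differentiableAt_id.neg).const_cpow (Or.inl hN)

theorem evalExp_mul_mellinKernel (s : ℂ) (r : AddMonoidAlgebra ℝ (V n)) (t : Fin n → ℝ) :
    (evalExp x ℝ t r : ℂ) * mellinKernel s t = ∑ v ∈ r.coeff.support,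
      (r.coeff v : ℂ) * ((Real.exp (-∑ j, t j * x j v) : ℂ) * mellinKernel s t) := by
  rw [evalExp_apply, Finsupp.sum, Complex.ofReal_sum, Finset.sum_mul]
  exact Finset.sum_congr rfl fun v _ => by rw [Complex.ofReal_mul, mul_assoc]

theorem integrable_evalExp {c₀ : ℝ} (hc₀ : 0 < c₀) {r : AddMonoidAlgebra ℝ (V n)}
    (hr : SuppGE x c₀ r) {s : ℂ} (hs : 0 < s.re) :
    Integrable (fun t => (evalExp x ℝ t r : ℂ) * mellinKernel s t) (orthantMeasure n) := by
  simp only [evalExp_mul_mellinKernel]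
  exact integrable_finsetSum _ fun v hv => (integrable_exp_mul_mellinKernel hs fun j =>
    hc₀.trans_le (hr v (Finsupp.mem_support_iff.mp hv) j)).const_mul _

theorem integral_evalExp {c₀ : ℝ} (hc₀ : 0 < c₀) {r : AddMonoidAlgebra ℝ (V n)}
    (hr : SuppGE x c₀ r) {s : ℂ} (hs : 0 < s.re) :
    ∫ t, (evalExp x ℝ t r : ℂ) * mellinKernel s t ∂orthantMeasure n =
      Complex.Gamma s ^ n * dirichlet x s r := by
  have hpos : ∀ v ∈ r.coeff.support, ∀ j, 0 < x j v := fun v hv j =>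
    hc₀.trans_le (hr v (Finsupp.mem_support_iff.mp hv) j)
  simp only [evalExp_mul_mellinKernel]
  rw [integral_finsetSum _ fun v hv =>
    (integrable_exp_mul_mellinKernel hs (hpos v hv)).const_mul _, dirichlet_apply, Finset.mul_sum]
  refine Finset.sum_congr rfl fun v hv => ?_
  rw [integral_const_mul, integral_exp_mul_mellinKernel hs (hpos v hv), mul_left_comm]

variable (x) in
/-- Every `x_j` repeated `K` times. -/
def coordList (K : ℕ) : List (V n →ₗ[ℚ] ℝ) := (List.replicate K (List.ofFn x)).flatten

theorem coordList_prod (K : ℕ) (v : V n) :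
    ((coordList x K).map fun l => l v).prod = (∏ j, x j v) ^ K := by
  rw [coordList, List.map_flatten, List.map_replicate, List.prod_flatten, List.map_replicate,
    List.prod_replicate, List.map_ofFn, List.prod_ofFn]
  rfl

/-- The derivatives multiply the coefficient at `v` by `N(v)^K`, which undoes the shift from `s` to
`s + K`. So any `s` can be moved to the half-plane where the Mellin integral converges. -/
theorem dirichlet_logDerivs {c₀ : ℝ} (hc₀ : 0 < c₀) {r : AddMonoidAlgebra ℝ (V n)}
    (hr : SuppGE x c₀ r) (K : ℕ) (s : ℂ) :
    dirichlet x (s + K) (logDerivs (coordList x K) r) = dirichlet x s r := by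
  rw [dirichlet_apply, dirichlet_apply]
  have hsub : (logDerivs (coordList x K) r).coeff.support ⊆ r.coeff.support := fun v hv => by
    rw [Finsupp.mem_support_iff, logDerivs_coeff] at hv
    exact Finsupp.mem_support_iff.mpr (right_ne_zero_of_mul hv)
  rw [Finset.sum_subset hsub fun v _ hv => by rw [Finsupp.notMem_support_iff.mp hv]; simp]
  refine Finset.sum_congr rfl fun v hv => ?_
  have hN : ((∏ j, x j v : ℝ) : ℂ) ≠ 0 := by
    rw [Complex.ofReal_ne_zero]
    exact (Finset.prod_pos fun j _ =>
      hc₀.trans_le (hr v (Finsupp.mem_support_iff.mp hv) j)).ne'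
  rw [logDerivs_coeff, coordList_prod, neg_add, Complex.cpow_add _ _ hN, Complex.cpow_neg _ (K : ℂ),
    Complex.cpow_natCast, Complex.ofReal_mul, Complex.ofReal_pow]
  have := pow_ne_zero K hN
  field_simp

/-- Dividing the Mellin integral by `Γ(s)^n` turns a pointwise bound for the exponential sum into
one for the Dirichlet polynomial. -/
theorem norm_dirichlet_le {c₀ : ℝ} (hc₀ : 0 < c₀) {r : AddMonoidAlgebra ℝ (V n)}
    (hr : SuppGE x c₀ r) {s : ℂ} (hs : 0 < s.re) {B : ℝ}
    (hB : ∀ t : Fin n → ℝ, (∀ j, 0 ≤ t j) →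
      |evalExp x ℝ t r| ≤ B * ∏ j, Real.exp (-c₀ * t j)) :
    ‖dirichlet x s r‖ ≤
      B * (‖(Complex.Gamma s)⁻¹‖ ^ n * (Real.Gamma s.re ^ n * (c₀ ^ n) ^ (-s.re))) := by
  have hG : Complex.Gamma s ^ n ≠ 0 := pow_ne_zero _ (Complex.Gamma_ne_zero_of_re_pos hs)
  have h1 : dirichlet x s r = (Complex.Gamma s)⁻¹ ^ n *
      ∫ t, (evalExp x ℝ t r : ℂ) * mellinKernel s t ∂orthantMeasure n := by
    rw [integral_evalExp hc₀ hr hs, inv_pow, inv_mul_cancel_left₀ hG]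
  have hconst := integral_norm_exp_mul_mellinKernel hs (y := fun _ : Fin n => c₀) fun _ => hc₀
  rw [Finset.prod_const, Finset.card_univ, Fintype.card_fin] at hconst
  rw [h1, norm_mul, norm_pow, mul_left_comm]
  refine mul_le_mul_of_nonneg_left ?_ (by positivity)
  rw [← hconst, ← integral_const_mul]
  refine norm_integral_le_of_norm_le
    ((integrable_exp_mul_mellinKernel hs fun _ => hc₀).norm.const_mul B) ?_
  filter_upwards [ae_pos] with t ht
  rw [norm_mul, norm_mul, ← mul_assoc]
  refine mul_le_mul_of_nonneg_right ?_ (norm_nonneg _)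
  rw [Complex.norm_real, Complex.norm_real, Real.norm_eq_abs,
    Real.norm_of_nonneg (Real.exp_pos _).le]
  refine (hB t fun j => (ht j).le).trans_eq ?_
  rw [← Real.exp_sum, ← Finset.sum_neg_distrib]
  congr 2
  exact Finset.sum_congr rfl fun j _ => by ring

theorem summable_succ_pow_mul_geometric {ρ : ℝ} (hρ : 0 < ρ) (hρ1 : ρ < 1) (m : ℕ) :
    Summable fun i : ℕ => (i + 1 : ℝ) ^ m * ρ ^ i := by
  have h := summable_pow_mul_geometric_of_norm_lt_one (R := ℝ) m
    (r := ρ) (by rwa [Real.norm_of_nonneg hρ.le])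
  have h1 := ((summable_nat_add_iff 1).mpr h).mul_left ρ⁻¹
  refine h1.congr fun i => ?_
  push_cast
  rw [pow_succ ρ]
  field_simp

variable {c₀ ρ : ℝ} {D c : AddMonoidAlgebra ℝ (V n)}

/-- Locally uniform convergence of the series `∑_i dirichlet (D^i c)`. -/
theorem exists_summable_norm_dirichlet_le (hc₀ : 0 < c₀) (hρ : 0 < ρ) (hρ1 : ρ < 1)
    (hD : SuppGE x 0 D) (hDρ : ∀ t : Fin n → ℝ, (∀ j, 0 ≤ t j) → |evalExp x ℝ t D| ≤ ρ)
    (hc : SuppGE x c₀ c) (s₀ : ℂ) :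
    ∃ (U : Set ℂ) (u : ℕ → ℝ), IsOpen U ∧ s₀ ∈ U ∧ Summable u ∧
      ∀ i, ∀ s ∈ U, ‖dirichlet x s (D ^ i * c)‖ ≤ u i := by
  obtain ⟨K, hK⟩ := exists_nat_gt (-s₀.re)
  have hK0 : 0 < s₀.re + K := by linarith
  obtain ⟨B, hB0, hB⟩ := exists_abs_evalExp_logDerivs_le hρ hD hDρ (coordList x K) hc
  -- The factor independent of `i`; it is continuous at `s₀`, hence bounded by `Φ s₀ + 1` nearby.
  set Φ : ℂ → ℝ := fun s => ‖(Complex.Gamma (s + K))⁻¹‖ ^ n *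
    (Real.Gamma (s.re + K) ^ n * (c₀ ^ n) ^ (-(s.re + K))) with hΦ
  have hcont : ContinuousAt Φ s₀ := by
    have hre : ContinuousAt (fun s : ℂ => s.re + K) s₀ := by fun_prop
    refine ContinuousAt.mul (ContinuousAt.pow (ContinuousAt.norm ?_) n)
      (ContinuousAt.mul (ContinuousAt.pow ?_ n) ?_)
    · have h := Complex.differentiable_one_div_Gamma.continuous
      exact (h.comp (continuous_id.add continuous_const)).continuousAt
    · have h := (Real.differentiableAt_Gamma (s := s₀.re + K) fun m hm => by
        have : (0 : ℝ) ≤ m := Nat.cast_nonneg m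
        linarith).continuousAt
      exact ContinuousAt.comp' h hre
    · exact ContinuousAt.rpow continuousAt_const hre.neg (Or.inl (pow_pos hc₀ n).ne')
  have hev : ∀ᶠ s in nhds s₀, Φ s < Φ s₀ + 1 ∧ 0 < s.re + K :=
    (hcont.eventually_lt continuousAt_const (by simp)).and
      ((by fun_prop : ContinuousAt (fun s : ℂ => s.re + K) s₀).eventually_const_lt hK0)
  obtain ⟨U, hU, hUo, hs₀⟩ := eventually_nhds_iff.mp hev
  refine ⟨U, fun i => B * ((i + 1 : ℝ) ^ (coordList x K).length * ρ ^ i) * (Φ s₀ + 1), hUo, hs₀,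
    ((summable_succ_pow_mul_geometric hρ hρ1 _).mul_left B).mul_right _, fun i s hs => ?_⟩
  obtain ⟨h1, h2⟩ := hU s hs
  have hsupp : SuppGE x c₀ (D ^ i * c) := hD.pow_mul hc i
  rw [← dirichlet_logDerivs hc₀ hsupp K s]
  refine (norm_dirichlet_le hc₀ (hsupp.logDerivs _) (s := s + K) (by simpa using h2)
    (hB i)).trans ?_
  refine mul_le_mul_of_nonneg_left ?_ (by positivity)
  have e : (s + K).re = s.re + K := by simp
  rw [e]
  exact h1.le

theorem differentiable_tsum_dirichlet (hc₀ : 0 < c₀) (hρ : 0 < ρ) (hρ1 : ρ < 1)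
    (hD : SuppGE x 0 D) (hDρ : ∀ t : Fin n → ℝ, (∀ j, 0 ≤ t j) → |evalExp x ℝ t D| ≤ ρ)
    (hc : SuppGE x c₀ c) : Differentiable ℂ fun s => ∑' i, dirichlet x s (D ^ i * c) := by
  intro s₀
  obtain ⟨U, u, hU, hs₀, hu, hle⟩ := exists_summable_norm_dirichlet_le hc₀ hρ hρ1 hD hDρ hc s₀
  exact (Complex.differentiableOn_tsum_of_summable_norm hu (fun i =>
    (differentiable_dirichlet hc₀ (hD.pow_mul hc i)).differentiableOn) hU hle).differentiableAt
    (hU.mem_nhds hs₀)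

/-- The series `∑_i dirichlet (D^i c)` as a Mellin transform. -/
theorem tsum_dirichlet_eq_integral (hc₀ : 0 < c₀) (hρ : 0 < ρ) (hρ1 : ρ < 1)
    (hD : SuppGE x 0 D) (hDρ : ∀ t : Fin n → ℝ, (∀ j, 0 ≤ t j) → |evalExp x ℝ t D| ≤ ρ)
    (hc : SuppGE x c₀ c) {s : ℂ} (hs : 0 < s.re) :
    Complex.Gamma s ^ n * ∑' i, dirichlet x s (D ^ i * c) =
      ∫ t, ((evalExp x ℝ t c / (1 - evalExp x ℝ t D) : ℝ) : ℂ) * mellinKernel s t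
        ∂orthantMeasure n := by
  have hsupp : ∀ i, SuppGE x c₀ (D ^ i * c) := hD.pow_mul hc
  -- The empty list gives the plain geometric bound, which justifies exchanging sum and integral.
  obtain ⟨B, hB0, hB⟩ := exists_abs_evalExp_logDerivs_le hρ hD hDρ [] hc
  have hnorm : ∀ i, ∫ t, ‖(evalExp x ℝ t (D ^ i * c) : ℂ) * mellinKernel s t‖ ∂orthantMeasure n ≤
      B * ρ ^ i * ∫ t, ‖(Real.exp (-∑ j, t j * (fun _ : Fin n => c₀) j) : ℂ) * mellinKernel s t‖
        ∂orthantMeasure n := by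
    intro i
    rw [← integral_const_mul]
    refine integral_mono_ae (integrable_evalExp hc₀ (hsupp i) hs).norm
      ((integrable_exp_mul_mellinKernel hs fun _ => hc₀).norm.const_mul _) ?_
    filter_upwards [ae_pos] with t ht
    rw [norm_mul, norm_mul, ← mul_assoc]
    refine mul_le_mul_of_nonneg_right ?_ (norm_nonneg _)
    rw [Complex.norm_real, Complex.norm_real, Real.norm_eq_abs,
      Real.norm_of_nonneg (Real.exp_pos _).le]
    refine (hB i t fun j => (ht j).le).trans_eq ?_
    rw [← Real.exp_sum, ← Finset.sum_neg_distrib, List.length_nil, pow_zero, one_mul]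
    congr 2
    exact Finset.sum_congr rfl fun j _ => by ring
  have hsummable : Summable fun i => ∫ t,
      ‖(evalExp x ℝ t (D ^ i * c) : ℂ) * mellinKernel s t‖ ∂orthantMeasure n :=
    Summable.of_nonneg_of_le (fun i => integral_nonneg fun t => norm_nonneg _) hnorm
      (((summable_geometric_of_lt_one hρ.le hρ1).mul_left B).mul_right _)
  have h := hasSum_integral_of_summable_integral_norm
    (fun i => integrable_evalExp hc₀ (hsupp i) hs) hsummable
  simp only [integral_evalExp hc₀ (hsupp _) hs] at h
  rw [← tsum_mul_left, h.tsum_eq]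
  refine integral_congr_ae ?_
  filter_upwards [ae_pos] with t ht
  have hlt : |evalExp x ℝ t D| < 1 := (hDρ t fun j => (ht j).le).trans_lt hρ1
  have hgeom := ((hasSum_geometric_of_abs_lt_one hlt).mul_right (evalExp x ℝ t c))
  have h2 : HasSum (fun i : ℕ => evalExp x ℝ t (D ^ i * c))
      (evalExp x ℝ t c / (1 - evalExp x ℝ t D)) := by
    simp only [map_mul, map_pow]
    rw [div_eq_inv_mul]
    exact hgeom
  exact ((Complex.hasSum_ofReal.mpr h2).mul_right _).tsum_eq

end Continuation

/-! ### The Dirichlet series of a function on `V` -/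

section Series

variable {n : ℕ} {x : Fin n → V n →ₗ[ℚ] ℝ}

/-- Compare `exp(-y)` with `m! / y^m` in each coordinate; the product is a constant times
`N(v)^{-m}`. -/
theorem summable_exp {F : V n → ℤ} {c₀ : ℝ} (hc₀ : 0 < c₀) (hFc : ∀ v, F v ≠ 0 → ∀ j, c₀ ≤ x j v)
    {m : ℕ} (hsum : Summable fun v => |(F v : ℝ)| * (∏ j, x j v) ^ (-(m : ℝ))) {t : Fin n → ℝ}
    (ht : ∀ j, 0 < t j) : Summable fun v => (F v : ℝ) * Real.exp (-∑ j, t j * x j v) := by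
  refine Summable.of_norm_bounded (hsum.mul_left (∏ j, (m.factorial : ℝ) / t j ^ m)) fun v => ?_
  by_cases hv : F v = 0
  · simp [hv]
  have hpos : ∀ j, 0 < x j v := fun j => hc₀.trans_le (hFc v hv j)
  rw [norm_mul, Real.norm_eq_abs, Real.norm_of_nonneg (Real.exp_pos _).le, mul_left_comm]
  refine mul_le_mul_of_nonneg_left ?_ (abs_nonneg _)
  rw [Real.rpow_neg (Finset.prod_nonneg fun j _ => (hpos j).le), Real.rpow_natCast,
    ← Finset.prod_pow, ← Finset.prod_inv_distrib, ← Finset.prod_mul_distrib,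
    ← Finset.sum_neg_distrib, Real.exp_sum]
  refine Finset.prod_le_prod (fun j _ => (Real.exp_pos _).le) fun j _ => ?_
  have hy : 0 < t j * x j v := mul_pos (ht j) (hpos j)
  have h := Real.pow_div_factorial_le_exp _ hy.le m
  rw [Real.exp_neg, ← div_eq_mul_inv, div_div, ← mul_pow, ← inv_div]
  exact inv_anti₀ (by positivity) h

theorem hasSum_act {F : V n → ℚ} {t : Fin n → ℝ} {G : ℝ}
    (hG : HasSum (fun v => (F v : ℝ) * Real.exp (-∑ j, t j * x j v)) G)
    (a : AddMonoidAlgebra ℚ (V n)) :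
    HasSum (fun v => (act ℚ (V n) a F v : ℝ) * Real.exp (-∑ j, t j * x j v))
      (evalExp x ℚ t a * G) := by
  induction a using AddMonoidAlgebra.induction_linear with
  | zero => simp
  | add a b ha hb =>
    rw [map_add, map_add, add_mul]
    convert ha.add hb using 2
    rw [LinearMap.add_apply, Pi.add_apply, Rat.cast_add, add_mul]
  | single w r =>
    have h := ((Equiv.subRight w).hasSum_iff.mpr hG).mul_left (evalExp x ℚ t (.single w r))
    rw [show (fun v => (act ℚ (V n) (.single w r) F v : ℝ) * Real.exp (-∑ j, t j * x j v)) = _ from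
      funext fun v => ?_]
    · exact h
    change _ = _ * ((F (v - w) : ℝ) * Real.exp (-∑ j, t j * x j (v - w)))
    rw [act_single, evalExp_single, Rat.cast_mul]
    have : Real.exp (-∑ j, t j * x j v) =
        Real.exp (-∑ j, t j * x j w) * Real.exp (-∑ j, t j * x j (v - w)) := by
      rw [← Real.exp_add]
      congr 1
      simp only [map_sub, mul_sub, Finset.sum_sub_distrib]
      ring
    rw [this]
    simp only [eq_ratCast]
    ring

/-- Under absolute convergence the formal identity `aF = c` becomes an identity of numbers,
translation by `w` being a reindexing of the sum. -/
theorem evalExp_eq_mul {F : V n → ℚ} {t : Fin n → ℝ}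
    (hF : Summable fun v => (F v : ℝ) * Real.exp (-∑ j, t j * x j v))
    {a c : AddMonoidAlgebra ℚ (V n)} (h : act ℚ (V n) a F = c.coeff) :
    evalExp x ℚ t c =
      evalExp x ℚ t a * ∑' v, (F v : ℝ) * Real.exp (-∑ j, t j * x j v) := by
  have h1 := hasSum_act hF.hasSum a
  rw [h] at h1
  refine HasSum.unique ?_ h1
  have h2 : evalExp x ℚ t c =
      ∑ v ∈ c.coeff.support, (c.coeff v : ℝ) * Real.exp (-∑ j, t j * x j v) := by
    rw [← evalExp_realify, evalExp_apply]
    refine (Finsupp.sum_of_support_subset _ (s := c.coeff.support) (fun v hv => ?_) _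
      (by simp)).trans ?_
    · rw [Finsupp.mem_support_iff, realify_coeff] at hv
      rw [Finsupp.mem_support_iff]
      rintro h0
      exact hv (by rw [h0, Rat.cast_zero])
    · exact Finset.sum_congr rfl fun v _ => by rw [realify_coeff]
  rw [h2]
  refine hasSum_sum_of_ne_finset_zero fun v hv => ?_
  rw [Finsupp.notMem_support_iff.mp hv]
  simp

/-- A Dirichlet series as a Mellin transform. -/
theorem hasSum_eq_integral {F : V n → ℤ} {c₀ : ℝ} (hc₀ : 0 < c₀)
    (hFc : ∀ v, F v ≠ 0 → ∀ j, c₀ ≤ x j v) {s : ℂ} (hs : 0 < s.re)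
    (hsum : Summable fun v => |(F v : ℝ)| * (∏ j, x j v) ^ (-s.re)) :
    HasSum (fun v => Complex.Gamma s ^ n * ((F v : ℂ) * ((∏ j, x j v : ℝ) : ℂ) ^ (-s)))
      (∫ t, ∑' v, ((F v : ℝ) * Real.exp (-∑ j, t j * x j v) : ℝ) * mellinKernel s t
        ∂orthantMeasure n) := by
  have hterm : ∀ v, (fun t => (((F v : ℝ) * Real.exp (-∑ j, t j * x j v) : ℝ) : ℂ) *
      mellinKernel s t) = fun t => (F v : ℂ) * ((Real.exp (-∑ j, t j * x j v) : ℂ) *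
        mellinKernel s t) := fun v => by
    ext t
    push_cast
    ring
  have hint : ∀ v, Integrable (fun t => (((F v : ℝ) * Real.exp (-∑ j, t j * x j v) : ℝ) : ℂ) *
      mellinKernel s t) (orthantMeasure n) := fun v => by
    rw [hterm]
    by_cases hv : F v = 0
    · simp [hv]
    · exact (integrable_exp_mul_mellinKernel hs fun j => hc₀.trans_le (hFc v hv j)).const_mul _
  have hval : ∀ v, ∫ t, (((F v : ℝ) * Real.exp (-∑ j, t j * x j v) : ℝ) : ℂ) *
      mellinKernel s t ∂orthantMeasure n =
        Complex.Gamma s ^ n * ((F v : ℂ) * ((∏ j, x j v : ℝ) : ℂ) ^ (-s)) := fun v => by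
    rw [hterm]
    by_cases hv : F v = 0
    · simp [hv]
    · rw [integral_const_mul, integral_exp_mul_mellinKernel hs fun j => hc₀.trans_le (hFc v hv j)]
      ring
  have hnorm : ∀ v, ∫ t, ‖(((F v : ℝ) * Real.exp (-∑ j, t j * x j v) : ℝ) : ℂ) *
      mellinKernel s t‖ ∂orthantMeasure n =
        Real.Gamma s.re ^ n * (|(F v : ℝ)| * (∏ j, x j v) ^ (-s.re)) := fun v => by
    by_cases hv : F v = 0
    · simp [hv]
    · have : ∀ t, ‖(((F v : ℝ) * Real.exp (-∑ j, t j * x j v) : ℝ) : ℂ) * mellinKernel s t‖ =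
          |(F v : ℝ)| * ‖(Real.exp (-∑ j, t j * x j v) : ℂ) * mellinKernel s t‖ := fun t => by
        rw [Complex.ofReal_mul, mul_assoc, norm_mul, Complex.norm_real, Real.norm_eq_abs]
      simp only [this]
      rw [integral_const_mul, integral_norm_exp_mul_mellinKernel hs fun j =>
        hc₀.trans_le (hFc v hv j)]
      ring
  have h := hasSum_integral_of_summable_integral_norm hint (by
    simp only [hnorm]
    exact hsum.mul_left _)
  simpa only [hval] using h

end Series

/-! ### Comparison of the special values -/

section Comparison

variable {n : ℕ} {x : Fin n → V n →ₗ[ℚ] ℝ}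

theorem act_apply (a : AddMonoidAlgebra ℚ (V n)) (F : V n → ℚ) (v : V n) :
    act ℚ (V n) a F v = ∑ u ∈ a.coeff.support, a.coeff u * F (v - u) := by
  have : act ℚ (V n) a F v = sumOver (fun u => F (v - u)) a := by
    induction a using AddMonoidAlgebra.induction_linear with
    | zero => simp
    | add a b ha hb => rw [map_add, map_add, LinearMap.add_apply, Pi.add_apply, ha, hb]
    | single w r => rw [act_single, sumOver_single, smul_eq_mul]
  rw [this, sumOver_apply]
  rfl

/-- Exponents of `c` are sums of one of `a`, with `x_j ≥ 0`, and one of `F`, with `x_j ≥ c₀`. -/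
theorem suppGE_realify_of_act_eq {F : V n → ℚ} {c₀ : ℝ} (hFc : ∀ v, F v ≠ 0 → ∀ j, c₀ ≤ x j v)
    {a c : AddMonoidAlgebra ℚ (V n)} (ha : ∀ v, a.coeff v ≠ 0 → ∀ j, 0 ≤ x j v)
    (h : act ℚ (V n) a F = c.coeff) : SuppGE x c₀ (realify n c) := fun v hv j => by
  rw [realify_coeff, Rat.cast_ne_zero, ← h, act_apply] at hv
  obtain ⟨u, -, hu⟩ := Finset.exists_ne_zero_of_sum_ne_zero hv
  have h1 := ha u (left_ne_zero_of_mul hu) j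
  have h2 := hFc _ (right_ne_zero_of_mul hu) j
  rw [map_sub] at h2
  linarith

/-- At `-k` a Dirichlet polynomial pairs its coefficients with the `k`-th power of the norm. -/
theorem dirichlet_neg_realify {N : MvPolynomial (Fin n) ℚ}
    (hN : ∀ v : V n, ((MvPolynomial.eval v N : ℚ) : ℝ) = ∏ j, x j v) (k : ℕ)
    (a : AddMonoidAlgebra ℚ (V n)) :
    dirichlet x (-(k : ℂ)) (realify n a) = (pair (N ^ k) a : ℚ) := by
  induction a using AddMonoidAlgebra.induction_linear with
  | zero => simp
  | add a b ha hb => rw [map_add, map_add, ha, hb, map_add, Rat.cast_add]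
  | single v r =>
    rw [realify_single, dirichlet, sumOver_single, pair_single, neg_neg, Complex.cpow_natCast,
      ← hN, Complex.real_smul]
    simp

/-- The Dirichlet series of `F` in its half-plane of convergence, in terms of a solution of
`a F = c` with `a` close to `1`. -/
theorem hasSum_tsum_dirichlet {F : V n → ℤ} {c₀ ρ : ℝ} (hc₀ : 0 < c₀)
    (hFc : ∀ v, F v ≠ 0 → ∀ j, c₀ ≤ x j v)
    (hsum : ∀ σ : ℝ, n < σ → Summable fun v => |(F v : ℝ)| * (∏ j, x j v) ^ (-σ))
    (hρ : 0 < ρ) (hρ1 : ρ < 1) {a c : AddMonoidAlgebra ℚ (V n)}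
    (hD : SuppGE x 0 (realify n (1 - a)))
    (hDρ : ∀ t : Fin n → ℝ, (∀ j, 0 ≤ t j) → |evalExp x ℝ t (realify n (1 - a))| ≤ ρ)
    (hc : SuppGE x c₀ (realify n c))
    (h : act ℚ (V n) a (fun v => (F v : ℚ)) = c.coeff) {s : ℂ} (hs : n < s.re) :
    HasSum (fun v => (F v : ℂ) * ((∏ j, x j v : ℝ) : ℂ) ^ (-s))
      (∑' i, dirichlet x s (realify n (1 - a) ^ i * realify n c)) := by
  have hs0 : 0 < s.re := (Nat.cast_nonneg n).trans_lt hs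
  have hG : Complex.Gamma s ^ n ≠ 0 := pow_ne_zero _ (Complex.Gamma_ne_zero_of_re_pos hs0)
  rw [← hasSum_mul_left_iff hG, tsum_dirichlet_eq_integral hc₀ hρ hρ1 hD hDρ hc hs0]
  refine Eq.mp (congrArg (fun z => HasSum _ z) (integral_congr_ae ?_))
    (hasSum_eq_integral hc₀ hFc hs0 (hsum _ hs))
  filter_upwards [ae_pos] with t ht
  -- The exponent `n + 1` is an integer beyond the abscissa `n`.
  have hS := summable_exp hc₀ hFc (m := n + 1) (hsum _ (by push_cast; linarith)) ht
  have h1 := evalExp_eq_mul (x := x) (F := fun v => (F v : ℚ)) (t := t) (by simpa using hS) h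
  simp only [Rat.cast_intCast] at h1
  have h2 : 1 - evalExp x ℝ t (realify n (1 - a)) = evalExp x ℚ t a := by
    rw [evalExp_realify, map_sub, map_one, sub_sub_cancel]
  have h3 : evalExp x ℚ t a ≠ 0 := by
    rw [← h2]
    linarith [(le_abs_self _).trans (hDρ t fun j => (ht j).le)]
  simp only [tsum_mul_right]
  rw [h2, evalExp_realify, h1, mul_div_cancel_left₀ _ h3, Complex.ofReal_tsum]

variable {E : Type*} [AddCommGroup E] [Module ℚ E]

/-- The values at a polynomial of a functional `Λ` with `a Λ = c`, when `1 - a` acts on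
polynomials in a locally nilpotent way. -/
theorem eq_sum_pair {F : V n → ℚ} {Λ : MvPolynomial (Fin n) ℚ →ₗ[ℚ] E} {ι : ℚ →ₗ[ℚ] E}
    {a c : AddMonoidAlgebra ℚ (V n)} (hs : Solves F Λ ι a c) {h : MvPolynomial (Fin n) ℚ} {I : ℕ}
    (hI : shiftPoly n ((1 - a) ^ I) h = 0) :
    Λ h = ι (∑ i ∈ Finset.range I, pair h ((1 - a) ^ i * c)) := by
  have h1 : a * ∑ i ∈ Finset.range I, (1 - a) ^ i + (1 - a) ^ I = 1 := by
    have := mul_neg_geom_sum (1 - a) I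
    rw [sub_sub_cancel] at this
    rw [this, sub_add_cancel]
  -- The truncated Neumann series inverts `a` on `h`, as the remainder `(1 - a)^I` kills it.
  have h2 : h = shiftPoly n a (∑ i ∈ Finset.range I, shiftPoly n ((1 - a) ^ i) h) := by
    conv_lhs => rw [← Module.End.one_apply (R := ℚ) h, ← map_one (shiftPoly n), ← h1, map_add,
      LinearMap.add_apply, hI, add_zero, shiftPoly_mul, map_sum, LinearMap.sum_apply]
  conv_lhs => rw [h2]
  rw [map_sum, map_sum, map_sum]
  refine Finset.sum_congr rfl fun i _ => ?_
  rw [hs.functional_eq, pair_mul]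

/-- The same expansion of `a⁻¹` in powers of `1 - a` yields a convergent series for the zeta
function and a finite sum for `Λ(N^k)`, and the two agree term by term at `s = -k`. -/
theorem exists_continuation {F : V n → ℤ} {c₀ : ℝ} (hc₀ : 0 < c₀)
    (hFc : ∀ v, F v ≠ 0 → ∀ j, c₀ ≤ x j v)
    (hsum : ∀ σ : ℝ, n < σ → Summable fun v => |(F v : ℝ)| * (∏ j, x j v) ^ (-σ))
    {Λ : MvPolynomial (Fin n) ℚ →ₗ[ℚ] E} {ι : ℚ →ₗ[ℚ] E} {b c : AddMonoidAlgebra ℚ (V n)}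
    (hb : IsPositive x b) (hs : Solves (fun v => (F v : ℚ)) Λ ι b c)
    {N : MvPolynomial (Fin n) ℚ}
    (hN : ∀ v : V n, ((MvPolynomial.eval v N : ℚ) : ℝ) = ∏ j, x j v) :
    ∃ Z : ℂ → ℂ, Differentiable ℂ Z ∧
      (∀ s : ℂ, n < s.re →
        HasSum (fun v => (F v : ℂ) * ((∏ j, x j v : ℝ) : ℂ) ^ (-s)) (Z s)) ∧
      ∀ k : ℕ, ∃ q : ℚ, Λ (N ^ k) = ι q ∧ Z (-(k : ℂ)) = q := by
  set m : ℚ := aug n b with hm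
  have hm1 : (1 : ℝ) ≤ m := (hb.one_le 0 fun _ => le_rfl).trans (hb.le_aug 0 fun _ => le_rfl)
  have hm0 : (0 : ℝ) < m := one_pos.trans_le hm1
  have hm0' : m ≠ 0 := by exact_mod_cast hm0.ne'
  -- Augmentation `1` makes `1 - a` locally nilpotent on polynomials, while the bounds on `b` give
  -- `m⁻¹ ≤ a ≤ 1` on `t ≥ 0`.
  set a : AddMonoidAlgebra ℚ (V n) := m⁻¹ • b with ha
  set c' : AddMonoidAlgebra ℚ (V n) := m⁻¹ • c with hc'
  have hsupp : ∀ v, a.coeff v ≠ 0 → ∀ j, 0 ≤ x j v := fun v hv =>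
    hb.support v fun h => hv (by simp [ha, h])
  have hs' : Solves (fun v => (F v : ℚ)) Λ ι a c' :=
    ⟨by rw [ha, map_smul, LinearMap.smul_apply, hs.act_eq]; rfl, fun h => by
      rw [ha, map_smul, LinearMap.smul_apply, map_smul, hs.functional_eq, hc', map_smul, map_smul]⟩
  have haug : aug n (1 - a) = 0 := by
    rw [map_sub, map_one, ha, map_smul, smul_eq_mul, inv_mul_cancel₀ hm0', sub_self]
  have hD : SuppGE x 0 (realify n (1 - a)) := fun v hv => by
    rw [realify_coeff, Rat.cast_ne_zero] at hv
    by_cases h : a.coeff v = 0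
    · refine isPositive_one.support v fun h1 => hv ?_
      rw [AddMonoidAlgebra.coeff_sub, Finsupp.sub_apply, h, h1, sub_zero]
    · exact hsupp v h
  have hc : SuppGE x c₀ (realify n c') :=
    suppGE_realify_of_act_eq (fun v hv => hFc v (by exact_mod_cast hv)) hsupp hs'.act_eq
  -- The maximum with `1 / 2` keeps `ρ` positive when `m = 1`.
  set ρ : ℝ := max (1 / 2) (1 - (m : ℝ)⁻¹) with hρdef
  have hρ : 0 < ρ := lt_max_of_lt_left (by norm_num)
  have hρ1 : ρ < 1 := max_lt (by norm_num) (by linarith [inv_pos.mpr hm0])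
  have hDρ : ∀ t : Fin n → ℝ, (∀ j, 0 ≤ t j) → |evalExp x ℝ t (realify n (1 - a))| ≤ ρ := by
    intro t ht
    have e1 : evalExp x ℚ t a = (m : ℝ)⁻¹ * evalExp x ℚ t b := by
      rw [ha, map_smul, Rat.smul_def, Rat.cast_inv]
    have h1 : (m : ℝ)⁻¹ ≤ evalExp x ℚ t a := by
      rw [e1]
      exact le_mul_of_one_le_right (inv_pos.mpr hm0).le (hb.one_le t ht)
    have h2 : evalExp x ℚ t a ≤ 1 := by
      rw [e1, inv_mul_le_iff₀ hm0, mul_one]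
      exact hb.le_aug t ht
    rw [evalExp_realify, map_sub, map_one, abs_of_nonneg (by linarith)]
    exact le_max_of_le_right (by linarith)
  refine ⟨fun s => ∑' i, dirichlet x s (realify n (1 - a) ^ i * realify n c'),
    differentiable_tsum_dirichlet hc₀ hρ hρ1 hD hDρ hc,
    fun s => hasSum_tsum_dirichlet hc₀ hFc hsum hρ hρ1 hD hDρ hc hs'.act_eq, fun k => ?_⟩
  obtain ⟨I, hI⟩ := exists_shiftPoly_pow_eq_zero haug (N ^ k)
  refine ⟨_, eq_sum_pair hs' (hI I le_rfl), ?_⟩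
  simp only [← map_pow, ← map_mul, dirichlet_neg_realify hN]
  rw [Rat.cast_sum]
  -- The terms with `i ≥ I` vanish at `s = -k`, leaving the sum that computes `Λ(N^k)`.
  refine tsum_eq_sum fun i hi => ?_
  rw [pair_mul, hI i (by simpa using hi), pair_zero_left, Rat.cast_zero]

end Comparison

end Shintani

end

/-! ### The theorem -/

theorem propositionP (n p : ℕ) [Fact p.Prime]
    (e : Module.Basis (Fin n) ℝ (Fin n → ℝ))
    (N : MvPolynomial (Fin n) ℚ)
    (hN : ∀ v : Shintani.V n,
      ((MvPolynomial.eval v N : ℚ) : ℝ) = Shintani.normForm e (Shintani.toReal v))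
    (f : Shintani.V n → ℤ) (hf : f ∈ Shintani.TestFunctionsAway n p)
    (C : Set (Fin n → ℝ)) (hC : Shintani.IsRationalSimplicialCone C)
    (hCpos : C ⊆ Shintani.positiveOrthant e)
    (U W : TopologicalSpace.CompactOpens (Shintani.Lp n p)) (hUW : U ≤ W)
    (ξ : Shintani.PseudoMeasure n p) (hξ : Shintani.IsConePseudoMeasure f C (W : Set _) ξ)
    (μ : Shintani.PMeasure n p) (hμ : algebraMap _ (Shintani.PseudoMeasure n p) μ = ξ) :
    ∃ Z : ℂ → ℂ,
      Shintani.IsShintaniZeta e (Shintani.tensorIndicator f (U : Set (Shintani.Lp n p))) C Z ∧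
      ∀ k : ℕ, AnalyticAt ℂ Z (-(k : ℂ)) ∧
        ∃ q : ℚ, Shintani.integralPow μ N k U = (q : ℚ_[p]) ∧ Z (-(k : ℂ)) = (q : ℂ) := by
  classical
  set F : Shintani.V n → ℤ :=
    Shintani.coneFun (Shintani.tensorIndicator f (U : Set (Shintani.Lp n p))) C with hF
  obtain ⟨⟨B, hB⟩, M, hM, hfM⟩ :=
    Shintani.exists_bound_tensorIndicator hf (U : Set (Shintani.Lp n p))
  obtain ⟨c₀, hc₀, hCc⟩ := Shintani.exists_pos_le_coordHom e hC hCpos hM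
  have hF0 : ∀ v, F v ≠ 0 → Shintani.toReal v ∈ C ∧ v ∈ Shintani.scaledLattice n M := fun v hv => by
    rw [hF, Shintani.coneFun] at hv
    split_ifs at hv with h
    · exact ⟨h, hfM v hv⟩
    · exact absurd rfl hv
  have hFB : ∀ v, |F v| ≤ B := fun v => by
    rw [hF, Shintani.coneFun]
    split_ifs
    · exact hB v
    · simpa using (abs_nonneg _).trans (hB v)
  have hFc : ∀ v, F v ≠ 0 → ∀ j, c₀ ≤ Shintani.coordHom e j v := fun v hv =>
    hCc v (hF0 v hv).2 (hF0 v hv).1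
  obtain ⟨ws, c, hws, hact, hfun⟩ := Shintani.exists_integralOn_eq_pair hUW hξ hμ
  -- The functional `Λ` takes values in `ℚ_p`; injectivity of `ℚ → ℚ_p` brings its identities back
  -- to rational numbers.
  obtain ⟨b, c', hb, hs⟩ := Shintani.exists_isPositive (x := Shintani.coordHom e)
    (Shintani.eq_zero_of_coordHom e) (ι := Algebra.linearMap ℚ ℚ_[p])
    (algebraMap ℚ ℚ_[p]).injective hws (H := fun v => (F v : ℚ))
    ⟨c₀, fun v hv => hFc v (Int.cast_ne_zero.mp hv)⟩ (Λ := Shintani.integralOn μ U) (c := c)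
    ⟨hact, hfun⟩
  obtain ⟨Z, hZ, hZsum, hZval⟩ := Shintani.exists_continuation hc₀ hFc
    (fun σ hσ => Shintani.summable_normForm e hFB hM (fun v hv => (hF0 v hv).2) hc₀ hFc hσ)
    hb hs hN
  refine ⟨Z, ⟨fun z _ => (hZ.analyticAt z).meromorphicAt, n, fun s hsn => ?_⟩, fun k =>
    ⟨hZ.analyticAt _, ?_⟩⟩
  · convert hZsum s hsn using 2 with v
    rw [Shintani.zetaTerm, hF, Shintani.coneFun, Shintani.normForm_toReal]
    split_ifs <;> simp
  · obtain ⟨q, hq, hq'⟩ := hZval k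
    exact ⟨q, (Shintani.integralPow_eq μ N k U).trans hq, hq'⟩
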